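/- Let $M$ be a smooth manifold of dimension $N\ge 2$ with a smooth Riemannian metric $a_{ij}(x)$, a smooth 1-form $b_i(x)$ with $a^{ij}b_ib_j=1$, and a smooth function $g(x)$ with $-2<g(x)<2$. For $y\in T_xM$ put $b=b_iy^i$, $q=\sqrt{a_{ij}y^iy^j-b^2}$, $h=\sqrt{1-g^2/4}$, $G=g/h$, $B=b^2+gbq+q^2$, $L=q+\tfrac g2 b$, and let $$K(x,y)=\sqrt{B}\,e^{-\frac12 Gf},\qquad f=-\arctan\tfrac G2+\arctan\tfrac{L}{hb}\ (b>0),\quad f=\pi-\arctan\tfrac G2+\arctan\tfrac{L}{hb}\ (b<0),\quad f=\tfrac\pi2-\arctan\tfrac G2\ (b=0)$$ (the Finsleroid–Finsler metric function). In local coordinates put $$g_{ij}=\tfrac12\frac{\partial^2K^2}{\partial y^i\partial y^j},\quad l^i=\frac{y^i}{K},\quad l_i=g_{ij}l^j,\quad h_{ij}=g_{ij}-l_il_j,\quad A_{ijk}=\tfrac K2\frac{\partial g_{ij}}{\partial y^k},\quad A_k=g^{ij}A_{ijk},$$ $$\|A\|=\sqrt{A^kA_k},\quad \alpha_{ijk}=\frac{A_{ijk}}{\|A\|},\quad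 \alpha_k=\frac{A_k}{\|A\|},\quad \mathcal H_{ij}=h_{ij}-\alpha_i\alpha_j .$$ Let ${}_{|k}$ be the $h$-covariant derivative of the Chern connection of $K$: with $\gamma^k{}_{ij}=\tfrac12 g^{kn}(\partial_{x^j}g_{ni}+\partial_{x^i}g_{nj}-\partial_{x^n}g_{ji})$, $G^k=\gamma^k{}_{ij}y^iy^j$, $\bar G^k{}_i=\tfrac12\partial G^k/\partial y^i$, $C_{ijk}=A_{ijk}/K$, $$\Gamma^k{}_{ij}=\gamma^k{}_{ij}-\bar G^n{}_iC_n{}^k{}_j-\bar G^n{}_jC_n{}^k{}_i+g^{km}\bar G^n{}_mC_{nij},\qquad T_{i|j}=\frac{\partial T_i}{\partial x^j}-\bar G^k{}_j\frac{\partial T_i}{\partial y^k}-\Gamma^k{}_{ij}T_k,$$ and similarly for tensors $T_{ijk}$; the dot denotes ${}_{|m}l^m$. THEOREM 3.1. Suppose that the space is involutive, i.e. $g_i:=\partial g/\partial x^i=\mu(x)b_i$ for some function $\mu$ on $M$, and $b$-parallel, i.e. $\nabla_ib_j=0$ for the Levi-Civita connection $\nabla$ of $a_{ij}$. Then, in all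 local coordinates and at all $(x,y)$ with $g(x)\ne0$ and $q(x,y)\neq 0$ (that is, $y$ is not collinear to the vector $b^i=a^{ij}b_j$): $K>0$, $K$ is smooth near $(x,y)$, the matrix $(g_{ij})$ is invertible and $\|A\|>0$, so that all the objects above are well defined there; the $A$-special relation $$A_{i|k}=\frac1g\,g_kA_i+\eta\,\mathcal H_{ik}$$ holds with the scalar $$\eta=\frac{\mu Ng}{4Kq}\,\bigl(B\mathcal M-bq\bigr),\qquad \mathcal M=-\frac{f}{h^3}+\frac{G q^2}{2hB}+\frac{bq}{h^2B};$$ and consequently the normalized Cartan tensor and vector satisfy $\dot\alpha_{ijk}=0$ and $\dot\alpha_i=0$. -/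

import Mathlib

open scoped Manifold ContDiff Bundle

/- A model space carries its standard manifold structure (the instance is given precedence so that
instance search does not return it wrapped in other instances). -/
attribute [local instance 2000] chartedSpaceSelf

noncomputable section

/-! ## Finsler geometry in a coordinate chart

A Finsler metric function in local coordinates is `F : Vec N → Vec N → ℝ`, `(x, y) ↦ F x y`, where
`x` are the coordinates of the point and `y` the components of the tangent vector. Components of
Finslerian tensors are functions of the line element `(x, y)`. All of the objects below are computed
from `F` by the usual rules; sums over repeated indices are written out. -/

/-- The coordinate space `ℝ^N`. -/
abbrev Vec (N : ℕ) : Type := EuclideanSpace ℝ (Fin N)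

/-- Scalar functions of the line element `(x, y)`. -/
abbrev LineFun (N : ℕ) : Type := Vec N → Vec N → ℝ

namespace Finsler

variable {N : ℕ}

/-- `∂f/∂xⁱ` (with `y` fixed). -/
def pdx (f : LineFun N) (i : Fin N) : LineFun N := fun x y =>
  fderiv ℝ (fun x' => f x' y) x (EuclideanSpace.single i 1)

/-- `∂f/∂yⁱ` (with `x` fixed). -/
def pdy (f : LineFun N) (i : Fin N) : LineFun N := fun x y =>
  fderiv ℝ (fun y' => f x y') y (EuclideanSpace.single i 1)

/-- The Finslerian metric tensor `g_{ij} = (1/2) ∂²F²/∂yⁱ∂yʲ`. -/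
def gLow (F : LineFun N) (i j : Fin N) : LineFun N := fun x y =>
  (1 / 2) * pdy (pdy (fun x y => F x y ^ 2) i) j x y

/-- The matrix `(g_{ij})`. -/
def gMat (F : LineFun N) (x y : Vec N) : Matrix (Fin N) (Fin N) ℝ :=
  Matrix.of fun i j => gLow F i j x y

/-- The reciprocal tensor `g^{ij}`. -/
def gUp (F : LineFun N) (i j : Fin N) : LineFun N := fun x y => (gMat F x y)⁻¹ i j

/-- `lⁱ = yⁱ / F`. -/
def lUp (F : LineFun N) (i : Fin N) : LineFun N := fun x y => y i / F x y

/-- `l_i = g_{ij} lʲ`. -/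
def lLow (F : LineFun N) (i : Fin N) : LineFun N := fun x y =>
  ∑ j, gLow F i j x y * lUp F j x y

/-- The angular metric tensor `h_{ij} = g_{ij} - l_i l_j`. -/
def angular (F : LineFun N) (i j : Fin N) : LineFun N := fun x y =>
  gLow F i j x y - lLow F i x y * lLow F j x y

/-- The Cartan tensor `A_{ijk} = (F/2) ∂g_{ij}/∂yᵏ`. -/
def cartan (F : LineFun N) (i j k : Fin N) : LineFun N := fun x y =>
  F x y / 2 * pdy (gLow F i j) k x y

/-- `A_k = g^{ij} A_{ijk}`. -/
def cartanVec (F : LineFun N) (k : Fin N) : LineFun N := fun x y =>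
  ∑ i, ∑ j, gUp F i j x y * cartan F i j k x y

/-- `Aᵏ = g^{kj} A_j`. -/
def cartanVecUp (F : LineFun N) (k : Fin N) : LineFun N := fun x y =>
  ∑ j, gUp F k j x y * cartanVec F j x y

/-- `‖A‖ = √(Aᵏ A_k)`. -/
def cartanNorm (F : LineFun N) : LineFun N := fun x y =>
  Real.sqrt (∑ k, cartanVecUp F k x y * cartanVec F k x y)

/-- The normalized Cartan tensor `α_{ijk} = A_{ijk} / ‖A‖`. -/
def alphaTensor (F : LineFun N) (i j k : Fin N) : LineFun N := fun x y =>
  1 / cartanNorm F x y * cartan F i j k x y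

/-- The normalized vector `α_k = A_k / ‖A‖`. -/
def alphaVec (F : LineFun N) (k : Fin N) : LineFun N := fun x y =>
  1 / cartanNorm F x y * cartanVec F k x y

/-- The tensor `𝓗_{ij} = h_{ij} - α_i α_j`. -/
def calH (F : LineFun N) (i j : Fin N) : LineFun N := fun x y =>
  angular F i j x y - alphaVec F i x y * alphaVec F j x y

/-- The Finslerian Christoffel symbols
`γᵏ_{ij} = (1/2) g^{kn} (∂g_{ni}/∂xʲ + ∂g_{nj}/∂xⁱ - ∂g_{ji}/∂xⁿ)`. -/
def christoffel (F : LineFun N) (k i j : Fin N) : LineFun N := fun x y =>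
  (1 / 2) * ∑ n, gUp F k n x y *
    (pdx (gLow F n i) j x y + pdx (gLow F n j) i x y - pdx (gLow F j i) n x y)

/-- The spray coefficients `Gᵏ = γᵏ_{ij} yⁱ yʲ`. -/
def spray (F : LineFun N) (k : Fin N) : LineFun N := fun x y =>
  ∑ i, ∑ j, christoffel F k i j x y * y i * y j

/-- The nonlinear connection coefficients `Ḡᵏ_i = (1/2) ∂Gᵏ/∂yⁱ`. -/
def nonlin (F : LineFun N) (k i : Fin N) : LineFun N := fun x y =>
  (1 / 2) * pdy (spray F k) i x y

/-- `Ḡ^{kn} = g^{km} Ḡⁿ_m`: the lower index of the nonlinear connection is raised and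
becomes the free index `k` of the (Chern) connection coefficients below. -/
def nonlinUp (F : LineFun N) (k n : Fin N) : LineFun N := fun x y =>
  ∑ m, gUp F k m x y * nonlin F n m x y

/-- `C_{ijk} = A_{ijk} / F`. -/
def cTensor (F : LineFun N) (i j k : Fin N) : LineFun N := fun x y =>
  cartan F i j k x y / F x y

/-- `C_n{}ᵏ_j = g^{km} C_{nmj}`. -/
def cMixed (F : LineFun N) (n k j : Fin N) : LineFun N := fun x y =>
  ∑ m, gUp F k m x y * cTensor F n m j x y

/-- The connection coefficients of `h`-type
`Γᵏ_{ij} = γᵏ_{ij} - Ḡⁿ_i C_n{}ᵏ_j - Ḡⁿ_j C_n{}ᵏ_i + Ḡ^{kn} C_{nij}`. -/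
def conn (F : LineFun N) (k i j : Fin N) : LineFun N := fun x y =>
  christoffel F k i j x y - ∑ n, nonlin F n i x y * cMixed F n k j x y
    - ∑ n, nonlin F n j x y * cMixed F n k i x y
    + ∑ n, nonlinUp F k n x y * cTensor F n i j x y

/-- The horizontal derivative `∂f/∂xʲ - Ḡᵏ_j ∂f/∂yᵏ` of a component function. -/
def horiz (F : LineFun N) (f : LineFun N) (j : Fin N) : LineFun N := fun x y =>
  pdx f j x y - ∑ k, nonlin F k j x y * pdy f k x y

/-- The `h`-covariant derivative `T_{i|j}` of a covariant vector. -/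
def hCov₁ (F : LineFun N) (T : Fin N → LineFun N) (i j : Fin N) : LineFun N := fun x y =>
  horiz F (T i) j x y - ∑ k, conn F k i j x y * T k x y

/-- The `h`-covariant derivative `T_{ijk|m}` of a covariant tensor of third order. -/
def hCov₃ (F : LineFun N) (T : Fin N → Fin N → Fin N → LineFun N) (i j k m : Fin N) :
    LineFun N := fun x y =>
  horiz F (T i j k) m x y - ∑ n, conn F n i m x y * T n j k x y
    - ∑ n, conn F n j m x y * T i n k x y - ∑ n, conn F n k m x y * T i j n x y

/-- `Ṫ_i = T_{i|m} lᵐ`. -/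
def dot₁ (F : LineFun N) (T : Fin N → LineFun N) (i : Fin N) : LineFun N := fun x y =>
  ∑ m, hCov₁ F T i m x y * lUp F m x y

/-- `Ṫ_{ijk} = T_{ijk|m} lᵐ`. -/
def dot₃ (F : LineFun N) (T : Fin N → Fin N → Fin N → LineFun N) (i j k : Fin N) :
    LineFun N := fun x y =>
  ∑ m, hCov₃ F T i j k m x y * lUp F m x y

end Finsler

/-! ## The Finsleroid--Finsler space -/

section Finsleroid

variable {N : ℕ} {M : Type*} [TopologicalSpace M] [ChartedSpace (Vec N) M]
  [IsManifold (𝓡 N) ∞ M]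

/-- Smooth Riemannian metrics on `M`. -/
abbrev RiemMetric (N : ℕ) (M : Type*) [TopologicalSpace M] [ChartedSpace (Vec N) M]
    [IsManifold (𝓡 N) ∞ M] : Type _ :=
  Bundle.ContMDiffRiemannianMetric (𝓡 N) ∞ (Vec N) (fun p : M => TangentSpace (𝓡 N) p)

/-- The tangent vector `yⁱ ∂/∂xⁱ` at the point with coordinates `x` in the chart `φ`. -/
def chartVec (φ : OpenPartialHomeomorph M (Vec N)) (x y : Vec N) :
    TangentSpace (𝓡 N) (φ.symm x) :=
  mfderiv (𝓡 N) (𝓡 N) φ.symm x y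

/-- The components `a_{ij}(x)` of a Riemannian metric in the chart `φ`. -/
def metricMat (a : RiemMetric N M) (φ : OpenPartialHomeomorph M (Vec N)) (x : Vec N) :
    Matrix (Fin N) (Fin N) ℝ :=
  Matrix.of fun i j => a.inner (φ.symm x) (chartVec φ x (EuclideanSpace.single i 1))
    (chartVec φ x (EuclideanSpace.single j 1))

/-- The components `b_i(x)` of a 1-form in the chart `φ`. -/
def formComp (b : ∀ p : M, TangentSpace (𝓡 N) p →L[ℝ] ℝ)
    (φ : OpenPartialHomeomorph M (Vec N)) (i : Fin N) (x : Vec N) : ℝ :=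
  b (φ.symm x) (chartVec φ x (EuclideanSpace.single i 1))

variable (N M) in
/-- The input data of a Finsleroid--Finsler space: a smooth Riemannian metric `a`, a smooth 1-form
`b` of unit Riemannian norm, and a smooth scalar `g` with `-2 < g < 2`. -/
structure FinsleroidSpace where
  a : RiemMetric N M
  b : ∀ p : M, TangentSpace (𝓡 N) p →L[ℝ] ℝ
  b_smooth : ContMDiff (𝓡 N) ((𝓡 N).prod 𝓘(ℝ, Vec N →L[ℝ] ℝ)) ∞
    (fun p => Bundle.TotalSpace.mk' (Vec N →L[ℝ] ℝ)
      (E := fun p : M => TangentSpace (𝓡 N) p →L[ℝ] ℝ) p (b p))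
  /-- `a^{ij} b_i b_j = 1` -/
  b_unit : ∀ φ ∈ IsManifold.maximalAtlas (𝓡 N) ∞ M, ∀ x ∈ φ.target,
    ∑ i, ∑ j, (metricMat a φ x)⁻¹ i j * formComp b φ i x * formComp b φ j x = 1
  g : M → ℝ
  g_smooth : ContMDiff (𝓡 N) 𝓘(ℝ, ℝ) ∞ g
  g_gt : ∀ p, -2 < g p
  g_lt : ∀ p, g p < 2

namespace FinsleroidSpace

variable (D : FinsleroidSpace N M) {p : M} (v : TangentSpace (𝓡 N) p)

/-- `q = √(S² - b²)`, where `S² = a(v, v)` and `b = b(v)`. -/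
def q : ℝ := Real.sqrt (D.a.inner p v v - D.b p v ^ 2)

variable (p) in
/-- `h = √(1 - g²/4)`. -/
def h : ℝ := Real.sqrt (1 - D.g p ^ 2 / 4)

variable (p) in
/-- `G = g / h`. -/
def G : ℝ := D.g p / D.h p

/-- The Finsleroid--characteristic quadratic form `B = b² + g b q + q²`. -/
def B : ℝ := D.b p v ^ 2 + D.g p * D.b p v * D.q v + D.q v ^ 2

/-- `L = q + (g/2) b`. -/
def L : ℝ := D.q v + D.g p / 2 * D.b p v

open Classical in
/-- The angle function `f`. For `b = 0` the common limit of the two expressions is taken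
(there `L / (h b)` tends to `±∞`). -/
def f : ℝ :=
  if 0 < D.b p v then
    -Real.arctan (D.G p / 2) + Real.arctan (D.L v / (D.h p * D.b p v))
  else if D.b p v < 0 then
    Real.pi - Real.arctan (D.G p / 2) + Real.arctan (D.L v / (D.h p * D.b p v))
  else Real.pi / 2 - Real.arctan (D.G p / 2)

/-- The Finsleroid--Finsler metric function `K = √B · exp(-G f / 2)`. -/
def K : ℝ := Real.sqrt (D.B v) * Real.exp (-(1 / 2) * D.G p * D.f v)

/-- The function `M = ∂ ln K² / ∂g` in explicit form,
`M = -f/h³ + G q² / (2 h B) + b q / (h² B)`. -/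
def Mfun : ℝ :=
  -(D.f v / D.h p ^ 3) + D.G p * D.q v ^ 2 / (2 * D.h p * D.B v)
    + D.b p v * D.q v / (D.h p ^ 2 * D.B v)

/-- The scalar `η = μ N g (B M - b q) / (4 K q)`. -/
def eta (μ : M → ℝ) : ℝ :=
  μ p * N * D.g p / (4 * D.K v * D.q v) * (D.B v * D.Mfun v - D.b p v * D.q v)


/-- The metric function `K` in the coordinates of the chart `φ`. -/
def Kloc (φ : OpenPartialHomeomorph M (Vec N)) : LineFun N := fun x y =>
  D.K (chartVec φ x y)

/-- The gradient components `g_i = ∂g/∂xⁱ` in the chart `φ`. -/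
def gradG (φ : OpenPartialHomeomorph M (Vec N)) (i : Fin N) (x : Vec N) : ℝ :=
  fderiv ℝ (fun x' => D.g (φ.symm x')) x (EuclideanSpace.single i 1)

/-- The Riemannian Christoffel symbols
`aᵏ_{ij} = (1/2) a^{kn} (∂_j a_{ni} + ∂_i a_{nj} - ∂_n a_{ji})` in the chart `φ`. -/
def riemChristoffel (φ : OpenPartialHomeomorph M (Vec N)) (k i j : Fin N) (x : Vec N) : ℝ :=
  (1 / 2) * ∑ n, (metricMat D.a φ x)⁻¹ k n *
    (fderiv ℝ (fun x' => metricMat D.a φ x' n i) x (EuclideanSpace.single j 1)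
      + fderiv ℝ (fun x' => metricMat D.a φ x' n j) x (EuclideanSpace.single i 1)
      - fderiv ℝ (fun x' => metricMat D.a φ x' j i) x (EuclideanSpace.single n 1))

/-- The Riemannian covariant derivative `∇_i b_j = ∂_i b_j - b_k aᵏ_{ij}` in the chart `φ`. -/
def nablaB (φ : OpenPartialHomeomorph M (Vec N)) (i j : Fin N) (x : Vec N) : ℝ :=
  fderiv ℝ (formComp D.b φ j) x (EuclideanSpace.single i 1)
    - ∑ k, formComp D.b φ k x * D.riemChristoffel φ k i j x

/-- The space is `b`-parallel: `∇_i b_j = 0`. -/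
def IsBParallel : Prop :=
  ∀ φ ∈ IsManifold.maximalAtlas (𝓡 N) ∞ M, ∀ x ∈ φ.target, ∀ i j, D.nablaB φ i j x = 0

/-- The space is involutive with involution scalar `μ`: `g_i = μ b_i`. -/
def IsInvolutive (μ : M → ℝ) : Prop :=
  ∀ φ ∈ IsManifold.maximalAtlas (𝓡 N) ∞ M, ∀ x ∈ φ.target, ∀ i,
    D.gradG φ i x = μ (φ.symm x) * formComp D.b φ i x

end FinsleroidSpace
end Finsleroid

end

/-!
# The Cartan vector of a `b`-parallel involutive Finsleroid--Finsler space

In a chart everything is computed from the scalars `g`, `b`, `q` and the pointwise orthogonal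
splitting of the covectors into `b_i`, `ω_i = ∂q/∂yⁱ` and the complement of `b` and `y`, on which
the Riemannian metric is `r_{ij} = a_{ij} - b_i b_j - ω_i ω_j`. Two facts make the computation
finite:

* vertically, `∂b/∂yᵏ = b_k`, `∂q/∂yᵏ = ω_k`, `∂ω_i/∂yᵏ = r_{ik}/q` (`lineDer_vertical`);
* horizontally, since `∇a = 0` and `∇b = 0`, the Riemannian horizontal derivative annihilates `b`
  and `q`, acts on `b_i`, `ω_i`, `a_{ij}` through the Christoffel symbols alone, and `g` changes by
  `μ b_k` (`lineDer_horizontal`). So an `x`-derivative of a Finslerian object is its derivative in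
  the parameter `g`, times `μ b_k`, plus Riemannian terms.

With `J = K²/B`, `m_i = (b + g q) b_i + q ω_i` and `n_i = q b_i - b ω_i` the metric tensor is
`g_{ij} = J r_{ij} + (J/B)(m_i m_j + n_i n_j)` (`gLow_eq`), its Cartan tensor is
`C_{ijk} = (g J / 2B) (r_{ij} n_k + r_{ik} n_j + r_{jk} n_i + (2/B) n_i n_j n_k)` (`cartan_eq`), and
`A_k = (N/2)(g K / B) n_k`, `‖A‖ = N |g| / 2` (`cartanVec_eq`, `cartanNorm_eq`). All these are
block tensors, i.e. combinations of `r` and of products of `b_i` and `ω_i`, and contractions of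
block tensors are block tensors again with explicit coefficients. Thus the spray is the Riemannian
one plus an explicit vector proportional to `μ` (`spray_eq`), the nonlinear connection and the Chern
connection are the Riemannian ones plus block tensors (`nonlin_eq`, `conn_eq`), and in `A_{i|k}` the
Riemannian terms cancel; what remains is the asserted combination of `b_k n_i` and `r_{ik}`
(`hCov₁_aE`), where `J r_{ik} = 𝓗_{ik}` (`calH_eq`).

For the normalized tensor, `α_{ijk}` is, up to the factor `1/N`, the sum of `α_i 𝓗_{jk}` over the
three positions of the single index and of `2 α_i α_j α_k` (`alphaTensor_eq`). The operation
`T ↦ T_{|m} lᵐ` is a derivation of the tensor algebra, so it is enough that it annihilates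
`𝓗_{ij}` and `α_i` (`flowDer_rhoE`, `flowDer_alphaE`).
-/

noncomputable section

/-! ### The metric function in terms of the scalars `g`, `b`, `q` -/

namespace Finsleroid

/-- `h = √(1 - g²/4)` as a function of the number `g`. -/
def hFun (g : ℝ) : ℝ := Real.sqrt (1 - g ^ 2 / 4)

/-- `B = b² + g b q + q²` as a function of the numbers `g`, `b`, `q`. -/
def BFun (g b q : ℝ) : ℝ := b ^ 2 + g * b * q + q ^ 2

open Classical in
/-- The angle `f` as a function of the numbers `g`, `b`, `q`. -/
def angleFun (g b q : ℝ) : ℝ :=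
  if 0 < b then -Real.arctan (g / hFun g / 2) + Real.arctan ((q + g / 2 * b) / (hFun g * b))
  else if b < 0 then
    Real.pi - Real.arctan (g / hFun g / 2) + Real.arctan ((q + g / 2 * b) / (hFun g * b))
  else Real.pi / 2 - Real.arctan (g / hFun g / 2)

/-- `K` as a function of the numbers `g`, `b`, `q`. -/
def KFun (g b q : ℝ) : ℝ :=
  Real.sqrt (BFun g b q) * Real.exp (-(1 / 2) * (g / hFun g) * angleFun g b q)

/-- `M = ∂ ln K² / ∂g` as a function of the numbers `g`, `b`, `q`. -/
def MFun (g b q : ℝ) : ℝ :=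
  -(angleFun g b q / hFun g ^ 3) + g / hFun g * q ^ 2 / (2 * hFun g * BFun g b q)
    + b * q / (hFun g ^ 2 * BFun g b q)

/-- The conformal factor `J = K² / B = exp (-G f)`. -/
def JFun (g b q : ℝ) : ℝ := KFun g b q ^ 2 / BFun g b q

section

variable {g b q : ℝ}

lemma hFun_sq (h1 : -2 < g) (h2 : g < 2) : hFun g ^ 2 = 1 - g ^ 2 / 4 :=
  Real.sq_sqrt (by nlinarith)

lemma hFun_pos (h1 : -2 < g) (h2 : g < 2) : 0 < hFun g :=
  Real.sqrt_pos.2 (by nlinarith)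

lemma BFun_pos (h1 : -2 < g) (h2 : g < 2) (hq : 0 < q) : 0 < BFun g b q := by
  have h3 : 0 < (1 - g ^ 2 / 4) * q ^ 2 := mul_pos (by nlinarith) (by positivity)
  have : BFun g b q = (b + g * q / 2) ^ 2 + (1 - g ^ 2 / 4) * q ^ 2 := by unfold BFun; ring
  rw [this]; positivity

lemma KFun_pos (h1 : -2 < g) (h2 : g < 2) (hq : 0 < q) : 0 < KFun g b q :=
  mul_pos (Real.sqrt_pos.2 (BFun_pos h1 h2 hq)) (Real.exp_pos _)

lemma JFun_pos (h1 : -2 < g) (h2 : g < 2) (hq : 0 < q) : 0 < JFun g b q :=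
  div_pos (pow_pos (KFun_pos h1 h2 hq) 2) (BFun_pos h1 h2 hq)

lemma KFun_sq (h1 : -2 < g) (h2 : g < 2) (hq : 0 < q) :
    KFun g b q ^ 2 = BFun g b q * JFun g b q := by
  unfold JFun
  field_simp [(BFun_pos (b := b) h1 h2 hq).ne']

lemma BFun_eq_angle (h1 : -2 < g) (h2 : g < 2) :
    (b + g * q / 2) ^ 2 + (hFun g * q) ^ 2 = BFun g b q := by
  rw [mul_pow, hFun_sq h1 h2]; unfold BFun; ring

end

section Angle

variable {g b q : ℝ}

/-- For `q > 0` the three branches of the angle are one arc cotangent, which is smooth across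
`b = 0`. -/
lemma angleFun_eq (h1 : -2 < g) (h2 : g < 2) (hq : 0 < q) :
    angleFun g b q = Real.pi / 2 - Real.arctan ((b + g * q / 2) / (hFun g * q)) := by
  have hp := hFun_pos h1 h2
  have e2 := hFun_sq h1 h2
  unfold angleFun
  set h := hFun g with hh
  set X := (b + g * q / 2) / (h * q) with hX
  -- `tan` of the difference of the two angles; both sides of `cot` vanish where `q + g b / 2 = 0`
  have htan : b ≠ 0 → Real.tan (Real.pi / 2 - (Real.arctan X - Real.arctan (g / h / 2)))
      = (q + g / 2 * b) / (h * b) := by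
    intro hb
    rw [Real.tan_pi_div_two_sub, Real.tan_sub'
      ⟨Real.arctan_ne_mul_pi_div_two, Real.arctan_ne_mul_pi_div_two⟩, Real.tan_arctan,
      Real.tan_arctan, inv_div]
    have e1 : X - g / h / 2 = b / (h * q) := by rw [hX]; field_simp; ring
    have e3 : 1 + X * (g / h / 2) = (q + g / 2 * b) / (h ^ 2 * q) := by
      rw [hX]; field_simp; rw [e2]; ring
    rw [e1, e3]; field_simp
  have hlt : X < g / h / 2 ↔ b < 0 := by
    have e1 : X - g / h / 2 = b / (h * q) := by rw [hX]; field_simp; ring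
    rw [← sub_neg, e1, div_neg_iff]
    have := mul_pos hp hq
    constructor
    · rintro (⟨-, h⟩ | ⟨h, -⟩)
      · linarith
      · exact h
    · exact fun h => Or.inr ⟨h, this⟩
  have a1 := Real.arctan_lt_pi_div_two X
  have a2 := Real.neg_pi_div_two_lt_arctan X
  have a3 := Real.arctan_lt_pi_div_two (g / h / 2)
  have a4 := Real.neg_pi_div_two_lt_arctan (g / h / 2)
  have hlt' := Real.arctan_lt_arctan_iff.trans hlt
  split_ifs with hb hb'
  · have : Real.arctan (g / h / 2) < Real.arctan X := by
      refine lt_of_le_of_ne (not_lt.1 fun h' => by linarith [hlt'.1 h']) fun h' => ?_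
      have : X - g / h / 2 = b / (h * q) := by rw [hX]; field_simp; ring
      rw [Real.arctan_injective h', sub_self] at this
      exact (div_pos hb (mul_pos hp hq)).ne this
    rw [Real.arctan_eq_of_tan_eq (htan hb.ne') ⟨by linarith, by linarith⟩]
    ring
  · have := hlt'.2 hb'
    have ht := htan hb'.ne
    rw [← Real.tan_sub_pi] at ht
    rw [Real.arctan_eq_of_tan_eq ht ⟨by linarith, by linarith⟩]
    ring
  · have : b = 0 := le_antisymm (not_lt.1 hb) (not_lt.1 hb')
    have : X = g / h / 2 := by rw [hX, this]; field_simp; ring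
    rw [this]

end Angle

section Derivatives

variable {g b q : ℝ → ℝ} {g' b' q' t : ℝ}

lemma hasDerivAt_hFun (hg : HasDerivAt g g' t) (h1 : -2 < g t) (h2 : g t < 2) :
    HasDerivAt (fun s => hFun (g s)) (-(g t / (4 * hFun (g t))) * g') t := by
  have hp := hFun_pos h1 h2
  have := ((hg.pow 2).div_const 4).const_sub 1 |>.sqrt (by
    have := hFun_sq h1 h2; simp only [Pi.pow_apply]; nlinarith)
  refine this.congr_deriv ?_
  change _ / (2 * hFun (g t)) = _
  field_simp
  push_cast
  ring

lemma hasDerivAt_BFun (hg : HasDerivAt g g' t) (hb : HasDerivAt b b' t) (hq : HasDerivAt q q' t) :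
    HasDerivAt (fun s => BFun (g s) (b s) (q s))
      (b t * q t * g' + (2 * b t + g t * q t) * b' + (g t * b t + 2 * q t) * q') t := by
  refine (((hb.pow 2).add ((hg.mul hb).mul hq)).add (hq.pow 2)).congr_deriv ?_
  simp only [Pi.mul_apply]
  push_cast
  ring

lemma hasDerivAt_angleFun (hg : HasDerivAt g g' t) (hb : HasDerivAt b b' t)
    (hq : HasDerivAt q q' t) (h1 : -2 < g t) (h2 : g t < 2) (hq0 : 0 < q t) :
    HasDerivAt (fun s => angleFun (g s) (b s) (q s))
      ((hFun (g t) * (b t * q' - q t * b')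
        - (g t * b t * q t + 2 * q t ^ 2) / (4 * hFun (g t)) * g')
          / BFun (g t) (b t) (q t)) t := by
  have hp := hFun_pos h1 h2
  have hB := BFun_pos (b := b t) h1 h2 hq0
  have hd : hFun (g t) * q t ≠ 0 := by positivity
  have he : (fun s => angleFun (g s) (b s) (q s)) =ᶠ[nhds t]
      fun s => Real.pi / 2 - Real.arctan ((b s + g s * q s / 2) / (hFun (g s) * q s)) := by
    filter_upwards [hg.continuousAt.eventually (lt_mem_nhds h1),
      hg.continuousAt.eventually (gt_mem_nhds h2), hq.continuousAt.eventually (lt_mem_nhds hq0)]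
      with s h1 h2 h3 using angleFun_eq h1 h2 h3
  refine HasDerivAt.congr_of_eventuallyEq ?_ he
  refine (((hb.add ((hg.mul hq).div_const 2)).div ((hasDerivAt_hFun hg h1 h2).mul hq)
    hd).arctan.const_sub (Real.pi / 2)).congr_deriv ?_
  simp only [Pi.mul_apply, Pi.add_apply, Pi.div_apply]
  have e1 : 1 + ((b t + g t * q t / 2) / (hFun (g t) * q t)) ^ 2
      = BFun (g t) (b t) (q t) / (hFun (g t) * q t) ^ 2 := by
    rw [← BFun_eq_angle h1 h2]; field_simp; ring
  rw [e1]
  have e2 := hFun_sq h1 h2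
  field_simp
  have e3 : g t ^ 2 = 4 - 4 * hFun (g t) ^ 2 := by linarith
  ring_nf
  rw [e3]
  ring

lemma hasDerivAt_KFun (hg : HasDerivAt g g' t) (hb : HasDerivAt b b' t)
    (hq : HasDerivAt q q' t) (h1 : -2 < g t) (h2 : g t < 2) (hq0 : 0 < q t) :
    HasDerivAt (fun s => KFun (g s) (b s) (q s))
      (KFun (g t) (b t) (q t) * (MFun (g t) (b t) (q t) / 2 * g'
        + ((b t + g t * q t) * b' + q t * q') / BFun (g t) (b t) (q t))) t := by
  have hp := hFun_pos h1 h2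
  have hB := BFun_pos (b := b t) h1 h2 hq0
  refine (((hasDerivAt_BFun hg hb hq).sqrt hB.ne').mul
    (((hg.div (hasDerivAt_hFun hg h1 h2) hp.ne').const_mul (-(1 / 2))).mul
      (hasDerivAt_angleFun hg hb hq h1 h2 hq0)).exp).congr_deriv ?_
  simp only [Pi.mul_apply, Pi.div_apply]
  unfold KFun MFun
  set E := Real.exp (-(1 / 2) * (g t / hFun (g t)) * angleFun (g t) (b t) (q t))
  have e0 : Real.sqrt (BFun (g t) (b t) (q t)) ^ 2 = BFun (g t) (b t) (q t) := Real.sq_sqrt hB.le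
  set s := Real.sqrt (BFun (g t) (b t) (q t))
  have hs : 0 < s := Real.sqrt_pos.2 hB
  have e2 : g t ^ 2 = 4 - 4 * hFun (g t) ^ 2 := by linarith [hFun_sq h1 h2]
  rw [← e0]
  set f := angleFun (g t) (b t) (q t)
  set h := hFun (g t)
  have e3 : s ^ 2 = b t ^ 2 + g t * b t * q t + q t ^ 2 := e0
  generalize g t = G at *
  generalize b t = x at *
  generalize q t = y at *
  field_simp
  grind

lemma hasDerivAt_MFun {g : ℝ} (hb : HasDerivAt b b' t)
    (hq : HasDerivAt q q' t) (h1 : -2 < g) (h2 : g < 2) (hq0 : 0 < q t) :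
    HasDerivAt (fun s => MFun g (b s) (q s))
      (2 * q t ^ 2 * (q t * b' - b t * q') / BFun g (b t) (q t) ^ 2) t := by
  have hp := hFun_pos h1 h2
  have hB := BFun_pos (b := b t) h1 h2 hq0
  have hg := hasDerivAt_const t g
  have dB := hasDerivAt_BFun hg hb hq
  refine ((((hasDerivAt_angleFun hg hb hq h1 h2 hq0).div_const (hFun g ^ 3)).neg.add
    (((hq.pow 2).const_mul (g / hFun g)).div (dB.const_mul (2 * hFun g)) (by positivity))).add
    ((hb.mul hq).div (dB.const_mul (hFun g ^ 2)) (by positivity))).congr_deriv ?_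
  simp only [Pi.mul_apply, Pi.pow_apply]
  have e2 : g ^ 2 = 4 - 4 * hFun g ^ 2 := by linarith [hFun_sq h1 h2]
  have e3 : BFun g (b t) (q t) = b t ^ 2 + g * b t * q t + q t ^ 2 := rfl
  generalize hFun g = h at *
  generalize b t = x at *
  generalize q t = y at *
  generalize BFun g x y = B at *
  field_simp
  rw [e3]
  grind

end Derivatives

section Smoothness

variable {E : Type*} [NormedAddCommGroup E] [NormedSpace ℝ E] {n : WithTop ℕ∞}
  {g b q : E → ℝ} {z : E}

lemma contDiffAt_hFun (hg : ContDiffAt ℝ n g z) (h1 : -2 < g z) (h2 : g z < 2) :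
    ContDiffAt ℝ n (fun w => hFun (g w)) z :=
  (contDiffAt_const.sub ((hg.pow 2).div_const 4)).sqrt (by nlinarith)

lemma contDiffAt_BFun (hg : ContDiffAt ℝ n g z) (hb : ContDiffAt ℝ n b z)
    (hq : ContDiffAt ℝ n q z) : ContDiffAt ℝ n (fun w => BFun (g w) (b w) (q w)) z :=
  ((hb.pow 2).add ((hg.mul hb).mul hq)).add (hq.pow 2)

lemma contDiffAt_angleFun (hg : ContDiffAt ℝ n g z) (hb : ContDiffAt ℝ n b z)
    (hq : ContDiffAt ℝ n q z) (h1 : -2 < g z) (h2 : g z < 2) (hq0 : 0 < q z) :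
    ContDiffAt ℝ n (fun w => angleFun (g w) (b w) (q w)) z := by
  have he : (fun w => angleFun (g w) (b w) (q w)) =ᶠ[nhds z]
      fun w => Real.pi / 2 - Real.arctan ((b w + g w * q w / 2) / (hFun (g w) * q w)) := by
    filter_upwards [hg.continuousAt.eventually (lt_mem_nhds h1),
      hg.continuousAt.eventually (gt_mem_nhds h2), hq.continuousAt.eventually (lt_mem_nhds hq0)]
      with s h1 h2 h3 using angleFun_eq h1 h2 h3
  refine ContDiffAt.congr_of_eventuallyEq ?_ he
  exact contDiffAt_const.sub (Real.contDiff_arctan.contDiffAt.comp z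
    ((hb.add ((hg.mul hq).div_const 2)).div ((contDiffAt_hFun hg h1 h2).mul hq)
      (mul_pos (hFun_pos h1 h2) hq0).ne'))

lemma contDiffAt_KFun (hg : ContDiffAt ℝ n g z) (hb : ContDiffAt ℝ n b z)
    (hq : ContDiffAt ℝ n q z) (h1 : -2 < g z) (h2 : g z < 2) (hq0 : 0 < q z) :
    ContDiffAt ℝ n (fun w => KFun (g w) (b w) (q w)) z :=
  ((contDiffAt_BFun hg hb hq).sqrt (BFun_pos h1 h2 hq0).ne').mul
    ((contDiffAt_const.mul (hg.div (contDiffAt_hFun hg h1 h2) (hFun_pos h1 h2).ne')).mul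
      (contDiffAt_angleFun hg hb hq h1 h2 hq0)).exp

lemma contDiffAt_JFun (hg : ContDiffAt ℝ n g z) (hb : ContDiffAt ℝ n b z)
    (hq : ContDiffAt ℝ n q z) (h1 : -2 < g z) (h2 : g z < 2) (hq0 : 0 < q z) :
    ContDiffAt ℝ n (fun w => JFun (g w) (b w) (q w)) z :=
  ((contDiffAt_KFun hg hb hq h1 h2 hq0).pow 2).div (contDiffAt_BFun hg hb hq)
    (BFun_pos h1 h2 hq0).ne'

lemma contDiffAt_MFun (hg : ContDiffAt ℝ n g z) (hb : ContDiffAt ℝ n b z)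
    (hq : ContDiffAt ℝ n q z) (h1 : -2 < g z) (h2 : g z < 2) (hq0 : 0 < q z) :
    ContDiffAt ℝ n (fun w => MFun (g w) (b w) (q w)) z := by
  have hp := (hFun_pos h1 h2).ne'
  have hB := (BFun_pos (b := b z) h1 h2 hq0).ne'
  have dh := contDiffAt_hFun hg h1 h2
  have dB := contDiffAt_BFun hg hb hq
  exact ((((contDiffAt_angleFun hg hb hq h1 h2 hq0).div (dh.pow 3) (pow_ne_zero 3 hp)).neg).add
    (((hg.div dh hp).mul (hq.pow 2)).div ((contDiffAt_const.mul dh).mul dB)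
      (mul_ne_zero (mul_ne_zero two_ne_zero hp) hB))).add
    ((hb.mul hq).div ((dh.pow 2).mul dB) (mul_ne_zero (pow_ne_zero 2 hp) hB))

end Smoothness

end Finsleroid

/-! ### The input data in coordinates -/

/-- The data `a_{ij}`, `b_i`, `g` of a Finsleroid space on an open coordinate domain `U`. -/
structure FinsleroidChart (N : ℕ) where
  U : Set (Vec N)
  isOpen : IsOpen U
  a : Vec N → Matrix (Fin N) (Fin N) ℝ
  b : Fin N → Vec N → ℝ
  g : Vec N → ℝ
  a_smooth : ∀ i j, ContDiffOn ℝ ∞ (fun x => a x i j) U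
  b_smooth : ∀ i, ContDiffOn ℝ ∞ (b i) U
  g_smooth : ContDiffOn ℝ ∞ g U
  a_symm : ∀ x i j, a x i j = a x j i
  a_unit : ∀ x ∈ U, IsUnit (a x).det
  b_unit : ∀ x ∈ U, ∑ i, ∑ j, (a x)⁻¹ i j * b i x * b j x = 1
  g_gt : ∀ x, -2 < g x
  g_lt : ∀ x, g x < 2

namespace FinsleroidChart

open Finsleroid Finsler

variable {N : ℕ} (D : FinsleroidChart N)

/-- `b = b_i yⁱ`. -/
def bet : LineFun N := fun x y => ∑ i, D.b i x * y i

/-- `u_i = a_{ij} yʲ`. -/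
def u (i : Fin N) : LineFun N := fun x y => ∑ j, D.a x i j * y j

/-- `S² = a_{ij} yⁱ yʲ`. -/
def S2 : LineFun N := fun x y => ∑ i, D.u i x y * y i

/-- `q = √(S² - b²)`. -/
def q : LineFun N := fun x y => Real.sqrt (D.S2 x y - D.bet x y ^ 2)

/-- `ω_i = ∂q/∂yⁱ`, the unit covector along the part of `u_i` orthogonal to `b_i`. -/
def om (i : Fin N) : LineFun N := fun x y => (D.u i x y - D.bet x y * D.b i x) / D.q x y

/-- The part `r_{ij} = a_{ij} - b_i b_j - ω_i ω_j` of the Riemannian metric that is orthogonal to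
`b` and to `y`. -/
def r (i j : Fin N) : LineFun N := fun x y =>
  D.a x i j - D.b i x * D.b j x - D.om i x y * D.om j x y

/-- `bⁱ = a^{ij} b_j`. -/
def bUp (i : Fin N) (x : Vec N) : ℝ := ∑ j, (D.a x)⁻¹ i j * D.b j x

/-- `ωⁱ = a^{ij} ω_j`, written through `y` and `bⁱ`. -/
def omUp (i : Fin N) : LineFun N := fun x y => (y i - D.bet x y * D.bUp i x) / D.q x y

/-- The mixed form `rⁱ_j` of `r_{ij}`: the projector to the complement of `b` and `y`. -/
def rMix (i j : Fin N) : LineFun N := fun x y =>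
  (1 : Matrix (Fin N) (Fin N) ℝ) i j - D.bUp i x * D.b j x - D.omUp i x y * D.om j x y

/-- The contravariant form `r^{ij}` of `r_{ij}`. -/
def rUp (i j : Fin N) : LineFun N := fun x y =>
  (D.a x)⁻¹ i j - D.bUp i x * D.bUp j x - D.omUp i x y * D.omUp j x y

/-- The line elements over the coordinate domain at which `y` is not collinear to `b`. -/
def Reg (x y : Vec N) : Prop := x ∈ D.U ∧ 0 < D.q x y

/-- The Finsleroid metric function in coordinates. -/
def F : LineFun N := fun x y => KFun (D.g x) (D.bet x y) (D.q x y)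

variable {D} {x y : Vec N}

lemma q_sq (h : D.Reg x y) : D.q x y ^ 2 = D.S2 x y - D.bet x y ^ 2 :=
  Real.sq_sqrt (Real.sqrt_pos.1 h.2).le

section Smooth

lemma contDiffAt_a (hx : x ∈ D.U) (i j : Fin N) :
    ContDiffAt ℝ ∞ (fun z : Vec N × Vec N => D.a z.1 i j) (x, y) :=
  ((D.a_smooth i j).contDiffAt (D.isOpen.mem_nhds hx)).comp (x, y) contDiffAt_fst

lemma contDiffAt_b (hx : x ∈ D.U) (i : Fin N) :
    ContDiffAt ℝ ∞ (fun z : Vec N × Vec N => D.b i z.1) (x, y) :=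
  ((D.b_smooth i).contDiffAt (D.isOpen.mem_nhds hx)).comp (x, y) contDiffAt_fst

lemma contDiffAt_g (hx : x ∈ D.U) :
    ContDiffAt ℝ ∞ (fun z : Vec N × Vec N => D.g z.1) (x, y) :=
  (D.g_smooth.contDiffAt (D.isOpen.mem_nhds hx)).comp (x, y) contDiffAt_fst

lemma contDiffAt_coord (i : Fin N) :
    ContDiffAt ℝ ∞ (fun z : Vec N × Vec N => z.2 i) (x, y) := by
  have : ContDiff ℝ ∞ (fun z : Vec N × Vec N => z.2 i) := by fun_prop
  exact this.contDiffAt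

lemma contDiffAt_bet (hx : x ∈ D.U) :
    ContDiffAt ℝ ∞ (fun z : Vec N × Vec N => D.bet z.1 z.2) (x, y) :=
  ContDiffAt.sum fun i _ => (contDiffAt_b hx i).mul (contDiffAt_coord i)

lemma contDiffAt_u (hx : x ∈ D.U) (i : Fin N) :
    ContDiffAt ℝ ∞ (fun z : Vec N × Vec N => D.u i z.1 z.2) (x, y) :=
  ContDiffAt.sum fun j _ => (contDiffAt_a hx i j).mul (contDiffAt_coord j)

lemma contDiffAt_S2 (hx : x ∈ D.U) :
    ContDiffAt ℝ ∞ (fun z : Vec N × Vec N => D.S2 z.1 z.2) (x, y) :=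
  ContDiffAt.sum fun i _ => (contDiffAt_u hx i).mul (contDiffAt_coord i)

lemma contDiffAt_q (h : D.Reg x y) :
    ContDiffAt ℝ ∞ (fun z : Vec N × Vec N => D.q z.1 z.2) (x, y) :=
  ((contDiffAt_S2 h.1).sub ((contDiffAt_bet h.1).pow 2)).sqrt (Real.sqrt_pos.1 h.2).ne'

lemma contDiffAt_om (h : D.Reg x y) (i : Fin N) :
    ContDiffAt ℝ ∞ (fun z : Vec N × Vec N => D.om i z.1 z.2) (x, y) :=
  ((contDiffAt_u h.1 i).sub ((contDiffAt_bet h.1).mul (contDiffAt_b h.1 i))).div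
    (contDiffAt_q h) h.2.ne'

lemma contDiffAt_r (h : D.Reg x y) (i j : Fin N) :
    ContDiffAt ℝ ∞ (fun z : Vec N × Vec N => D.r i j z.1 z.2) (x, y) :=
  ((contDiffAt_a h.1 i j).sub ((contDiffAt_b h.1 i).mul (contDiffAt_b h.1 j))).sub
    ((contDiffAt_om h i).mul (contDiffAt_om h j))

lemma contDiffAt_F (h : D.Reg x y) :
    ContDiffAt ℝ ∞ (fun z : Vec N × Vec N => D.F z.1 z.2) (x, y) :=
  contDiffAt_KFun (contDiffAt_g h.1) (contDiffAt_bet h.1) (contDiffAt_q h) (D.g_gt x) (D.g_lt x) h.2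

lemma eventually_reg (h : D.Reg x y) : ∀ᶠ z : Vec N × Vec N in nhds (x, y), D.Reg z.1 z.2 := by
  have h1 : ∀ᶠ z : Vec N × Vec N in nhds (x, y), z.1 ∈ D.U :=
    continuousAt_fst.eventually (D.isOpen.mem_nhds h.1)
  have h2 : ∀ᶠ z : Vec N × Vec N in nhds (x, y), 0 < D.q z.1 z.2 :=
    (contDiffAt_q h).continuousAt.eventually (lt_mem_nhds h.2)
  filter_upwards [h1, h2] with z hz1 hz2 using ⟨hz1, hz2⟩

/-- Smoothness at all regular line elements of a function of the line element. -/
def SmoothFun (D : FinsleroidChart N) (f : LineFun N) : Prop :=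
  ∀ x y, D.Reg x y → ContDiffAt ℝ ∞ (fun z : Vec N × Vec N => f z.1 z.2) (x, y)

/-- Equality of two functions at all regular line elements. -/
def EqReg (D : FinsleroidChart N) (f f' : LineFun N) : Prop :=
  ∀ x y, D.Reg x y → f x y = f' x y

lemma EqReg.eventuallyEq {f f' : LineFun N} (hf : D.EqReg f f') (h : D.Reg x y) :
    (fun z : Vec N × Vec N => f z.1 z.2) =ᶠ[nhds (x, y)] fun z => f' z.1 z.2 := by
  filter_upwards [eventually_reg h] with z hz using hf _ _ hz

lemma EqReg.pdy {f f' : LineFun N} (hf : D.EqReg f f') (i : Fin N) :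
    D.EqReg (pdy f i) (pdy f' i) := by
  intro x y h
  have h2 : ContinuousAt (fun y' : Vec N => (x, y')) y := by fun_prop
  have : (fun y' => f x y') =ᶠ[nhds y] fun y' => f' x y' :=
    h2.eventually (hf.eventuallyEq h)
  simp only [Finsler.pdy, this.fderiv_eq]

lemma EqReg.pdx {f f' : LineFun N} (hf : D.EqReg f f') (i : Fin N) :
    D.EqReg (pdx f i) (pdx f' i) := by
  intro x y h
  have h2 : ContinuousAt (fun x' : Vec N => (x', y)) x := by fun_prop
  have : (fun x' => f x' y) =ᶠ[nhds x] fun x' => f' x' y :=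
    h2.eventually (hf.eventuallyEq h)
  simp only [Finsler.pdx, this.fderiv_eq]

/-- The total derivative of a function of the line element in the direction `(ξ, η)`. -/
def lineDir (f : LineFun N) (x y ξ η : Vec N) : ℝ :=
  fderiv ℝ (fun z : Vec N × Vec N => f z.1 z.2) (x, y) (ξ, η)

lemma SmoothFun.differentiableAt {f : LineFun N} (hf : D.SmoothFun f) (h : D.Reg x y) :
    DifferentiableAt ℝ (fun z : Vec N × Vec N => f z.1 z.2) (x, y) :=
  (hf x y h).differentiableAt (by simp)

lemma SmoothFun.hasDerivAt {f : LineFun N} (hf : D.SmoothFun f) (h : D.Reg x y) (ξ η : Vec N) :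
    HasDerivAt (fun t : ℝ => f (x + t • ξ) (y + t • η)) (lineDir f x y ξ η) 0 :=
  (hf.differentiableAt h).hasFDerivAt.hasLineDerivAt (ξ, η)

lemma SmoothFun.pdy_eq {f : LineFun N} (hf : D.SmoothFun f) (h : D.Reg x y) (i : Fin N) :
    pdy f i x y = lineDir f x y 0 (EuclideanSpace.single i 1) := by
  have h1 : HasFDerivAt (fun y' : Vec N => (x, y'))
    (ContinuousLinearMap.inr ℝ (Vec N) (Vec N)) y := hasFDerivAt_prodMk_right x y
  have := (hf.differentiableAt h).hasFDerivAt.comp y h1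
  have e : pdy f i x y = _ := congrArg (· (EuclideanSpace.single i 1)) this.fderiv
  rw [e]; simp [lineDir]

lemma SmoothFun.pdx_eq {f : LineFun N} (hf : D.SmoothFun f) (h : D.Reg x y) (i : Fin N) :
    pdx f i x y = lineDir f x y (EuclideanSpace.single i 1) 0 := by
  have h1 : HasFDerivAt (fun x' : Vec N => (x', y))
    (ContinuousLinearMap.inl ℝ (Vec N) (Vec N)) x := hasFDerivAt_prodMk_left x y
  have := (hf.differentiableAt h).hasFDerivAt.comp x h1
  have e : pdx f i x y = _ := congrArg (· (EuclideanSpace.single i 1)) this.fderiv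
  rw [e]; simp [lineDir]

/-- The operator `∂/∂xᵏ - vⁿ ∂/∂yⁿ` of a horizontal derivative is a single directional
derivative. -/
lemma SmoothFun.pdx_sub {f : LineFun N} (hf : D.SmoothFun f) (h : D.Reg x y) (k : Fin N)
    (v : Fin N → ℝ) :
    pdx f k x y - ∑ n, v n * pdy f n x y
      = lineDir f x y (EuclideanSpace.single k 1) (-WithLp.toLp 2 v) := by
  have e : (-WithLp.toLp 2 v : Vec N) = -∑ n, v n • EuclideanSpace.single n (1 : ℝ) := by
    congr 1
    ext j
    simp [Finset.sum_apply, Pi.single_apply]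
  have e2 : ((EuclideanSpace.single k 1, -WithLp.toLp 2 v) : Vec N × Vec N)
      = (EuclideanSpace.single k 1, 0)
        - ∑ n, v n • ((0 : Vec N), (EuclideanSpace.single n (1 : ℝ) : Vec N)) := by
    rw [e]
    ext1
    · simp [Prod.fst_sum]
    · simp [Prod.snd_sum]
  rw [hf.pdx_eq h, lineDir, lineDir, e2, map_sub, map_sum]
  congr 1
  refine Finset.sum_congr rfl fun n _ => ?_
  rw [hf.pdy_eq h, map_smul, smul_eq_mul, lineDir]

end Smooth

end FinsleroidChart

namespace FinsleroidChart

open Finsleroid Finsler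

variable {N : ℕ} {D : FinsleroidChart N} {x y : Vec N}

/-! ### Derivatives of the basic quantities along lines in `(x, y)`-space -/

/-- The derivatives at `(x, y)` in the direction `(ξ, η)` of the scalars `g`, `b`, `q` and of the
tensors `b_i`, `ω_i`, `a_{ij}`, from which everything else is built. -/
structure LineDer (D : FinsleroidChart N) (x y ξ η : Vec N) (g' b' q' : ℝ) (β' ω' : Fin N → ℝ)
    (a' : Fin N → Fin N → ℝ) : Prop where
  g : HasDerivAt (fun t : ℝ => D.g (x + t • ξ)) g' 0
  bet : HasDerivAt (fun t : ℝ => D.bet (x + t • ξ) (y + t • η)) b' 0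
  q : HasDerivAt (fun t : ℝ => D.q (x + t • ξ) (y + t • η)) q' 0
  b : ∀ i, HasDerivAt (fun t : ℝ => D.b i (x + t • ξ)) (β' i) 0
  om : ∀ i, HasDerivAt (fun t : ℝ => D.om i (x + t • ξ) (y + t • η)) (ω' i) 0
  a : ∀ i j, HasDerivAt (fun t : ℝ => D.a (x + t • ξ) i j) (a' i j) 0

lemma hasDerivAt_coord (y η : Vec N) (i : Fin N) :
    HasDerivAt (fun t : ℝ => (y + t • η) i) (η i) 0 := by
  simpa using ((hasDerivAt_id (0 : ℝ)).mul_const (η i)).const_add (y i)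

/-- The derivatives of the derived quantities `b`, `q`, `ω_i` from those of the input data: it is
enough to check the differentiated relations `S² = q² + b²` and `q ω_i = u_i - b b_i`. -/
lemma lineDer_of_base (h : D.Reg x y) (ξ η : Vec N) {g' : ℝ} {β' : Fin N → ℝ}
    {a' : Fin N → Fin N → ℝ} {b' q' : ℝ} {u' ω' : Fin N → ℝ}
    (hg : HasDerivAt (fun t : ℝ => D.g (x + t • ξ)) g' 0)
    (hb : ∀ i, HasDerivAt (fun t : ℝ => D.b i (x + t • ξ)) (β' i) 0)
    (ha : ∀ i j, HasDerivAt (fun t : ℝ => D.a (x + t • ξ) i j) (a' i j) 0)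
    (hu : ∀ i, ∑ j, a' i j * y j + ∑ j, D.a x i j * η j = u' i)
    (hb' : ∑ i, β' i * y i + ∑ i, D.b i x * η i = b')
    (hq' : ∑ i, u' i * y i + ∑ i, D.u i x y * η i = 2 * D.q x y * q' + 2 * D.bet x y * b')
    (hω : ∀ i, u' i - b' * D.b i x - D.bet x y * β' i = D.q x y * ω' i + q' * D.om i x y) :
    LineDer D x y ξ η g' b' q' β' ω' a' := by
  have hu0 : ∀ i, HasDerivAt (fun t : ℝ => D.u i (x + t • ξ) (y + t • η)) (u' i) 0 := by
    intro i
    refine (HasDerivAt.fun_sum fun j _ => (ha i j).mul (hasDerivAt_coord y η j)).congr_deriv ?_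
    rw [← hu, ← Finset.sum_add_distrib]
    simp
  have hbet : HasDerivAt (fun t : ℝ => D.bet (x + t • ξ) (y + t • η)) b' 0 := by
    refine (HasDerivAt.fun_sum fun j _ => (hb j).mul (hasDerivAt_coord y η j)).congr_deriv ?_
    rw [← hb', ← Finset.sum_add_distrib]
    simp
  have hS2 : HasDerivAt (fun t : ℝ => D.S2 (x + t • ξ) (y + t • η))
      (2 * D.q x y * q' + 2 * D.bet x y * b') 0 := by
    refine (HasDerivAt.fun_sum fun j _ => (hu0 j).mul (hasDerivAt_coord y η j)).congr_deriv ?_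
    rw [← hq', ← Finset.sum_add_distrib]
    simp
  have hq0 := h.2.ne'
  have hq : HasDerivAt (fun t : ℝ => D.q (x + t • ξ) (y + t • η)) q' 0 := by
    refine ((hS2.sub (hbet.pow 2)).sqrt ?_).congr_deriv ?_
    · simpa using (Real.sqrt_pos.1 h.2).ne'
    · simp only [Pi.sub_apply, Pi.pow_apply, zero_smul, add_zero]
      change _ / (2 * D.q x y) = _
      field_simp
      push_cast
      ring
  refine ⟨hg, hbet, hq, hb, fun i => ?_, ha⟩
  refine (((hu0 i).sub (hbet.mul (hb i))).div hq (by simpa using hq0)).congr_deriv ?_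
  simp only [Pi.sub_apply, Pi.mul_apply, zero_smul, add_zero]
  have e : D.u i x y - D.bet x y * D.b i x = D.q x y * D.om i x y := by
    unfold om; field_simp
  rw [e, show u' i - (b' * D.b i x + D.bet x y * β' i)
    = u' i - b' * D.b i x - D.bet x y * β' i by ring, hω i]
  field_simp
  ring

lemma q_mul_om (h : D.Reg x y) (i : Fin N) :
    D.q x y * D.om i x y = D.u i x y - D.bet x y * D.b i x := by
  have := h.2.ne'
  unfold om; field_simp

/-- Vertically `∂b/∂yᵏ = b_k`, `∂q/∂yᵏ = ω_k` and `∂ω_i/∂yᵏ = r_{ik}/q`. -/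
lemma lineDer_vertical (h : D.Reg x y) (k : Fin N) :
    LineDer D x y 0 (EuclideanSpace.single k 1) 0 (D.b k x) (D.om k x y) (fun _ => 0)
      (fun i => D.r i k x y / D.q x y) (fun _ _ => 0) := by
  have hq0 := h.2.ne'
  have hs : ∀ j, (EuclideanSpace.single k (1 : ℝ) : Vec N) j = if j = k then 1 else 0 := by
    intro j; simp
  have hsum : ∀ f : Fin N → ℝ, ∑ j, f j * (EuclideanSpace.single k (1 : ℝ) : Vec N) j = f k := by
    intro f; simp
  refine lineDer_of_base h 0 _ (u' := fun i => D.a x i k) ?_ ?_ ?_ ?_ ?_ ?_ ?_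
  · simpa using hasDerivAt_const (0 : ℝ) (D.g x)
  · intro i; simpa using hasDerivAt_const (0 : ℝ) (D.b i x)
  · intro i j; simpa using hasDerivAt_const (0 : ℝ) (D.a x i j)
  · intro i; rw [hsum]; simp
  · rw [hsum]; simp
  · rw [hsum]
    have : ∑ i, D.a x i k * y i = D.u k x y := Finset.sum_congr rfl fun i _ => by
      rw [D.a_symm]
    rw [this]
    linear_combination 2 * -(q_mul_om h k)
  · intro i
    unfold r
    field_simp
    ring

/-- The Christoffel symbols `Γⁿ_{ik} = Gam x n i k` of the Riemannian metric, together with the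
coordinate forms of `∇a = 0`, `∇b = 0` and `∂_k g = μ b_k`. -/
structure IsParallel (D : FinsleroidChart N) (Gam : Vec N → Fin N → Fin N → Fin N → ℝ)
    (μ : Vec N → ℝ) : Prop where
  symm : ∀ x n i k, Gam x n i k = Gam x n k i
  deriv_a : ∀ x ∈ D.U, ∀ i j k, fderiv ℝ (fun x' => D.a x' i j) x (EuclideanSpace.single k 1) =
    ∑ n, Gam x n i k * D.a x n j + ∑ n, Gam x n j k * D.a x i n
  deriv_b : ∀ x ∈ D.U, ∀ i k, fderiv ℝ (D.b i) x (EuclideanSpace.single k 1) =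
    ∑ n, Gam x n i k * D.b n x
  deriv_g : ∀ x ∈ D.U, ∀ k, fderiv ℝ D.g x (EuclideanSpace.single k 1) = μ x * D.b k x

/-- The coefficients `Nⁿ_k = Γⁿ_{ik} yⁱ` of the Riemannian nonlinear connection. -/
def riemN (Gam : Vec N → Fin N → Fin N → Fin N → ℝ) (x y : Vec N) (k n : Fin N) : ℝ :=
  ∑ i, Gam x n i k * y i

variable {Gam : Vec N → Fin N → Fin N → Fin N → ℝ} {μ : Vec N → ℝ}

/-- In the Riemannian horizontal direction the scalars `b` and `q` are constant, and the tensors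
`b_i`, `ω_i`, `a_{ij}` are transported by the Christoffel symbols. -/
lemma lineDer_horizontal (hP : D.IsParallel Gam μ) (h : D.Reg x y) (k : Fin N) :
    LineDer D x y (EuclideanSpace.single k 1) (-WithLp.toLp 2 (riemN Gam x y k))
      (μ x * D.b k x) 0 0 (fun i => ∑ n, Gam x n i k * D.b n x)
      (fun i => ∑ n, Gam x n i k * D.om n x y)
      (fun i j => ∑ n, Gam x n i k * D.a x n j + ∑ n, Gam x n j k * D.a x i n) := by
  have hnhds := D.isOpen.mem_nhds h.1
  have hsum : ∀ f : Fin N → ℝ, ∑ j, f j * (-WithLp.toLp 2 (riemN Gam x y k) : Vec N) j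
      = -∑ j, ∑ n, Gam x n j k * f n * y j := by
    intro f
    simp only [PiLp.neg_apply, riemN, mul_neg, Finset.sum_neg_distrib, Finset.mul_sum]
    rw [Finset.sum_comm]
    congr 1
    refine Finset.sum_congr rfl fun j _ => Finset.sum_congr rfl fun n _ => by ring
  have hlin : ∀ f : Fin N → ℝ, ∑ j, (∑ n, Gam x n j k * f n) * y j
      = ∑ j, ∑ n, Gam x n j k * f n * y j := by
    intro f; simp only [Finset.sum_mul]
  refine lineDer_of_base h _ _ (u' := fun i => ∑ n, Gam x n i k * D.u n x y) ?_ ?_ ?_ ?_ ?_ ?_ ?_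
  · rw [← hP.deriv_g x h.1]
    exact ((D.g_smooth.contDiffAt hnhds).differentiableAt (by simp)).hasFDerivAt.hasLineDerivAt _
  · intro i
    rw [← hP.deriv_b x h.1]
    exact (((D.b_smooth i).contDiffAt hnhds).differentiableAt
      (by simp)).hasFDerivAt.hasLineDerivAt _
  · intro i j
    rw [← hP.deriv_a x h.1]
    exact (((D.a_smooth i j).contDiffAt hnhds).differentiableAt
      (by simp)).hasFDerivAt.hasLineDerivAt _
  · intro i
    rw [hsum]
    simp only [add_mul, Finset.sum_add_distrib, hlin]
    have : ∑ j, (∑ n, Gam x n i k * D.a x n j) * y j = ∑ n, Gam x n i k * D.u n x y := by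
      simp only [u, Finset.mul_sum, Finset.sum_mul]
      rw [Finset.sum_comm]
      refine Finset.sum_congr rfl fun j _ => Finset.sum_congr rfl fun n _ => by ring
    rw [this]; ring
  · rw [hsum, hlin]; ring
  · rw [hsum, hlin]; ring
  · intro i
    rw [zero_mul, zero_mul, add_zero, sub_zero, Finset.mul_sum, Finset.mul_sum,
      ← Finset.sum_sub_distrib]
    refine Finset.sum_congr rfl fun n _ => ?_
    linear_combination -Gam x n i k * q_mul_om h n

/-! ### The frame -/

lemma a_mul_inv (hx : x ∈ D.U) : D.a x * (D.a x)⁻¹ = 1 := Matrix.mul_nonsing_inv _ (D.a_unit x hx)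

lemma inv_mul_a (hx : x ∈ D.U) : (D.a x)⁻¹ * D.a x = 1 := Matrix.nonsing_inv_mul _ (D.a_unit x hx)

lemma inv_symm (x : Vec N) (i j : Fin N) : (D.a x)⁻¹ i j = (D.a x)⁻¹ j i := by
  have : (D.a x).transpose = D.a x := by ext i j; exact D.a_symm x j i
  conv_lhs => rw [← this, ← Matrix.transpose_nonsing_inv]
  rfl

lemma sum_a_inv (hx : x ∈ D.U) (i j : Fin N) :
    ∑ n, D.a x i n * (D.a x)⁻¹ n j = (1 : Matrix (Fin N) (Fin N) ℝ) i j := by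
  rw [← a_mul_inv hx, Matrix.mul_apply]

lemma sum_a_bUp (hx : x ∈ D.U) (i : Fin N) : ∑ n, D.a x i n * D.bUp n x = D.b i x := by
  simp only [bUp, Finset.mul_sum]
  rw [Finset.sum_comm]
  simp only [← mul_assoc, ← Finset.sum_mul, sum_a_inv hx]
  simp [Matrix.one_apply]

lemma sum_bUp_b (hx : x ∈ D.U) : ∑ n, D.bUp n x * D.b n x = 1 := by
  rw [← D.b_unit x hx]
  simp only [bUp, Finset.sum_mul]
  refine Finset.sum_congr rfl fun j _ => Finset.sum_congr rfl fun n _ => by ring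

lemma sum_bUp_u (hx : x ∈ D.U) : ∑ n, D.bUp n x * D.u n x y = D.bet x y := by
  simp only [u, bet, Finset.mul_sum]
  rw [Finset.sum_comm]
  refine Finset.sum_congr rfl fun j _ => ?_
  rw [← sum_a_bUp hx j, Finset.sum_mul]
  refine Finset.sum_congr rfl fun n _ => by rw [D.a_symm x n j]; ring

lemma sum_bUp_om (h : D.Reg x y) : ∑ n, D.bUp n x * D.om n x y = 0 := by
  have hq0 := h.2.ne'
  have : D.q x y * ∑ n, D.bUp n x * D.om n x y = 0 := by
    rw [Finset.mul_sum]
    have : ∀ n, D.q x y * (D.bUp n x * D.om n x y)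
        = D.bUp n x * D.u n x y - D.bet x y * (D.bUp n x * D.b n x) := fun n => by
      linear_combination D.bUp n x * q_mul_om h n
    simp only [this, Finset.sum_sub_distrib, ← Finset.mul_sum, sum_bUp_u h.1, sum_bUp_b h.1]
    ring
  exact (mul_eq_zero.1 this).resolve_left hq0

lemma q_mul_omUp (h : D.Reg x y) (i : Fin N) :
    D.q x y * D.omUp i x y = y i - D.bet x y * D.bUp i x := by
  have := h.2.ne'
  unfold omUp; field_simp

lemma sum_omUp_b (h : D.Reg x y) : ∑ n, D.omUp n x y * D.b n x = 0 := by
  have hq0 := h.2.ne'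
  have : D.q x y * ∑ n, D.omUp n x y * D.b n x = 0 := by
    rw [Finset.mul_sum]
    have : ∀ n, D.q x y * (D.omUp n x y * D.b n x)
        = D.b n x * y n - D.bet x y * (D.bUp n x * D.b n x) := fun n => by
      linear_combination D.b n x * q_mul_omUp h n
    simp only [this, Finset.sum_sub_distrib, ← Finset.mul_sum, sum_bUp_b h.1]
    unfold bet; ring
  exact (mul_eq_zero.1 this).resolve_left hq0

lemma sum_om_y (h : D.Reg x y) : ∑ n, D.om n x y * y n = D.q x y := by
  have hq0 := h.2.ne'
  have : D.q x y * ∑ n, D.om n x y * y n = D.q x y * D.q x y := by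
    rw [Finset.mul_sum]
    have : ∀ n, D.q x y * (D.om n x y * y n)
        = D.u n x y * y n - D.bet x y * (D.b n x * y n) := fun n => by
      linear_combination y n * q_mul_om h n
    simp only [this, Finset.sum_sub_distrib, ← Finset.mul_sum]
    have := q_sq h
    unfold S2 at this
    change _ - D.bet x y * D.bet x y = _
    linear_combination -this
  exact mul_left_cancel₀ hq0 this

lemma sum_omUp_om (h : D.Reg x y) : ∑ n, D.omUp n x y * D.om n x y = 1 := by
  have hq0 := h.2.ne'
  have : D.q x y * ∑ n, D.omUp n x y * D.om n x y = D.q x y * 1 := by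
    rw [Finset.mul_sum]
    have : ∀ n, D.q x y * (D.omUp n x y * D.om n x y)
        = D.om n x y * y n - D.bet x y * (D.bUp n x * D.om n x y) := fun n => by
      linear_combination D.om n x y * q_mul_omUp h n
    simp only [this, Finset.sum_sub_distrib, ← Finset.mul_sum, sum_om_y h, sum_bUp_om h]
    ring
  exact mul_left_cancel₀ hq0 this

/-- The tangent vector lies in the plane of `bⁱ` and `ωⁱ`. -/
lemma y_eq (h : D.Reg x y) (i : Fin N) :
    y i = D.bet x y * D.bUp i x + D.q x y * D.omUp i x y := by
  rw [q_mul_omUp h]; ring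

lemma sum_a_omUp (h : D.Reg x y) (i : Fin N) : ∑ n, D.a x i n * D.omUp n x y = D.om i x y := by
  have hq0 := h.2.ne'
  have : D.q x y * ∑ n, D.a x i n * D.omUp n x y = D.q x y * D.om i x y := by
    rw [Finset.mul_sum, q_mul_om h]
    have : ∀ n, D.q x y * (D.a x i n * D.omUp n x y)
        = D.a x i n * y n - D.bet x y * (D.a x i n * D.bUp n x) := fun n => by
      linear_combination D.a x i n * q_mul_omUp h n
    simp only [this, Finset.sum_sub_distrib, ← Finset.mul_sum, sum_a_bUp h.1]
    unfold u; ring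
  exact mul_left_cancel₀ hq0 this

end FinsleroidChart

namespace FinsleroidChart

open Finsleroid Finsler

variable {N : ℕ} {D : FinsleroidChart N} {x y : Vec N}

/-! ### Tensors adapted to the splitting into `b`, `ω` and the complement -/

variable (D) in
/-- The covector `c₁ b_i + c₂ ω_i`. -/
def cov (x y : Vec N) (c₁ c₂ : ℝ) (i : Fin N) : ℝ := c₁ * D.b i x + c₂ * D.om i x y

variable (D) in
/-- The vector `c₁ bⁱ + c₂ ωⁱ`. -/
def con (x y : Vec N) (c₁ c₂ : ℝ) (i : Fin N) : ℝ := c₁ * D.bUp i x + c₂ * D.omUp i x y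

variable (D) in
/-- The covariant tensor with the given components in the basis `b`, `ω` and the multiple `c` of
`r_{ij}` on the complement. -/
def ten (x y : Vec N) (c₁₁ c₁₂ c₂₁ c₂₂ c : ℝ) (i k : Fin N) : ℝ :=
  c₁₁ * (D.b i x * D.b k x) + c₁₂ * (D.b i x * D.om k x y) + c₂₁ * (D.om i x y * D.b k x)
    + c₂₂ * (D.om i x y * D.om k x y) + c * D.r i k x y

variable (D) in
/-- The mixed tensor with the given components in the basis `b`, `ω` and the multiple `c` of
`rⁱ_j` on the complement. -/
def mix (x y : Vec N) (c₁₁ c₁₂ c₂₁ c₂₂ c : ℝ) (n k : Fin N) : ℝ :=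
  c₁₁ * (D.bUp n x * D.b k x) + c₁₂ * (D.bUp n x * D.om k x y) + c₂₁ * (D.omUp n x y * D.b k x)
    + c₂₂ * (D.omUp n x y * D.om k x y) + c * D.rMix n k x y

variable (D) in
/-- The contravariant tensor with the given components in the basis `b`, `ω` and the multiple `c` of
`r^{ij}` on the complement. -/
def tenUp (x y : Vec N) (c₁₁ c₁₂ c₂₁ c₂₂ c : ℝ) (i k : Fin N) : ℝ :=
  c₁₁ * (D.bUp i x * D.bUp k x) + c₁₂ * (D.bUp i x * D.omUp k x y)
    + c₂₁ * (D.omUp i x y * D.bUp k x) + c₂₂ * (D.omUp i x y * D.omUp k x y) + c * D.rUp i k x y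

lemma r_symm (i j : Fin N) : D.r i j x y = D.r j i x y := by
  unfold r; rw [D.a_symm]; ring

lemma rUp_symm (i j : Fin N) : D.rUp i j x y = D.rUp j i x y := by
  unfold rUp; rw [inv_symm]; ring

lemma sum_con (c₁ c₂ : ℝ) (X : Fin N → ℝ) : ∑ n, D.con x y c₁ c₂ n * X n
    = c₁ * ∑ n, D.bUp n x * X n + c₂ * ∑ n, D.omUp n x y * X n := by
  simp only [con, add_mul, Finset.sum_add_distrib, Finset.mul_sum, mul_assoc]

lemma sum_rMix (k : Fin N) (X : Fin N → ℝ) : ∑ n, D.rMix n k x y * X n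
    = X k - D.b k x * ∑ n, D.bUp n x * X n - D.om k x y * ∑ n, D.omUp n x y * X n := by
  have : ∀ n, D.rMix n k x y * X n = (1 : Matrix (Fin N) (Fin N) ℝ) n k * X n
      - D.b k x * (D.bUp n x * X n) - D.om k x y * (D.omUp n x y * X n) := by
    intro n; unfold rMix; ring
  simp only [this, Finset.sum_sub_distrib, Finset.mul_sum]
  simp [Matrix.one_apply]

lemma sum_mix (c₁₁ c₁₂ c₂₁ c₂₂ c : ℝ) (k : Fin N) (X : Fin N → ℝ) :
    ∑ n, D.mix x y c₁₁ c₁₂ c₂₁ c₂₂ c n k * X n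
      = (c₁₁ * D.b k x + c₁₂ * D.om k x y) * ∑ n, D.bUp n x * X n
        + (c₂₁ * D.b k x + c₂₂ * D.om k x y) * ∑ n, D.omUp n x y * X n
        + c * (X k - D.b k x * ∑ n, D.bUp n x * X n - D.om k x y * ∑ n, D.omUp n x y * X n) := by
  rw [← sum_rMix]
  simp only [Finset.mul_sum]
  simp only [← Finset.sum_add_distrib]
  refine Finset.sum_congr rfl fun n _ => by unfold mix; ring

lemma sum_bUp_r (h : D.Reg x y) (i : Fin N) : ∑ n, D.bUp n x * D.r n i x y = 0 := by
  have : ∀ n, D.bUp n x * D.r n i x y = D.a x i n * D.bUp n x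
      - D.b i x * (D.bUp n x * D.b n x) - D.om i x y * (D.bUp n x * D.om n x y) := by
    intro n; unfold r; rw [D.a_symm]; ring
  simp only [this, Finset.sum_sub_distrib, ← Finset.mul_sum, sum_a_bUp h.1, sum_bUp_b h.1,
    sum_bUp_om h]
  ring

lemma sum_omUp_r (h : D.Reg x y) (i : Fin N) : ∑ n, D.omUp n x y * D.r n i x y = 0 := by
  have : ∀ n, D.omUp n x y * D.r n i x y = D.a x i n * D.omUp n x y
      - D.b i x * (D.omUp n x y * D.b n x) - D.om i x y * (D.omUp n x y * D.om n x y) := by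
    intro n; unfold r; rw [D.a_symm]; ring
  simp only [this, Finset.sum_sub_distrib, ← Finset.mul_sum, sum_a_omUp h, sum_omUp_b h,
    sum_omUp_om h]
  ring

lemma sum_cov (X : Fin N → ℝ) (c₁ c₂ : ℝ) : ∑ n, X n * D.cov x y c₁ c₂ n
    = c₁ * ∑ n, X n * D.b n x + c₂ * ∑ n, X n * D.om n x y := by
  simp only [Finset.mul_sum, ← Finset.sum_add_distrib]
  refine Finset.sum_congr rfl fun n _ => by unfold cov; ring

lemma sum_ten (X : Fin N → ℝ) (c₁₁ c₁₂ c₂₁ c₂₂ c : ℝ) (k : Fin N) :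
    ∑ n, X n * D.ten x y c₁₁ c₁₂ c₂₁ c₂₂ c n k
      = (c₁₁ * D.b k x + c₁₂ * D.om k x y) * ∑ n, X n * D.b n x
        + (c₂₁ * D.b k x + c₂₂ * D.om k x y) * ∑ n, X n * D.om n x y
        + c * ∑ n, X n * D.r n k x y := by
  simp only [Finset.mul_sum, ← Finset.sum_add_distrib]
  refine Finset.sum_congr rfl fun n _ => by unfold ten; ring

lemma ten_swap (c₁₁ c₁₂ c₂₁ c₂₂ c : ℝ) (i k : Fin N) :
    D.ten x y c₁₁ c₁₂ c₂₁ c₂₂ c i k = D.ten x y c₁₁ c₂₁ c₁₂ c₂₂ c k i := by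
  unfold ten; rw [r_symm]; ring

lemma con_cov (h : D.Reg x y) (c₁ c₂ d₁ d₂ : ℝ) :
    ∑ n, D.con x y c₁ c₂ n * D.cov x y d₁ d₂ n = c₁ * d₁ + c₂ * d₂ := by
  simp only [sum_con, sum_cov, sum_bUp_b h.1, sum_bUp_om h, sum_omUp_b h, sum_omUp_om h]
  ring

lemma con_ten (h : D.Reg x y) (c₁ c₂ d₁₁ d₁₂ d₂₁ d₂₂ d : ℝ) (k : Fin N) :
    ∑ n, D.con x y c₁ c₂ n * D.ten x y d₁₁ d₁₂ d₂₁ d₂₂ d n k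
      = D.cov x y (c₁ * d₁₁ + c₂ * d₂₁) (c₁ * d₁₂ + c₂ * d₂₂) k := by
  simp only [sum_con, sum_ten, sum_bUp_b h.1, sum_bUp_om h, sum_omUp_b h, sum_omUp_om h,
    sum_bUp_r h, sum_omUp_r h]
  unfold cov; ring

lemma mix_cov (h : D.Reg x y) (c₁₁ c₁₂ c₂₁ c₂₂ c d₁ d₂ : ℝ) (k : Fin N) :
    ∑ n, D.mix x y c₁₁ c₁₂ c₂₁ c₂₂ c n k * D.cov x y d₁ d₂ n
      = D.cov x y (c₁₁ * d₁ + c₂₁ * d₂) (c₁₂ * d₁ + c₂₂ * d₂) k := by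
  simp only [sum_mix, sum_cov, sum_bUp_b h.1, sum_bUp_om h, sum_omUp_b h, sum_omUp_om h]
  unfold cov; ring

lemma mix_ten (h : D.Reg x y) (c₁₁ c₁₂ c₂₁ c₂₂ c d₁₁ d₁₂ d₂₁ d₂₂ d : ℝ) (k i : Fin N) :
    ∑ n, D.mix x y c₁₁ c₁₂ c₂₁ c₂₂ c n k * D.ten x y d₁₁ d₁₂ d₂₁ d₂₂ d n i
      = D.ten x y (c₁₁ * d₁₁ + c₂₁ * d₂₁) (c₁₁ * d₁₂ + c₂₁ * d₂₂) (c₁₂ * d₁₁ + c₂₂ * d₂₁)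
        (c₁₂ * d₁₂ + c₂₂ * d₂₂) (c * d) k i := by
  simp only [sum_mix, sum_ten, sum_bUp_b h.1, sum_bUp_om h, sum_omUp_b h, sum_omUp_om h,
    sum_bUp_r h, sum_omUp_r h]
  unfold ten; ring

lemma mix_con (h : D.Reg x y) (c₁₁ c₁₂ c₂₁ c₂₂ c d₁ d₂ : ℝ) (n : Fin N) :
    ∑ k, D.mix x y c₁₁ c₁₂ c₂₁ c₂₂ c n k * D.con x y d₁ d₂ k
      = D.con x y (c₁₁ * d₁ + c₁₂ * d₂) (c₂₁ * d₁ + c₂₂ * d₂) n := by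
  have hr : ∑ k, D.con x y d₁ d₂ k * D.rMix n k x y = 0 := by
    have : ∀ k, D.con x y d₁ d₂ k * D.rMix n k x y
        = (1 : Matrix (Fin N) (Fin N) ℝ) n k * D.con x y d₁ d₂ k
          - D.bUp n x * (D.con x y d₁ d₂ k * D.b k x)
          - D.omUp n x y * (D.con x y d₁ d₂ k * D.om k x y) := by
      intro k; unfold rMix; ring
    simp only [this, Finset.sum_sub_distrib, ← Finset.mul_sum, sum_con, sum_bUp_b h.1,
      sum_bUp_om h, sum_omUp_b h, sum_omUp_om h]
    simp only [Matrix.one_apply, ite_mul, one_mul, zero_mul, Finset.sum_ite_eq, Finset.mem_univ,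
      if_true]
    unfold con; ring
  have : ∀ k, D.mix x y c₁₁ c₁₂ c₂₁ c₂₂ c n k * D.con x y d₁ d₂ k
      = (c₁₁ * D.bUp n x + c₂₁ * D.omUp n x y) * (D.con x y d₁ d₂ k * D.b k x)
        + (c₁₂ * D.bUp n x + c₂₂ * D.omUp n x y) * (D.con x y d₁ d₂ k * D.om k x y)
        + c * (D.con x y d₁ d₂ k * D.rMix n k x y) := by
    intro k; unfold mix; ring
  simp only [this, Finset.sum_add_distrib, ← Finset.mul_sum, hr, sum_con, sum_bUp_b h.1,
      sum_bUp_om h, sum_omUp_b h, sum_omUp_om h]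
  unfold con; ring

lemma sum_rUp (i : Fin N) (X : Fin N → ℝ) : ∑ n, D.rUp i n x y * X n
    = ∑ n, (D.a x)⁻¹ i n * X n - D.bUp i x * ∑ n, D.bUp n x * X n
      - D.omUp i x y * ∑ n, D.omUp n x y * X n := by
  simp only [Finset.mul_sum, ← Finset.sum_sub_distrib]
  refine Finset.sum_congr rfl fun n _ => by unfold rUp; ring

lemma sum_inv_om (h : D.Reg x y) (i : Fin N) : ∑ n, (D.a x)⁻¹ i n * D.om n x y = D.omUp i x y := by
  have : ∀ n, (D.a x)⁻¹ i n * D.om n x y = ∑ k, (D.a x)⁻¹ i n * D.a x n k * D.omUp k x y := by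
    intro n; rw [← sum_a_omUp h, Finset.mul_sum]; simp only [mul_assoc]
  simp only [this]
  rw [Finset.sum_comm]
  simp only [← Finset.sum_mul, ← Matrix.mul_apply, inv_mul_a h.1]
  simp [Matrix.one_apply]

lemma sum_rUp_b (h : D.Reg x y) (i : Fin N) : ∑ n, D.rUp i n x y * D.b n x = 0 := by
  rw [sum_rUp, sum_bUp_b h.1, sum_omUp_b h]
  unfold bUp; ring

lemma sum_rUp_om (h : D.Reg x y) (i : Fin N) : ∑ n, D.rUp i n x y * D.om n x y = 0 := by
  rw [sum_rUp, sum_bUp_om h, sum_omUp_om h, sum_inv_om h]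
  ring

lemma sum_rUp_r (h : D.Reg x y) (i k : Fin N) :
    ∑ n, D.rUp i n x y * D.r n k x y = D.rMix i k x y := by
  rw [sum_rUp, sum_bUp_r h, sum_omUp_r h]
  have : ∀ n, (D.a x)⁻¹ i n * D.r n k x y = (D.a x)⁻¹ i n * D.a x n k
      - D.b k x * ((D.a x)⁻¹ i n * D.b n x) - D.om k x y * ((D.a x)⁻¹ i n * D.om n x y) := by
    intro n; unfold r; ring
  simp only [this, Finset.sum_sub_distrib, ← Finset.mul_sum, sum_inv_om h, ← Matrix.mul_apply,
    inv_mul_a h.1]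
  unfold rMix bUp; ring

lemma sum_tenUp (c₁₁ c₁₂ c₂₁ c₂₂ c : ℝ) (i : Fin N) (X : Fin N → ℝ) :
    ∑ n, D.tenUp x y c₁₁ c₁₂ c₂₁ c₂₂ c i n * X n
      = (c₁₁ * D.bUp i x + c₂₁ * D.omUp i x y) * ∑ n, D.bUp n x * X n
        + (c₁₂ * D.bUp i x + c₂₂ * D.omUp i x y) * ∑ n, D.omUp n x y * X n
        + c * ∑ n, D.rUp i n x y * X n := by
  simp only [Finset.mul_sum, ← Finset.sum_add_distrib]
  refine Finset.sum_congr rfl fun n _ => by unfold tenUp; ring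

lemma tenUp_cov (h : D.Reg x y) (c₁₁ c₁₂ c₂₁ c₂₂ c d₁ d₂ : ℝ) (i : Fin N) :
    ∑ n, D.tenUp x y c₁₁ c₁₂ c₂₁ c₂₂ c i n * D.cov x y d₁ d₂ n
      = D.con x y (c₁₁ * d₁ + c₁₂ * d₂) (c₂₁ * d₁ + c₂₂ * d₂) i := by
  simp only [sum_tenUp, sum_cov, sum_bUp_b h.1, sum_bUp_om h, sum_omUp_b h, sum_omUp_om h,
    sum_rUp_b h, sum_rUp_om h]
  unfold con; ring

lemma tenUp_ten (h : D.Reg x y) (c₁₁ c₁₂ c₂₁ c₂₂ c d₁₁ d₁₂ d₂₁ d₂₂ d : ℝ) (i k : Fin N) :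
    ∑ n, D.tenUp x y c₁₁ c₁₂ c₂₁ c₂₂ c i n * D.ten x y d₁₁ d₁₂ d₂₁ d₂₂ d n k
      = D.mix x y (c₁₁ * d₁₁ + c₁₂ * d₂₁) (c₁₁ * d₁₂ + c₁₂ * d₂₂) (c₂₁ * d₁₁ + c₂₂ * d₂₁)
        (c₂₁ * d₁₂ + c₂₂ * d₂₂) (c * d) i k := by
  simp only [sum_tenUp, sum_ten, sum_bUp_b h.1, sum_bUp_om h, sum_omUp_b h, sum_omUp_om h,
    sum_rUp_b h, sum_rUp_om h, sum_rUp_r h, sum_bUp_r h, sum_omUp_r h]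
  unfold mix; ring

lemma mix_one (n k : Fin N) :
    D.mix x y 1 0 0 1 1 n k = (1 : Matrix (Fin N) (Fin N) ℝ) n k := by
  unfold mix rMix; ring

lemma mix_trace (h : D.Reg x y) (c₁₁ c₁₂ c₂₁ c₂₂ c : ℝ) :
    ∑ n, D.mix x y c₁₁ c₁₂ c₂₁ c₂₂ c n n = c₁₁ + c₂₂ + c * (N - 2) := by
  have e : ∀ n, D.mix x y c₁₁ c₁₂ c₂₁ c₂₂ c n n = (c₁₁ - c) * (D.bUp n x * D.b n x)
      + c₁₂ * (D.bUp n x * D.om n x y) + c₂₁ * (D.omUp n x y * D.b n x)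
      + (c₂₂ - c) * (D.omUp n x y * D.om n x y) + c * 1 := by
    intro n; unfold mix rMix; rw [Matrix.one_apply_eq]; ring
  simp only [e, Finset.sum_add_distrib, ← Finset.mul_sum, sum_bUp_b h.1, sum_bUp_om h,
    sum_omUp_b h, sum_omUp_om h]
  simp
  ring

end FinsleroidChart

namespace FinsleroidChart

open Finsleroid Finsler

variable {N : ℕ} {D : FinsleroidChart N} {x y : Vec N}

/-! ### The metric tensor and the Cartan tensor -/

section Defs

variable (D : FinsleroidChart N)

/-- `B = b² + g b q + q²` at a line element. -/
def B : LineFun N := fun x y => BFun (D.g x) (D.bet x y) (D.q x y)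

/-- `J = K² / B` at a line element. -/
def J : LineFun N := fun x y => JFun (D.g x) (D.bet x y) (D.q x y)

/-- `M = ∂ ln K² / ∂g` at a line element. -/
def MF : LineFun N := fun x y => MFun (D.g x) (D.bet x y) (D.q x y)

/-- The covector `m_i = (b + g q) b_i + q ω_i = u_i + g q b_i`, which is proportional to `l_i`. -/
def mLow (i : Fin N) : LineFun N := fun x y =>
  D.cov x y (D.bet x y + D.g x * D.q x y) (D.q x y) i

/-- The covector `n_i = q b_i - b ω_i`, which annihilates `y` and is proportional to `A_i`. -/
def nLow (i : Fin N) : LineFun N := fun x y => D.cov x y (D.q x y) (-D.bet x y) i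

/-- The explicit form `g_{ij} = J (r_{ij} + (m_i m_j + n_i n_j) / B)` of the metric tensor. -/
def gE (i j : Fin N) : LineFun N := fun x y =>
  D.ten x y (D.J x y / D.B x y * ((D.bet x y + D.g x * D.q x y) ^ 2 + D.q x y ^ 2))
    (D.J x y / D.B x y * (D.g x * D.q x y ^ 2)) (D.J x y / D.B x y * (D.g x * D.q x y ^ 2))
    (D.J x y / D.B x y * (D.q x y ^ 2 + D.bet x y ^ 2)) (D.J x y) i j

/-- The explicit form of the reciprocal metric tensor. -/
def gUpE (i j : Fin N) : LineFun N := fun x y =>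
  D.tenUp x y (1 / (D.J x y * D.B x y) * (D.q x y ^ 2 + D.bet x y ^ 2))
    (-(1 / (D.J x y * D.B x y) * (D.g x * D.q x y ^ 2)))
    (-(1 / (D.J x y * D.B x y) * (D.g x * D.q x y ^ 2)))
    (1 / (D.J x y * D.B x y) * ((D.bet x y + D.g x * D.q x y) ^ 2 + D.q x y ^ 2))
    (1 / D.J x y) i j

/-- The explicit form of the Cartan tensor `C_{ijk} = (1/2) ∂g_{ij}/∂yᵏ`. -/
def cE (i j k : Fin N) : LineFun N := fun x y =>
  D.g x * D.J x y / (2 * D.B x y) * (D.r i j x y * D.nLow k x y + D.r i k x y * D.nLow j x y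
    + D.r j k x y * D.nLow i x y
    + 2 / D.B x y * (D.nLow i x y * D.nLow j x y * D.nLow k x y))

/-- The explicit form of the Cartan vector `A_k`. -/
def aE (k : Fin N) : LineFun N := fun x y => N / 2 * (D.g x * D.F x y / D.B x y) * D.nLow k x y

end Defs

lemma B_pos (h : D.Reg x y) : 0 < D.B x y := BFun_pos (D.g_gt x) (D.g_lt x) h.2
lemma J_pos (h : D.Reg x y) : 0 < D.J x y := JFun_pos (D.g_gt x) (D.g_lt x) h.2
lemma F_pos (h : D.Reg x y) : 0 < D.F x y := KFun_pos (D.g_gt x) (D.g_lt x) h.2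
lemma F_sq (h : D.Reg x y) : D.F x y ^ 2 = D.B x y * D.J x y :=
  KFun_sq (D.g_gt x) (D.g_lt x) h.2
lemma B_eq (D : FinsleroidChart N) (x y : Vec N) :
    D.B x y = D.bet x y ^ 2 + D.g x * D.bet x y * D.q x y + D.q x y ^ 2 := rfl

/-! #### Smoothness -/

lemma smoothFun_g : D.SmoothFun fun x _ => D.g x := fun _ _ h => contDiffAt_g h.1
lemma smoothFun_b (i : Fin N) : D.SmoothFun fun x _ => D.b i x := fun _ _ h => contDiffAt_b h.1 i
lemma smoothFun_bet : D.SmoothFun D.bet := fun _ _ h => contDiffAt_bet h.1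
lemma smoothFun_q : D.SmoothFun D.q := fun _ _ h => contDiffAt_q h
lemma smoothFun_om (i : Fin N) : D.SmoothFun (D.om i) := fun _ _ h => contDiffAt_om h i
lemma smoothFun_r (i j : Fin N) : D.SmoothFun (D.r i j) := fun _ _ h => contDiffAt_r h i j
lemma smoothFun_F : D.SmoothFun D.F := fun _ _ h => contDiffAt_F h
lemma smoothFun_B : D.SmoothFun D.B := fun _ _ h =>
  contDiffAt_BFun (contDiffAt_g h.1) (contDiffAt_bet h.1) (contDiffAt_q h)
lemma smoothFun_J : D.SmoothFun D.J := fun x _ h =>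
  contDiffAt_JFun (contDiffAt_g h.1) (contDiffAt_bet h.1) (contDiffAt_q h) (D.g_gt x) (D.g_lt x) h.2
lemma smoothFun_MF : D.SmoothFun D.MF := fun x _ h =>
  contDiffAt_MFun (contDiffAt_g h.1) (contDiffAt_bet h.1) (contDiffAt_q h) (D.g_gt x) (D.g_lt x) h.2

lemma SmoothFun.mul {f f' : LineFun N} (hf : D.SmoothFun f) (hf' : D.SmoothFun f') :
    D.SmoothFun fun x y => f x y * f' x y := fun x y h => (hf x y h).mul (hf' x y h)

lemma SmoothFun.add {f f' : LineFun N} (hf : D.SmoothFun f) (hf' : D.SmoothFun f') :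
    D.SmoothFun fun x y => f x y + f' x y := fun x y h => (hf x y h).add (hf' x y h)

lemma SmoothFun.neg {f : LineFun N} (hf : D.SmoothFun f) :
    D.SmoothFun fun x y => -f x y := fun x y h => (hf x y h).neg

lemma SmoothFun.div {f f' : LineFun N} (hf : D.SmoothFun f) (hf' : D.SmoothFun f')
    (h0 : ∀ x y, D.Reg x y → f' x y ≠ 0) :
    D.SmoothFun fun x y => f x y / f' x y := fun x y h => (hf x y h).div (hf' x y h) (h0 x y h)

lemma SmoothFun.pow {f : LineFun N} (hf : D.SmoothFun f) (n : ℕ) :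
    D.SmoothFun fun x y => f x y ^ n := fun x y h => (hf x y h).pow n

lemma smoothFun_const (c : ℝ) : D.SmoothFun fun _ _ => c := fun _ _ _ => contDiffAt_const

lemma SmoothFun.cov {f₁ f₂ : LineFun N} (h₁ : D.SmoothFun f₁) (h₂ : D.SmoothFun f₂) (i : Fin N) :
    D.SmoothFun fun x y => D.cov x y (f₁ x y) (f₂ x y) i :=
  (h₁.mul (smoothFun_b i)).add (h₂.mul (smoothFun_om i))

lemma SmoothFun.ten {f₁₁ f₁₂ f₂₁ f₂₂ f : LineFun N} (h₁₁ : D.SmoothFun f₁₁)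
    (h₁₂ : D.SmoothFun f₁₂) (h₂₁ : D.SmoothFun f₂₁) (h₂₂ : D.SmoothFun f₂₂) (hf : D.SmoothFun f)
    (i j : Fin N) : D.SmoothFun fun x y =>
      D.ten x y (f₁₁ x y) (f₁₂ x y) (f₂₁ x y) (f₂₂ x y) (f x y) i j :=
  ((((h₁₁.mul ((smoothFun_b i).mul (smoothFun_b j))).add
    (h₁₂.mul ((smoothFun_b i).mul (smoothFun_om j)))).add
    (h₂₁.mul ((smoothFun_om i).mul (smoothFun_b j)))).add
    (h₂₂.mul ((smoothFun_om i).mul (smoothFun_om j)))).add (hf.mul (smoothFun_r i j))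

lemma smoothFun_mLow (i : Fin N) : D.SmoothFun (D.mLow i) :=
  (smoothFun_bet.add (smoothFun_g.mul smoothFun_q)).cov smoothFun_q i

lemma smoothFun_nLow (i : Fin N) : D.SmoothFun (D.nLow i) :=
  smoothFun_q.cov smoothFun_bet.neg i

lemma smoothFun_gE (i j : Fin N) : D.SmoothFun (D.gE i j) := by
  have hJB := smoothFun_J.div (smoothFun_B (D := D)) fun x y h => (B_pos h).ne'
  have hg := smoothFun_g (D := D)
  have hq := smoothFun_q (D := D)
  have hb := smoothFun_bet (D := D)
  have h1 := hJB.mul (hg.mul (hq.pow 2))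
  exact SmoothFun.ten (hJB.mul (((hb.add (hg.mul hq)).pow 2).add (hq.pow 2))) h1 h1
    (hJB.mul ((hq.pow 2).add (hb.pow 2))) smoothFun_J i j

lemma smoothFun_aE (k : Fin N) : D.SmoothFun (D.aE k) :=
  ((smoothFun_const _).mul ((smoothFun_g.mul smoothFun_F).div smoothFun_B
    fun _ _ h => (B_pos h).ne')).mul (smoothFun_nLow k)

/-! #### Derivatives along lines -/

section LineDer

variable {ξ η : Vec N} {g' b' q' : ℝ} {β' ω' : Fin N → ℝ} {a' : Fin N → Fin N → ℝ}

lemma LineDer.B (hL : LineDer D x y ξ η g' b' q' β' ω' a') :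
    HasDerivAt (fun t : ℝ => D.B (x + t • ξ) (y + t • η))
      (D.bet x y * D.q x y * g' + (2 * D.bet x y + D.g x * D.q x y) * b'
        + (D.g x * D.bet x y + 2 * D.q x y) * q') 0 :=
  (hasDerivAt_BFun hL.g hL.bet hL.q).congr_deriv (by simp only [zero_smul, add_zero])

lemma LineDer.F (hL : LineDer D x y ξ η g' b' q' β' ω' a') (h : D.Reg x y) :
    HasDerivAt (fun t : ℝ => D.F (x + t • ξ) (y + t • η))
      (D.F x y * (D.MF x y / 2 * g' + ((D.bet x y + D.g x * D.q x y) * b' + D.q x y * q')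
        / D.B x y)) 0 :=
  (hasDerivAt_KFun hL.g hL.bet hL.q (D.g_gt _) (D.g_lt _) (by simpa using h.2)).congr_deriv
    (by simp only [zero_smul, add_zero]; rfl)

lemma LineDer.J (hL : LineDer D x y ξ η g' b' q' β' ω' a') (h : D.Reg x y) :
    HasDerivAt (fun t : ℝ => D.J (x + t • ξ) (y + t • η))
      (D.J x y * ((D.MF x y - D.bet x y * D.q x y / D.B x y) * g'
        + D.g x * (D.q x y * b' - D.bet x y * q') / D.B x y)) 0 := by
  have hB := (B_pos h).ne'
  refine (((hL.F h).pow 2).div hL.B (by simpa using hB)).congr_deriv ?_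
  have e : D.J x y = D.F x y ^ 2 / D.B x y := rfl
  simp only [zero_smul, add_zero, Pi.pow_apply, e]
  field_simp
  rw [B_eq]
  push_cast
  ring

lemma LineDer.MF (hL : LineDer D x y 0 η 0 b' q' β' ω' a') (h : D.Reg x y) :
    HasDerivAt (fun t : ℝ => D.MF x (y + t • η))
      (2 * D.q x y ^ 2 * (D.q x y * b' - D.bet x y * q') / D.B x y ^ 2) 0 := by
  have hb := hL.bet
  have hq := hL.q
  simp only [smul_zero, add_zero] at hb hq
  exact (hasDerivAt_MFun hb hq (D.g_gt x) (D.g_lt x) (by simpa using h.2)).congr_deriv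
    (by simp only [zero_smul, add_zero]; rfl)

lemma LineDer.cov (hL : LineDer D x y ξ η g' b' q' β' ω' a') {f₁ f₂ : LineFun N} {d₁ d₂ : ℝ}
    (h₁ : HasDerivAt (fun t : ℝ => f₁ (x + t • ξ) (y + t • η)) d₁ 0)
    (h₂ : HasDerivAt (fun t : ℝ => f₂ (x + t • ξ) (y + t • η)) d₂ 0) (i : Fin N) :
    HasDerivAt (fun t : ℝ => D.cov (x + t • ξ) (y + t • η) (f₁ (x + t • ξ) (y + t • η))
        (f₂ (x + t • ξ) (y + t • η)) i)
      (D.cov x y d₁ d₂ i + f₁ x y * β' i + f₂ x y * ω' i) 0 := by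
  refine ((h₁.mul (hL.b i)).add (h₂.mul (hL.om i))).congr_deriv ?_
  simp only [zero_smul, add_zero, FinsleroidChart.cov]
  ring

lemma LineDer.r (hL : LineDer D x y ξ η g' b' q' β' ω' a') (i j : Fin N) :
    HasDerivAt (fun t : ℝ => D.r i j (x + t • ξ) (y + t • η))
      (a' i j - (β' i * D.b j x + D.b i x * β' j) - (ω' i * D.om j x y + D.om i x y * ω' j)) 0 := by
  refine (((hL.a i j).sub ((hL.b i).mul (hL.b j))).sub ((hL.om i).mul (hL.om j))).congr_deriv ?_
  simp only [zero_smul, add_zero]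

lemma LineDer.ten (hL : LineDer D x y ξ η g' b' q' β' ω' a') {f₁₁ f₁₂ f₂₁ f₂₂ f : LineFun N}
    {d₁₁ d₁₂ d₂₁ d₂₂ d : ℝ}
    (h₁₁ : HasDerivAt (fun t : ℝ => f₁₁ (x + t • ξ) (y + t • η)) d₁₁ 0)
    (h₁₂ : HasDerivAt (fun t : ℝ => f₁₂ (x + t • ξ) (y + t • η)) d₁₂ 0)
    (h₂₁ : HasDerivAt (fun t : ℝ => f₂₁ (x + t • ξ) (y + t • η)) d₂₁ 0)
    (h₂₂ : HasDerivAt (fun t : ℝ => f₂₂ (x + t • ξ) (y + t • η)) d₂₂ 0)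
    (hf : HasDerivAt (fun t : ℝ => f (x + t • ξ) (y + t • η)) d 0) (i j : Fin N) :
    HasDerivAt (fun t : ℝ => D.ten (x + t • ξ) (y + t • η) (f₁₁ (x + t • ξ) (y + t • η))
        (f₁₂ (x + t • ξ) (y + t • η)) (f₂₁ (x + t • ξ) (y + t • η)) (f₂₂ (x + t • ξ) (y + t • η))
        (f (x + t • ξ) (y + t • η)) i j)
      (D.ten x y d₁₁ d₁₂ d₂₁ d₂₂ d i j + f₁₁ x y * (β' i * D.b j x + D.b i x * β' j)
        + f₁₂ x y * (β' i * D.om j x y + D.b i x * ω' j)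
        + f₂₁ x y * (ω' i * D.b j x + D.om i x y * β' j)
        + f₂₂ x y * (ω' i * D.om j x y + D.om i x y * ω' j)
        + f x y * (a' i j - (β' i * D.b j x + D.b i x * β' j)
          - (ω' i * D.om j x y + D.om i x y * ω' j))) 0 := by
  refine (((((h₁₁.mul ((hL.b i).mul (hL.b j))).add (h₁₂.mul ((hL.b i).mul (hL.om j)))).add
    (h₂₁.mul ((hL.om i).mul (hL.b j)))).add (h₂₂.mul ((hL.om i).mul (hL.om j)))).add
    (hf.mul (hL.r i j))).congr_deriv ?_
  simp only [zero_smul, add_zero, FinsleroidChart.ten, Pi.mul_apply]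
  ring

lemma SmoothFun.lineDir_eq {f : LineFun N} (hf : D.SmoothFun f) (h : D.Reg x y) {d : ℝ}
    (hd : HasDerivAt (fun t : ℝ => f (x + t • ξ) (y + t • η)) d 0) : lineDir f x y ξ η = d :=
  (hf.hasDerivAt h ξ η).unique hd

end LineDer

/-! #### Vertical derivatives -/

lemma pdy_F_sq (i : Fin N) :
    D.EqReg (pdy (fun x y => D.F x y ^ 2) i) fun x y => 2 * (D.J x y * D.mLow i x y) := by
  intro x y h
  have hL := lineDer_vertical h i
  have hB := (B_pos h).ne'
  rw [(smoothFun_F.pow 2).pdy_eq h, (smoothFun_F.pow 2).lineDir_eq h ((hL.F h).pow 2)]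
  have e : D.J x y = D.F x y ^ 2 / D.B x y := rfl
  simp only [zero_smul, add_zero, e, mLow, cov]
  field_simp
  push_cast
  ring

lemma gLow_eq (i j : Fin N) : D.EqReg (gLow D.F i j) (D.gE i j) := by
  intro x y h
  have hL := lineDer_vertical h j
  have hB := (B_pos h).ne'
  have hs : D.SmoothFun fun x y => 2 * (D.J x y * D.mLow i x y) :=
    (smoothFun_const 2).mul (smoothFun_J.mul (smoothFun_mLow i))
  have hm := hL.cov (f₁ := fun x y => D.bet x y + D.g x * D.q x y) (f₂ := D.q)
    (hL.bet.add (hL.g.mul hL.q)) hL.q i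
  rw [gLow, (pdy_F_sq i).pdy j x y h, hs.pdy_eq h,
    hs.lineDir_eq h (((hL.J h).mul hm).const_mul 2)]
  have hq0 := h.2.ne'
  simp only [zero_smul, add_zero, cov, gE, ten]
  field_simp
  rw [B_eq]
  ring

lemma gE_symm (i j : Fin N) : D.gE i j x y = D.gE j i x y := by
  unfold gE; rw [ten_swap]

lemma pdy_gE (i j k : Fin N) : D.EqReg (pdy (D.gE i j) k) fun x y => 2 * D.cE i j k x y := by
  intro x y h
  have hL := lineDer_vertical h k
  have hB := (B_pos h).ne'
  have hq0 := h.2.ne'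
  rw [(smoothFun_gE i j).pdy_eq h]
  have hJB := (hL.J h).div hL.B (by simpa using hB)
  have h12 := hJB.mul (hL.g.mul (hL.q.pow 2))
  rw [(smoothFun_gE i j).lineDir_eq h (hL.ten
    (f₁₁ := fun x y => D.J x y / D.B x y * ((D.bet x y + D.g x * D.q x y) ^ 2 + D.q x y ^ 2))
    (f₁₂ := fun x y => D.J x y / D.B x y * (D.g x * D.q x y ^ 2))
    (f₂₁ := fun x y => D.J x y / D.B x y * (D.g x * D.q x y ^ 2))
    (f₂₂ := fun x y => D.J x y / D.B x y * (D.q x y ^ 2 + D.bet x y ^ 2)) (f := D.J)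
    (hJB.mul (((hL.bet.add (hL.g.mul hL.q)).pow 2).add (hL.q.pow 2))) h12 h12
    (hJB.mul ((hL.q.pow 2).add (hL.bet.pow 2))) (hL.J h) i j)]
  simp only [zero_smul, add_zero, ten, cE, nLow, cov, Pi.add_apply, Pi.mul_apply, Pi.div_apply,
    Pi.pow_apply]
  push_cast
  field_simp
  rw [B_eq]
  ring

end FinsleroidChart

namespace FinsleroidChart

open Finsleroid Finsler

variable {N : ℕ} {D : FinsleroidChart N} {x y : Vec N}

/-! ### The reciprocal tensor and the Cartan vector -/

lemma sum_gUpE_gE (h : D.Reg x y) (i k : Fin N) :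
    ∑ n, D.gUpE i n x y * D.gE n k x y = (1 : Matrix (Fin N) (Fin N) ℝ) i k := by
  have hB := (B_pos h).ne'
  have hJ := (J_pos h).ne'
  simp only [gUpE, gE]
  rw [tenUp_ten h, ← mix_one (D := D) (x := x) (y := y)]
  congr 1 <;> field_simp <;> rw [B_eq] <;> ring

lemma gMat_eq (h : D.Reg x y) : gMat D.F x y = Matrix.of fun i j => D.gE i j x y := by
  ext i j
  exact gLow_eq i j x y h

lemma gUpE_mul_gMat (h : D.Reg x y) :
    (Matrix.of fun i j => D.gUpE i j x y) * gMat D.F x y = 1 := by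
  rw [gMat_eq h]
  ext i k
  rw [Matrix.mul_apply]
  exact sum_gUpE_gE h i k

lemma isUnit_det_gMat (h : D.Reg x y) : IsUnit (gMat D.F x y).det :=
  Matrix.isUnit_det_of_left_inverse (gUpE_mul_gMat h)

lemma gUp_eq (i j : Fin N) : D.EqReg (gUp D.F i j) (D.gUpE i j) := by
  intro x y h
  rw [gUp, Matrix.inv_eq_left_inv (gUpE_mul_gMat h)]
  rfl

lemma gUpE_symm (i j : Fin N) : D.gUpE i j x y = D.gUpE j i x y := by
  unfold gUpE tenUp; rw [rUp_symm]; ring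

variable (D) in
/-- The vector `νⁱ = q bⁱ - (b + g q) ωⁱ`, which equals `J g^{ij} n_j`. -/
def nUp (x y : Vec N) (i : Fin N) : ℝ :=
  D.con x y (D.q x y) (-(D.bet x y + D.g x * D.q x y)) i

lemma y_eq_con (h : D.Reg x y) (i : Fin N) : y i = D.con x y (D.bet x y) (D.q x y) i := y_eq h i

lemma gUpE_cov (h : D.Reg x y) (c₁ c₂ : ℝ) (i : Fin N) :
    ∑ n, D.gUpE i n x y * D.cov x y c₁ c₂ n = D.con x y
      (1 / (D.J x y * D.B x y) * ((D.q x y ^ 2 + D.bet x y ^ 2) * c₁ - D.g x * D.q x y ^ 2 * c₂))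
      (1 / (D.J x y * D.B x y) * (((D.bet x y + D.g x * D.q x y) ^ 2 + D.q x y ^ 2) * c₂
        - D.g x * D.q x y ^ 2 * c₁)) i := by
  unfold gUpE
  rw [tenUp_cov h]
  congr 1 <;> ring

lemma gUpE_nLow (h : D.Reg x y) (i : Fin N) :
    ∑ n, D.gUpE i n x y * D.nLow n x y = 1 / D.J x y * D.nUp x y i := by
  have hB := (B_pos h).ne'
  have hJ := (J_pos h).ne'
  unfold nLow nUp
  rw [gUpE_cov h]
  simp only [con]
  field_simp
  rw [B_eq]
  ring

lemma gUpE_r (h : D.Reg x y) (i k : Fin N) :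
    ∑ n, D.gUpE i n x y * D.r n k x y = 1 / D.J x y * D.rMix i k x y := by
  have : ∀ n, D.r n k x y = D.ten x y 0 0 0 0 1 n k := by intro n; simp [ten]
  simp only [gUpE, this]
  rw [tenUp_ten h]
  simp only [mix]
  ring

lemma nUp_nLow (h : D.Reg x y) : ∑ n, D.nUp x y n * D.nLow n x y = D.B x y := by
  unfold nUp nLow
  rw [con_cov h, B_eq]
  ring

lemma con_r (h : D.Reg x y) (c₁ c₂ : ℝ) (k : Fin N) :
    ∑ n, D.con x y c₁ c₂ n * D.r n k x y = 0 := by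
  rw [sum_con, sum_bUp_r h, sum_omUp_r h]; ring

lemma sum_cE (X : Fin N → ℝ) (j k : Fin N) : ∑ n, X n * D.cE n j k x y
    = D.g x * D.J x y / (2 * D.B x y) * ((∑ n, X n * D.r n j x y) * D.nLow k x y
      + (∑ n, X n * D.r n k x y) * D.nLow j x y + D.r j k x y * (∑ n, X n * D.nLow n x y)
      + 2 / D.B x y * ((∑ n, X n * D.nLow n x y) * D.nLow j x y * D.nLow k x y)) := by
  simp only [Finset.sum_mul, Finset.mul_sum, ← Finset.sum_add_distrib]
  refine Finset.sum_congr rfl fun n _ => by unfold cE; ring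

lemma cE_swap (i j k : Fin N) : D.cE i j k x y = D.cE j i k x y := by
  unfold cE; rw [r_symm i j]; ring

lemma cE_swap' (i j k : Fin N) : D.cE i j k x y = D.cE i k j x y := by
  unfold cE; rw [r_symm j k]; ring

lemma con_cE (h : D.Reg x y) (c₁ c₂ : ℝ) (j k : Fin N) :
    ∑ n, D.con x y c₁ c₂ n * D.cE n j k x y
      = D.g x * D.J x y / (2 * D.B x y) * (c₁ * D.q x y - c₂ * D.bet x y) *
        D.ten x y (2 / D.B x y * D.q x y ^ 2) (-(2 / D.B x y * (D.q x y * D.bet x y)))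
          (-(2 / D.B x y * (D.q x y * D.bet x y))) (2 / D.B x y * D.bet x y ^ 2) 1 j k := by
  rw [sum_cE, con_r h, con_r h]
  simp only [nLow]
  rw [con_cov h]
  unfold ten cov
  ring

lemma cartan_eq (i j k : Fin N) :
    D.EqReg (cartan D.F i j k) fun x y => D.F x y * D.cE i j k x y := by
  intro x y h
  rw [cartan, (gLow_eq i j).pdy k x y h, pdy_gE i j k x y h]
  ring

lemma cTensor_eq (i j k : Fin N) : D.EqReg (cTensor D.F i j k) (D.cE i j k) := by
  intro x y h
  have := (F_pos h).ne'
  rw [cTensor, cartan_eq i j k x y h]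
  field_simp

lemma cartanVec_eq (k : Fin N) : D.EqReg (cartanVec D.F k) (D.aE k) := by
  intro x y h
  have hB := (B_pos h).ne'
  have hJ := (J_pos h).ne'
  have e1 : ∀ i, ∑ j, gUp D.F i j x y * cartan D.F i j k x y
      = D.F x y * (D.g x / (2 * D.B x y)) * (D.nLow k x y * D.mix x y 0 0 0 0 1 i i
        + D.nUp x y i * D.r i k x y + D.mix x y 0 0 0 0 1 i k * D.nLow i x y
        + 2 / D.B x y * D.nLow k x y * (D.nUp x y i * D.nLow i x y)) := by
    intro i
    have e2 : ∀ j, gUp D.F i j x y * cartan D.F i j k x y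
        = D.F x y * (D.gUpE i j x y * D.cE j i k x y) := by
      intro j
      rw [gUp_eq i j x y h, cartan_eq i j k x y h, cE_swap]; ring
    have e3 : ∀ i k, D.mix x y 0 0 0 0 1 i k = D.rMix i k x y := by
      intro i k; unfold mix; ring
    simp only [e2]
    rw [← Finset.mul_sum, sum_cE, gUpE_r h, gUpE_r h, gUpE_nLow h, e3, e3]
    field_simp
    ring
  unfold cartanVec
  simp only [e1]
  rw [← Finset.mul_sum]
  simp only [Finset.sum_add_distrib, ← Finset.mul_sum]
  rw [mix_trace h, nUp_nLow h]
  have e4 : ∑ i, D.nUp x y i * D.r i k x y = 0 := con_r h _ _ k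
  have e5 : ∑ i, D.mix x y 0 0 0 0 1 i k * D.nLow i x y = 0 := by
    unfold nLow; rw [mix_cov h]; simp [cov]
  rw [e4, e5]
  unfold aE
  field_simp
  ring

lemma cartanVecUp_eq (k : Fin N) : D.EqReg (cartanVecUp D.F k) fun x y =>
    N / 2 * (D.g x * D.F x y / (D.J x y * D.B x y)) * D.nUp x y k := by
  intro x y h
  have hB := (B_pos h).ne'
  have hJ := (J_pos h).ne'
  have : ∀ j, gUp D.F k j x y * cartanVec D.F j x y = N / 2 * (D.g x * D.F x y / D.B x y)
      * (D.gUpE k j x y * D.nLow j x y) := by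
    intro j
    rw [gUp_eq k j x y h, cartanVec_eq j x y h]; unfold aE; ring
  simp only [cartanVecUp, this, ← Finset.mul_sum, gUpE_nLow h]
  field_simp

lemma cartanNorm_eq : D.EqReg (cartanNorm D.F) fun x _ => N / 2 * |D.g x| := by
  intro x y h
  have hB := (B_pos h).ne'
  have hJ := (J_pos h).ne'
  have : ∀ k, cartanVecUp D.F k x y * cartanVec D.F k x y
      = (N / 2) ^ 2 * (D.g x ^ 2 * D.F x y ^ 2 / (D.J x y * D.B x y ^ 2)) *
        (D.nUp x y k * D.nLow k x y) := by
    intro k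
    rw [cartanVecUp_eq k x y h, cartanVec_eq k x y h]; unfold aE; field_simp
  simp only [cartanNorm, this, ← Finset.mul_sum, nUp_nLow h, F_sq h]
  rw [Real.sqrt_eq_iff_mul_self_eq]
  · rw [mul_mul_mul_comm, abs_mul_abs_self]; field_simp
  · have : D.B x y * D.J x y / (D.J x y * D.B x y ^ 2) * D.B x y = 1 := by field_simp
    have e : (N / 2 : ℝ) ^ 2 * (D.g x ^ 2 * (D.B x y * D.J x y) / (D.J x y * D.B x y ^ 2)) * D.B x y
      = (N / 2 : ℝ) ^ 2 * D.g x ^ 2 * (D.B x y * D.J x y / (D.J x y * D.B x y ^ 2) * D.B x y) := by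
      ring
    rw [e, this]; positivity
  · positivity

/-! ### Horizontal derivatives -/

variable (D) in
/-- The explicit form of the derivative `Q_{ij}` of `g_{ij} = J (r_{ij} + (m_i m_j + n_i n_j) / B)`
with respect to the parameter `g`, for fixed `b`, `q`, `b_i`, `ω_i`, `a_{ij}`. -/
def QE (i j : Fin N) : LineFun N := fun x y =>
  D.ten x y
    (D.J x y / D.B x y * ((D.MF x y - 2 * D.bet x y * D.q x y / D.B x y)
      * ((D.bet x y + D.g x * D.q x y) ^ 2 + D.q x y ^ 2)
      + 2 * D.q x y * (D.bet x y + D.g x * D.q x y)))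
    (D.J x y / D.B x y * ((D.MF x y - 2 * D.bet x y * D.q x y / D.B x y)
      * (D.g x * D.q x y ^ 2) + D.q x y ^ 2))
    (D.J x y / D.B x y * ((D.MF x y - 2 * D.bet x y * D.q x y / D.B x y)
      * (D.g x * D.q x y ^ 2) + D.q x y ^ 2))
    (D.J x y / D.B x y * ((D.MF x y - 2 * D.bet x y * D.q x y / D.B x y)
      * (D.q x y ^ 2 + D.bet x y ^ 2)))
    (D.J x y * (D.MF x y - D.bet x y * D.q x y / D.B x y)) i j

lemma QE_symm (i j : Fin N) : D.QE i j x y = D.QE j i x y := by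
  unfold QE; rw [ten_swap]

variable {Gam : Vec N → Fin N → Fin N → Fin N → ℝ} {μ : Vec N → ℝ}

lemma sum_Gam_ten (Γ : Fin N → ℝ) (c₁₁ c₁₂ c₂₁ c₂₂ c : ℝ) (j : Fin N) :
    ∑ n, Γ n * D.ten x y c₁₁ c₁₂ c₂₁ c₂₂ c n j
      = c₁₁ * ((∑ n, Γ n * D.b n x) * D.b j x) + c₁₂ * ((∑ n, Γ n * D.b n x) * D.om j x y)
        + c₂₁ * ((∑ n, Γ n * D.om n x y) * D.b j x) + c₂₂ * ((∑ n, Γ n * D.om n x y) * D.om j x y)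
        + c * ((∑ n, Γ n * D.a x n j) - (∑ n, Γ n * D.b n x) * D.b j x
          - (∑ n, Γ n * D.om n x y) * D.om j x y) := by
  simp only [Finset.mul_sum, Finset.sum_mul, ← Finset.sum_add_distrib, ← Finset.sum_sub_distrib]
  refine Finset.sum_congr rfl fun n _ => by unfold ten r; ring

/-- In coordinates an `x`-derivative of `g_{ij}` consists of the terms of a parallel transport along
the Riemannian connection and of the `g`-derivative of `g_{ij}` times `∂_k g = μ b_k`. -/
lemma pdx_gE (hP : D.IsParallel Gam μ) (h : D.Reg x y) (i j k : Fin N) :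
    pdx (D.gE i j) k x y = ∑ n, riemN Gam x y k n * (2 * D.cE i j n x y)
      + ∑ n, Gam x n i k * D.gE n j x y + ∑ n, Gam x n j k * D.gE n i x y
      + μ x * D.b k x * D.QE i j x y := by
  have hL := lineDer_horizontal hP h k
  have hB := (B_pos h).ne'
  have hq0 := h.2.ne'
  have e := (smoothFun_gE (D := D) i j).pdx_sub h k (riemN Gam x y k)
  simp only [pdy_gE i j _ x y h] at e
  rw [sub_eq_iff_eq_add'] at e
  rw [e, add_assoc, add_assoc]
  congr 1
  have hJB := (hL.J h).div hL.B (by simpa using hB)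
  have h12 := hJB.mul (hL.g.mul (hL.q.pow 2))
  rw [(smoothFun_gE i j).lineDir_eq h (hL.ten
    (f₁₁ := fun x y => D.J x y / D.B x y * ((D.bet x y + D.g x * D.q x y) ^ 2 + D.q x y ^ 2))
    (f₁₂ := fun x y => D.J x y / D.B x y * (D.g x * D.q x y ^ 2))
    (f₂₁ := fun x y => D.J x y / D.B x y * (D.g x * D.q x y ^ 2))
    (f₂₂ := fun x y => D.J x y / D.B x y * (D.q x y ^ 2 + D.bet x y ^ 2)) (f := D.J)
    (hJB.mul (((hL.bet.add (hL.g.mul hL.q)).pow 2).add (hL.q.pow 2))) h12 h12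
    (hJB.mul ((hL.q.pow 2).add (hL.bet.pow 2))) (hL.J h) i j)]
  simp only [zero_smul, add_zero, gE, QE, Pi.add_apply, Pi.mul_apply,
    Pi.div_apply, Pi.pow_apply, sum_Gam_ten, D.a_symm x i]
  generalize ∑ n, Gam x n i k * D.b n x = s1
  generalize ∑ n, Gam x n j k * D.b n x = s2
  generalize ∑ n, Gam x n i k * D.om n x y = s3
  generalize ∑ n, Gam x n j k * D.om n x y = s4
  generalize ∑ n, Gam x n i k * D.a x n j = s5
  generalize ∑ n, Gam x n j k * D.a x n i = s6
  push_cast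
  unfold ten
  generalize D.r i j x y = r
  field_simp
  ring

end FinsleroidChart

namespace FinsleroidChart

open Finsleroid Finsler

variable {N : ℕ} {D : FinsleroidChart N} {x y : Vec N}
  {Gam : Vec N → Fin N → Fin N → Fin N → ℝ} {μ : Vec N → ℝ}

/-! ### Christoffel symbols and spray -/

lemma sum_gUpE_lower (h : D.Reg x y) (v : Fin N → ℝ) (k : Fin N) :
    ∑ n, D.gUpE k n x y * ∑ m, v m * D.gE m n x y = v k := by
  simp only [Finset.mul_sum]
  rw [Finset.sum_comm]
  have : ∀ m, ∑ n, D.gUpE k n x y * (v m * D.gE m n x y)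
      = v m * (1 : Matrix (Fin N) (Fin N) ℝ) k m := by
    intro m
    rw [← sum_gUpE_gE h, Finset.mul_sum]
    refine Finset.sum_congr rfl fun n _ => ?_
    rw [gE_symm m n]; ring
  simp only [this]
  simp [Matrix.one_apply]

variable (D Gam μ) in
/-- The lowered Christoffel symbols `γ_{n,ij}` without the part `Γᵐ_{ij} g_{mn}`. -/
def chrE (n i j : Fin N) : LineFun N := fun x y =>
  ∑ m, riemN Gam x y j m * D.cE m n i x y + ∑ m, riemN Gam x y i m * D.cE m n j x y
    - ∑ m, riemN Gam x y n m * D.cE m i j x y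
    + μ x / 2 * (D.b j x * D.QE n i x y + D.b i x * D.QE n j x y - D.b n x * D.QE i j x y)

lemma cE_rot (i j k : Fin N) : D.cE i j k x y = D.cE k i j x y := by
  rw [cE_swap', cE_swap]

lemma christoffel_eq (hP : D.IsParallel Gam μ) (h : D.Reg x y) (k i j : Fin N) :
    christoffel D.F k i j x y
      = Gam x k i j + ∑ n, D.gUpE k n x y * D.chrE Gam μ n i j x y := by
  have e : ∀ n, gUp D.F k n x y * (pdx (gLow D.F n i) j x y + pdx (gLow D.F n j) i x y
      - pdx (gLow D.F j i) n x y) = 2 * (D.gUpE k n x y * ∑ m, Gam x m i j * D.gE m n x y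
        + D.gUpE k n x y * D.chrE Gam μ n i j x y) := by
    intro n
    rw [gUp_eq k n x y h, (gLow_eq n i).pdx j x y h, (gLow_eq n j).pdx i x y h,
      (gLow_eq j i).pdx n x y h, pdx_gE hP h, pdx_gE hP h, pdx_gE hP h]
    have s1 : ∀ p q, ∑ m, riemN Gam x y p m * (2 * D.cE n q m x y)
        = 2 * ∑ m, riemN Gam x y p m * D.cE m n q x y := by
      intro p q
      rw [Finset.mul_sum]
      exact Finset.sum_congr rfl fun m _ => by rw [cE_rot n q m]; ring
    have s2 : ∑ m, riemN Gam x y n m * (2 * D.cE j i m x y)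
        = 2 * ∑ m, riemN Gam x y n m * D.cE m i j x y := by
      rw [Finset.mul_sum]
      exact Finset.sum_congr rfl fun m _ => by rw [cE_rot j i m, cE_swap' m j i]; ring
    rw [s1, s1, s2]
    simp only [hP.symm x _ j i, hP.symm x _ n i, hP.symm x _ n j, chrE, QE_symm j i]
    ring
  simp only [christoffel, e]
  rw [← Finset.mul_sum, Finset.sum_add_distrib, sum_gUpE_lower h (fun m => Gam x m i j)]
  ring

lemma sum_y_cE (h : D.Reg x y) (j k : Fin N) : ∑ n, y n * D.cE n j k x y = 0 := by
  have : ∀ n, y n * D.cE n j k x y = D.con x y (D.bet x y) (D.q x y) n * D.cE n j k x y := by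
    intro n; rw [← y_eq_con h]
  simp only [this]
  rw [con_cE h]
  ring

lemma sum_y_sum_cE (h : D.Reg x y) (v : Fin N → ℝ) (n : Fin N) :
    ∑ i, y i * ∑ m, v m * D.cE m n i x y = 0 := by
  simp only [Finset.mul_sum]
  rw [Finset.sum_comm]
  have : ∀ m, ∑ i, y i * (v m * D.cE m n i x y) = v m * ∑ i, y i * D.cE i m n x y := by
    intro m
    rw [Finset.mul_sum]
    exact Finset.sum_congr rfl fun i _ => by rw [cE_rot m n i]; ring
  simp only [this, sum_y_cE h, mul_zero, Finset.sum_const_zero]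

lemma sum_y_cov (h : D.Reg x y) (c₁ c₂ : ℝ) :
    ∑ n, y n * D.cov x y c₁ c₂ n = D.bet x y * c₁ + D.q x y * c₂ := by
  rw [← con_cov h]
  exact Finset.sum_congr rfl fun n _ => by rw [← y_eq_con h]

/-- `Q_{nj} yʲ = (1/2) ∂²K²/∂g∂yⁿ`. -/
lemma sum_y_QE (h : D.Reg x y) (n : Fin N) : ∑ i, y i * D.QE i n x y
    = D.cov x y (D.J x y * (D.MF x y * (D.bet x y + D.g x * D.q x y) + D.q x y ^ 3 / D.B x y))
      (D.J x y * (D.MF x y * D.q x y - D.bet x y * D.q x y ^ 2 / D.B x y)) n := by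
  have hB := (B_pos h).ne'
  have : ∀ i, y i * D.QE i n x y = D.con x y (D.bet x y) (D.q x y) i * D.QE i n x y := by
    intro n; rw [← y_eq_con h]
  simp only [this]
  unfold QE
  rw [con_ten h]
  congr 1
  · field_simp
    rw [B_eq]
    ring
  · field_simp
    rw [B_eq]
    ring

variable (D μ) in
/-- The coefficient of `bᵏ` in the vector `Dᵏ` by which the spray of the Finsleroid metric function
differs from the Riemannian one. -/
def d₁ (x y : Vec N) : ℝ :=
  μ x / 2 * ((D.bet x y ^ 2 - D.q x y ^ 2) * D.MF x y + 2 * D.bet x y * D.q x y ^ 3 / D.B x y)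

variable (D μ) in
/-- The coefficient of `ωᵏ` in the vector `Dᵏ`. -/
def d₂ (x y : Vec N) : ℝ :=
  μ x / 2 * D.q x y * (D.bet x y * D.MF x y
    + (D.MF x y - 2 * D.bet x y * D.q x y / D.B x y) * (D.bet x y + D.g x * D.q x y))

lemma spray_eq (hP : D.IsParallel Gam μ) (h : D.Reg x y) (k : Fin N) :
    spray D.F k x y = ∑ i, ∑ j, Gam x k i j * y i * y j
      + D.con x y (D.d₁ μ x y) (D.d₂ μ x y) k := by
  have hB := (B_pos h).ne'
  have hJ := (J_pos h).ne'
  have e1 : spray D.F k x y = ∑ i, ∑ j, Gam x k i j * y i * y j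
      + ∑ n, D.gUpE k n x y * ∑ i, ∑ j, D.chrE Gam μ n i j x y * y i * y j := by
    have : ∑ n, D.gUpE k n x y * ∑ i, ∑ j, D.chrE Gam μ n i j x y * y i * y j
        = ∑ i, ∑ j, (∑ n, D.gUpE k n x y * D.chrE Gam μ n i j x y) * y i * y j := by
      simp only [Finset.mul_sum, Finset.sum_mul]
      rw [Finset.sum_comm]
      refine Finset.sum_congr rfl fun i _ => ?_
      rw [Finset.sum_comm]
      refine Finset.sum_congr rfl fun j _ => Finset.sum_congr rfl fun n _ => by ring
    rw [this]
    simp only [spray, christoffel_eq hP h, add_mul, Finset.sum_add_distrib]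
  have e2 : ∀ n, ∑ i, ∑ j, D.chrE Gam μ n i j x y * y i * y j
      = μ x * (D.bet x y * (∑ i, y i * D.QE i n x y)
        - D.b n x / 2 * ∑ j, y j * ∑ i, y i * D.QE i j x y) := by
    intro n
    have a1 : ∀ i j, D.chrE Gam μ n i j x y * y i * y j
        = y j * (y i * ∑ m, riemN Gam x y j m * D.cE m n i x y)
          + y i * (y j * ∑ m, riemN Gam x y i m * D.cE m n j x y)
          - y i * (y j * ∑ m, riemN Gam x y n m * D.cE m i j x y)
          + μ x / 2 * (D.b j x * y j * (y i * D.QE i n x y))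
          + μ x / 2 * (D.b i x * y i * (y j * D.QE j n x y))
          - μ x / 2 * D.b n x * (y j * (y i * D.QE i j x y)) := by
      intro i j
      unfold chrE
      rw [QE_symm n i, QE_symm n j]
      ring
    have b1 : ∑ i, ∑ j, y j * (y i * ∑ m, riemN Gam x y j m * D.cE m n i x y) = 0 := by
      rw [Finset.sum_comm]
      simp only [← Finset.mul_sum, sum_y_sum_cE h, mul_zero, Finset.sum_const_zero]
    have b2 : ∑ i, ∑ j, D.b j x * y j * (y i * D.QE i n x y)
        = D.bet x y * ∑ i, y i * D.QE i n x y := by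
      rw [bet, Finset.sum_mul_sum, Finset.sum_comm]
    have b3 : ∑ i, D.b i x * y i * ∑ j, y j * D.QE j n x y
        = D.bet x y * ∑ i, y i * D.QE i n x y := by
      rw [bet, Finset.sum_mul]
    have b4 : ∑ i, ∑ j, y j * (y i * D.QE i j x y)
        = ∑ j, y j * ∑ i, y i * D.QE i j x y := by
      rw [Finset.sum_comm]
      simp only [Finset.mul_sum]
    simp only [a1, Finset.sum_add_distrib, Finset.sum_sub_distrib, b1]
    simp only [← Finset.mul_sum, sum_y_sum_cE h, b2, b3, b4]
    simp only [mul_zero, Finset.sum_const_zero]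
    ring
  rw [e1]
  simp only [e2, sum_y_QE h, sum_y_cov h]
  have e3 : ∀ n, D.gUpE k n x y * (μ x * (D.bet x y * D.cov x y
        (D.J x y * (D.MF x y * (D.bet x y + D.g x * D.q x y) + D.q x y ^ 3 / D.B x y))
        (D.J x y * (D.MF x y * D.q x y - D.bet x y * D.q x y ^ 2 / D.B x y)) n
      - D.b n x / 2 * (D.bet x y * (D.J x y * (D.MF x y * (D.bet x y + D.g x * D.q x y)
        + D.q x y ^ 3 / D.B x y)) + D.q x y * (D.J x y * (D.MF x y * D.q x y
        - D.bet x y * D.q x y ^ 2 / D.B x y)))))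
      = μ x * (D.gUpE k n x y * D.cov x y
        (D.bet x y * (D.J x y * (D.MF x y * (D.bet x y + D.g x * D.q x y) + D.q x y ^ 3 / D.B x y))
          - D.B x y * D.J x y * D.MF x y / 2)
        (D.bet x y * (D.J x y * (D.MF x y * D.q x y - D.bet x y * D.q x y ^ 2 / D.B x y))) n) := by
    intro n
    unfold cov
    field_simp
    rw [B_eq]
    ring
  simp only [e3]
  rw [← Finset.mul_sum, gUpE_cov h]
  congr 1
  unfold con d₁ d₂
  field_simp
  rw [B_eq]
  ring

end FinsleroidChart

namespace FinsleroidChart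

open Finsleroid Finsler

variable {N : ℕ} {D : FinsleroidChart N} {x y : Vec N}
  {Gam : Vec N → Fin N → Fin N → Fin N → ℝ} {μ : Vec N → ℝ}

/-! ### The nonlinear connection and the Chern connection -/

lemma SmoothFun.differentiableAt_right {f : LineFun N} (hf : D.SmoothFun f) (h : D.Reg x y) :
    DifferentiableAt ℝ (fun y' => f x y') y :=
  (hf.differentiableAt h).comp y (differentiableAt_const x |>.prodMk differentiableAt_id)

lemma pdy_eq_of_hasDerivAt {f : LineFun N} {i : Fin N} {d : ℝ}
    (hf : DifferentiableAt ℝ (fun y' => f x y') y)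
    (hd : HasDerivAt (fun t : ℝ => f x (y + t • EuclideanSpace.single i 1)) d 0) :
    pdy f i x y = d :=
  (hf.hasFDerivAt.hasLineDerivAt (EuclideanSpace.single i (1 : ℝ))).unique hd

variable (D μ) in
/-- The tensor `Pⁿ_k = (1/2) ∂Dⁿ/∂yᵏ` by which the nonlinear connection differs from the Riemannian
one. -/
def pE (n k : Fin N) : LineFun N := fun x y =>
  D.mix x y
    (μ x / 2 * (D.bet x y * D.MF x y))
    (μ x * (D.bet x y * D.q x y ^ 2 / D.B x y - D.q x y * D.MF x y / 2))
    (μ x / 2 * (D.q x y * D.MF x y))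
    (μ x * ((D.bet x y + D.g x * D.q x y) * (D.MF x y / 2 - D.bet x y * D.q x y / D.B x y)))
    (μ x / 4 * (D.bet x y * D.MF x y
      + (D.MF x y - 2 * D.bet x y * D.q x y / D.B x y) * (D.bet x y + D.g x * D.q x y))) n k

lemma nonlin_eq (hP : D.IsParallel Gam μ) (h : D.Reg x y) (n k : Fin N) :
    nonlin D.F n k x y = riemN Gam x y k n + D.pE μ n k x y := by
  have hB := (B_pos h).ne'
  have hq0 := h.2.ne'
  have hL := lineDer_vertical h k
  have e : D.EqReg (spray D.F n) fun x y => ∑ i, ∑ j, Gam x n i j * y i * y j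
      + D.con x y (D.d₁ μ x y) (D.d₂ μ x y) n := fun x y h => spray_eq hP h n
  have dy : ∀ i : Fin N, DifferentiableAt ℝ (fun y' : Vec N => y' i) y := by
    intro i; fun_prop
  have hd : DifferentiableAt ℝ (fun y' => ∑ i, ∑ j, Gam x n i j * y' i * y' j
      + D.con x y' (D.d₁ μ x y') (D.d₂ μ x y') n) y := by
    have h1 := (smoothFun_bet (D := D)).differentiableAt_right h
    have h2 := (smoothFun_q (D := D)).differentiableAt_right h
    have h3 := (smoothFun_B (D := D)).differentiableAt_right h
    have h4 := (smoothFun_MF (D := D)).differentiableAt_right h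
    unfold con d₁ d₂ omUp
    fun_prop (disch := assumption)
  have c1 := hL.bet
  have c2 := hL.q
  have c3 := hL.B
  have c4 := hL.MF h
  simp only [smul_zero, add_zero] at c1 c2 c3
  have c5 := fun i => hasDerivAt_coord y (EuclideanSpace.single k (1 : ℝ)) i
  have hdd := (HasDerivAt.fun_sum (u := Finset.univ) fun i _ => HasDerivAt.fun_sum
    (u := Finset.univ) fun j _ => ((c5 i).const_mul (Gam x n i j)).mul (c5 j)).add
    (((((((c1.pow 2).sub (c2.pow 2)).mul c4).add (((c1.const_mul 2).mul (c2.pow 3)).div c3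
      (by simpa using hB))).const_mul (μ x / 2)).mul_const (D.bUp n x)).add
      (((c2.const_mul (μ x / 2)).mul ((c1.mul c4).add ((c4.sub (((c1.const_mul 2).mul c2).div c3
        (by simpa using hB))).mul (c1.add (c2.const_mul (D.g x)))))).mul
        (((c5 n).sub (c1.mul_const (D.bUp n x))).div c2 (by simpa using hq0))))
  rw [nonlin, e.pdy k x y h, pdy_eq_of_hasDerivAt hd hdd]
  rw [mul_add]
  congr 1
  · have hs : ∀ f : Fin N → ℝ, ∑ j, f j * (EuclideanSpace.single k (1 : ℝ) : Vec N) j = f k := by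
      intro f; simp
    have e1 : ∀ i j, Gam x n i j * (EuclideanSpace.single k (1 : ℝ) : Vec N) i
          * (y + (0 : ℝ) • EuclideanSpace.single k (1 : ℝ)) j
        + Gam x n i j * (y + (0 : ℝ) • EuclideanSpace.single k (1 : ℝ)) i
          * (EuclideanSpace.single k (1 : ℝ) : Vec N) j
        = Gam x n i j * y j * (EuclideanSpace.single k (1 : ℝ) : Vec N) i
        + Gam x n i j * y i * (EuclideanSpace.single k (1 : ℝ) : Vec N) j := by
      intro i j; simp only [zero_smul, add_zero]; ring
    simp only [e1, Finset.sum_add_distrib, hs]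
    rw [Finset.sum_comm]
    simp only [hs, riemN]
    rw [← Finset.sum_add_distrib, Finset.mul_sum]
    refine Finset.sum_congr rfl fun i _ => ?_
    rw [hP.symm x n k i]; ring
  · simp only [zero_smul, add_zero, Pi.add_apply, Pi.mul_apply, Pi.sub_apply, Pi.div_apply,
      Pi.pow_apply, y_eq h n, PiLp.single_apply]
    simp only [pE, mix, rMix, Matrix.one_apply]
    generalize (if n = k then (1 : ℝ) else 0) = δ
    push_cast
    field_simp
    rw [B_eq]
    ring

end FinsleroidChart

namespace FinsleroidChart

open Finsleroid Finsler

variable {N : ℕ} {D : FinsleroidChart N} {x y : Vec N}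
  {Gam : Vec N → Fin N → Fin N → Fin N → ℝ} {μ : Vec N → ℝ}

variable (D μ) in
/-- The lowered difference `T_{p,ik}` between the Chern connection and the Christoffel symbols of
the Riemannian metric. -/
def tE (p i k : Fin N) : LineFun N := fun x y =>
  μ x / 2 * (D.b k x * D.QE p i x y + D.b i x * D.QE p k x y - D.b p x * D.QE i k x y)
    - ∑ m, D.pE μ m i x y * D.cE p m k x y - ∑ m, D.pE μ m k x y * D.cE p m i x y
    + ∑ m, D.pE μ m p x y * D.cE m i k x y

lemma conn_eq (hP : D.IsParallel Gam μ) (h : D.Reg x y) (n i k : Fin N) :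
    conn D.F n i k x y = Gam x n i k + ∑ p, D.gUpE n p x y * D.tE μ p i k x y := by
  have e1 : ∀ i k, ∑ m, nonlin D.F m i x y * cMixed D.F m n k x y
      = ∑ p, D.gUpE n p x y * (∑ m, riemN Gam x y i m * D.cE m p k x y
        + ∑ m, D.pE μ m i x y * D.cE p m k x y) := by
    intro i k
    have : ∀ m, nonlin D.F m i x y * cMixed D.F m n k x y
        = ∑ p, D.gUpE n p x y * (riemN Gam x y i m * D.cE m p k x y
          + D.pE μ m i x y * D.cE p m k x y) := by
      intro m
      simp only [cMixed, gUp_eq _ _ x y h, cTensor_eq _ _ _ x y h, nonlin_eq hP h, Finset.mul_sum]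
      exact Finset.sum_congr rfl fun p _ => by rw [cE_swap p m k]; ring
    simp only [this]
    rw [Finset.sum_comm]
    simp only [← Finset.mul_sum, Finset.sum_add_distrib]
  have e2 : ∑ m, nonlinUp D.F n m x y * cTensor D.F m i k x y
      = ∑ p, D.gUpE n p x y * (∑ m, riemN Gam x y p m * D.cE m i k x y
        + ∑ m, D.pE μ m p x y * D.cE m i k x y) := by
    have : ∀ m, nonlinUp D.F n m x y * cTensor D.F m i k x y
        = ∑ p, D.gUpE n p x y * (riemN Gam x y p m * D.cE m i k x y
          + D.pE μ m p x y * D.cE m i k x y) := by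
      intro m
      simp only [nonlinUp, gUp_eq _ _ x y h, cTensor_eq _ _ _ x y h, nonlin_eq hP h,
        Finset.sum_mul]
      exact Finset.sum_congr rfl fun p _ => by ring
    simp only [this]
    rw [Finset.sum_comm]
    simp only [← Finset.mul_sum, Finset.sum_add_distrib]
  rw [conn, e1, e1, e2, christoffel_eq hP h]
  rw [add_sub_assoc, add_sub_assoc, add_assoc]
  congr 1
  rw [← Finset.sum_sub_distrib, ← Finset.sum_sub_distrib, ← Finset.sum_add_distrib]
  refine Finset.sum_congr rfl fun p _ => ?_
  unfold chrE tE
  ring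

/-! ### The covariant derivative of the Cartan vector -/

lemma pdy_aE (i n : Fin N) : D.EqReg (pdy (D.aE i) n) fun x y =>
    N / 2 * (D.g x * D.F x y / D.B x y) * D.ten x y
      (-(D.q x y * D.bet x y / D.B x y)) (1 - D.q x y * (D.q x y + D.g x * D.bet x y) / D.B x y)
      (D.bet x y ^ 2 / D.B x y - 1) (D.bet x y * (D.q x y + D.g x * D.bet x y) / D.B x y)
      (-(D.bet x y / D.q x y)) i n := by
  intro x y h
  have hB := (B_pos h).ne'
  have hq0 := h.2.ne'
  have hL := lineDer_vertical h n
  rw [(smoothFun_aE i).pdy_eq h, (smoothFun_aE i).lineDir_eq h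
    ((((hL.g.mul (hL.F h)).div hL.B (by simpa using hB)).const_mul (N / 2 : ℝ)).mul
      (hL.cov (f₁ := D.q) (f₂ := fun x y => -D.bet x y) hL.q hL.bet.neg i))]
  simp only [zero_smul, add_zero, cov, ten, nLow, Pi.mul_apply, Pi.div_apply]
  field_simp
  rw [B_eq]
  ring

lemma pdx_aE (hP : D.IsParallel Gam μ) (h : D.Reg x y) (i k : Fin N) :
    pdx (D.aE i) k x y = ∑ n, riemN Gam x y k n * pdy (D.aE i) n x y
      + ∑ n, Gam x n i k * D.aE n x y
      + μ x * D.b k x * (N / 2 * (D.F x y / D.B x y) * (1 + D.g x * D.MF x y / 2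
        - D.g x * D.bet x y * D.q x y / D.B x y) * D.nLow i x y) := by
  have hB := (B_pos h).ne'
  have hL := lineDer_horizontal hP h k
  have e := (smoothFun_aE (D := D) i).pdx_sub h k (riemN Gam x y k)
  rw [sub_eq_iff_eq_add'] at e
  rw [e, add_assoc]
  congr 1
  rw [(smoothFun_aE i).lineDir_eq h
    ((((hL.g.mul (hL.F h)).div hL.B (by simpa using hB)).const_mul (N / 2 : ℝ)).mul
      (hL.cov (f₁ := D.q) (f₂ := fun x y => -D.bet x y) hL.q hL.bet.neg i))]
  have e1 : ∑ n, Gam x n i k * D.aE n x y = N / 2 * (D.g x * D.F x y / D.B x y)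
      * (D.q x y * ∑ n, Gam x n i k * D.b n x - D.bet x y * ∑ n, Gam x n i k * D.om n x y) := by
    simp only [Finset.mul_sum, ← Finset.sum_sub_distrib]
    exact Finset.sum_congr rfl fun n _ => by unfold aE nLow cov; ring
  rw [e1]
  simp only [zero_smul, add_zero, cov, nLow, Pi.mul_apply, Pi.div_apply]
  generalize ∑ n, Gam x n i k * D.b n x = s1
  generalize ∑ n, Gam x n i k * D.om n x y = s2
  field_simp
  ring

lemma con_pE (h : D.Reg x y) (c₁ c₂ : ℝ) (m : Fin N) :
    ∑ p, D.con x y c₁ c₂ p * D.pE μ m p x y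
      = D.con x y
        (μ x / 2 * (D.bet x y * D.MF x y) * c₁
          + μ x * (D.bet x y * D.q x y ^ 2 / D.B x y - D.q x y * D.MF x y / 2) * c₂)
        (μ x / 2 * (D.q x y * D.MF x y) * c₁ + μ x * ((D.bet x y + D.g x * D.q x y)
          * (D.MF x y / 2 - D.bet x y * D.q x y / D.B x y)) * c₂) m := by
  rw [← mix_con h _ _ _ _ (μ x / 4 * (D.bet x y * D.MF x y
      + (D.MF x y - 2 * D.bet x y * D.q x y / D.B x y) * (D.bet x y + D.g x * D.q x y)))]
  exact Finset.sum_congr rfl fun p _ => by unfold pE; ring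

/-- The contraction of `T_{p,ik}` with a vector in the plane of `b` and `y`. -/
lemma con_tE (h : D.Reg x y) (c₁ c₂ : ℝ) (i k : Fin N) :
    ∑ p, D.con x y c₁ c₂ p * D.tE μ p i k x y
      = μ x / 2 * (D.b k x * ∑ p, D.con x y c₁ c₂ p * D.QE p i x y
          + D.b i x * (∑ p, D.con x y c₁ c₂ p * D.QE p k x y) - c₁ * D.QE i k x y)
        - ∑ m, D.pE μ m i x y * ∑ p, D.con x y c₁ c₂ p * D.cE p m k x y
        - ∑ m, D.pE μ m k x y * ∑ p, D.con x y c₁ c₂ p * D.cE p m i x y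
        + ∑ m, (∑ p, D.con x y c₁ c₂ p * D.pE μ m p x y) * D.cE m i k x y := by
  have e0 : c₁ * D.QE i k x y = ∑ p, D.con x y c₁ c₂ p * D.b p x * D.QE i k x y := by
    have := con_cov h c₁ c₂ 1 0
    simp only [cov, one_mul, zero_mul, add_zero, mul_one, mul_zero] at this
    rw [← Finset.sum_mul, this]
  have e1 : ∀ i k, ∑ m, D.pE μ m i x y * ∑ p, D.con x y c₁ c₂ p * D.cE p m k x y
      = ∑ p, D.con x y c₁ c₂ p * ∑ m, D.pE μ m i x y * D.cE p m k x y := by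
    intro i k
    simp only [Finset.mul_sum]
    rw [Finset.sum_comm]
    exact Finset.sum_congr rfl fun p _ => Finset.sum_congr rfl fun m _ => by ring
  have e2 : ∑ m, (∑ p, D.con x y c₁ c₂ p * D.pE μ m p x y) * D.cE m i k x y
      = ∑ p, D.con x y c₁ c₂ p * ∑ m, D.pE μ m p x y * D.cE m i k x y := by
    simp only [Finset.mul_sum, Finset.sum_mul]
    rw [Finset.sum_comm]
    exact Finset.sum_congr rfl fun p _ => Finset.sum_congr rfl fun m _ => by ring
  rw [e0, e1, e1, e2]
  simp only [Finset.mul_sum, ← Finset.sum_sub_distrib, ← Finset.sum_add_distrib]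
  refine Finset.sum_congr rfl fun p _ => ?_
  simp only [← Finset.mul_sum]
  unfold tE
  ring

/-- For covectors `A_i` whose `x`-derivatives are Riemannian transport terms plus `a'_i`, the
Riemannian terms drop out of `A_{i|k}`. -/
lemma hCov₁_eq {A : Fin N → LineFun N} {a' : Fin N → ℝ} {k : Fin N}
    (hP : D.IsParallel Gam μ) (h : D.Reg x y) (i : Fin N)
    (hA : ∀ i, pdx (A i) k x y = ∑ n, riemN Gam x y k n * pdy (A i) n x y
      + ∑ n, Gam x n i k * A n x y + a' i) :
    hCov₁ D.F A i k x y = a' i - ∑ n, D.pE μ n k x y * pdy (A i) n x y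
      - ∑ p, (∑ n, D.gUpE p n x y * A n x y) * D.tE μ p i k x y := by
  have e1 : ∑ n, conn D.F n i k x y * A n x y = ∑ n, Gam x n i k * A n x y
      + ∑ p, (∑ n, D.gUpE p n x y * A n x y) * D.tE μ p i k x y := by
    simp only [conn_eq hP h, add_mul, Finset.sum_add_distrib, Finset.sum_mul]
    congr 1
    rw [Finset.sum_comm]
    exact Finset.sum_congr rfl fun p _ => Finset.sum_congr rfl fun n _ => by
      rw [gUpE_symm n p]; ring
  rw [hCov₁, horiz, e1, hA]
  simp only [nonlin_eq hP h, add_mul, Finset.sum_add_distrib]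
  ring

lemma hCov₁_congr {A A' : Fin N → LineFun N} (hA : ∀ i, D.EqReg (A i) (A' i)) (h : D.Reg x y)
    (i k : Fin N) : hCov₁ D.F A i k x y = hCov₁ D.F A' i k x y := by
  simp only [hCov₁, horiz, (hA i).pdx k x y h, fun n => (hA i).pdy n x y h, hA _ x y h]

/-- The `A`-special relation, with `𝓗_{ik} = J r_{ik}`. -/
lemma hCov₁_aE (hP : D.IsParallel Gam μ) (h : D.Reg x y) (i k : Fin N) :
    hCov₁ D.F D.aE i k x y = μ x * D.b k x * (N / 2 * (D.F x y / D.B x y) * D.nLow i x y)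
      + μ x * N * D.g x / (4 * D.F x y * D.q x y)
        * (D.B x y * D.MF x y - D.bet x y * D.q x y) * (D.J x y * D.r i k x y) := by
  have hB := (B_pos h).ne'
  have hJ := (J_pos h).ne'
  have hF := (F_pos h).ne'
  have hq0 := h.2.ne'
  rw [hCov₁_eq hP h i fun i => pdx_aE hP h i k]
  have e1 : ∑ n, D.pE μ n k x y * pdy (D.aE i) n x y = N / 2 * (D.g x * D.F x y / D.B x y)
      * ∑ n, D.pE μ n k x y * D.ten x y
        (-(D.q x y * D.bet x y / D.B x y)) (D.bet x y ^ 2 / D.B x y - 1)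
        (1 - D.q x y * (D.q x y + D.g x * D.bet x y) / D.B x y)
        (D.bet x y * (D.q x y + D.g x * D.bet x y) / D.B x y) (-(D.bet x y / D.q x y)) n i := by
    rw [Finset.mul_sum]
    refine Finset.sum_congr rfl fun n _ => ?_
    rw [pdy_aE i n x y h, ten_swap]
    ring
  have e2 : ∀ p, ∑ n, D.gUpE p n x y * D.aE n x y
      = N / 2 * (D.g x * D.F x y / (D.B x y * D.J x y)) * D.nUp x y p := by
    intro p
    have : ∀ n, D.gUpE p n x y * D.aE n x y = N / 2 * (D.g x * D.F x y / D.B x y)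
        * (D.gUpE p n x y * D.nLow n x y) := by
      intro n; unfold aE; ring
    simp only [this, ← Finset.mul_sum, gUpE_nLow h]
    field_simp
  have e3 : ∑ p, (∑ n, D.gUpE p n x y * D.aE n x y) * D.tE μ p i k x y
      = N / 2 * (D.g x * D.F x y / (D.B x y * D.J x y)) * ∑ p, D.nUp x y p * D.tE μ p i k x y := by
    rw [Finset.mul_sum]
    exact Finset.sum_congr rfl fun p _ => by rw [e2 p]; ring
  have e4 : ∀ i k (S c₁₁ c₁₂ c₂₁ c₂₂ c : ℝ), ∑ m, D.pE μ m i x y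
      * (S * D.ten x y c₁₁ c₁₂ c₂₁ c₂₂ c m k)
      = S * ∑ m, D.pE μ m i x y * D.ten x y c₁₁ c₁₂ c₂₁ c₂₂ c m k := by
    intro i k S c₁₁ c₁₂ c₂₁ c₂₂ c
    rw [Finset.mul_sum]
    exact Finset.sum_congr rfl fun p _ => by ring
  rw [e1, e3]
  simp only [nUp]
  rw [con_tE h]
  -- every contraction is a block tensor; the coefficients are compared after expansion
  simp only [con_pE h, con_cE h, e4]
  simp only [pE, mix_ten h, QE, con_ten h]
  simp only [ten, cov, nLow]
  rw [r_symm k i]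
  generalize D.r i k x y = r
  field_simp
  rw [F_sq h, B_eq]
  ring

end FinsleroidChart

/-! ### Covariant derivatives along `l` as derivations -/

namespace Finsler

variable {N : ℕ} {F : LineFun N} {x y : Vec N}

/-- Differentiability separately in the point and in the tangent vector, which is what the Leibniz
rule for horizontal derivatives needs. -/
def PartDiffAt (f : LineFun N) (x y : Vec N) : Prop :=
  DifferentiableAt ℝ (fun x' => f x' y) x ∧ DifferentiableAt ℝ (fun y' => f x y') y

/-- The derivative of a component function in the horizontal direction `l`. -/
def flowDer (F f : LineFun N) : LineFun N := fun x y => ∑ m, horiz F f m x y * lUp F m x y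

/-- The contraction `Γⁿ_{im} lᵐ` of the connection coefficients. -/
def flowConn (F : LineFun N) (n i : Fin N) : LineFun N := fun x y =>
  ∑ m, conn F n i m x y * lUp F m x y

lemma PartDiffAt.mul {f f' : LineFun N} (hf : PartDiffAt f x y) (hf' : PartDiffAt f' x y) :
    PartDiffAt (fun x y => f x y * f' x y) x y := ⟨hf.1.mul hf'.1, hf.2.mul hf'.2⟩

lemma PartDiffAt.add {f f' : LineFun N} (hf : PartDiffAt f x y) (hf' : PartDiffAt f' x y) :
    PartDiffAt (fun x y => f x y + f' x y) x y := ⟨hf.1.add hf'.1, hf.2.add hf'.2⟩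

lemma PartDiffAt.const_mul {f : LineFun N} (hf : PartDiffAt f x y) (c : ℝ) :
    PartDiffAt (fun x y => c * f x y) x y := ⟨hf.1.const_mul c, hf.2.const_mul c⟩

lemma flowDer_mul {f f' : LineFun N} (hf : PartDiffAt f x y) (hf' : PartDiffAt f' x y) :
    flowDer F (fun x y => f x y * f' x y) x y
      = f x y * flowDer F f' x y + f' x y * flowDer F f x y := by
  simp only [flowDer, Finset.mul_sum, ← Finset.sum_add_distrib]
  refine Finset.sum_congr rfl fun m _ => ?_
  have e1 : pdx (fun x y => f x y * f' x y) m x y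
      = f x y * pdx f' m x y + f' x y * pdx f m x y := by
    simp only [pdx, fderiv_fun_mul hf.1 hf'.1]
    rfl
  have e2 : ∀ k, pdy (fun x y => f x y * f' x y) k x y
      = f x y * pdy f' k x y + f' x y * pdy f k x y := by
    intro k
    simp only [pdy, fderiv_fun_mul hf.2 hf'.2]
    rfl
  have e3 : ∑ k, nonlin F k m x y * (f x y * pdy f' k x y + f' x y * pdy f k x y)
      = f x y * ∑ k, nonlin F k m x y * pdy f' k x y
        + f' x y * ∑ k, nonlin F k m x y * pdy f k x y := by
    simp only [Finset.mul_sum, ← Finset.sum_add_distrib]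
    exact Finset.sum_congr rfl fun k _ => by ring
  simp only [horiz, e1, e2, e3]
  ring

lemma flowDer_add {f f' : LineFun N} (hf : PartDiffAt f x y) (hf' : PartDiffAt f' x y) :
    flowDer F (fun x y => f x y + f' x y) x y = flowDer F f x y + flowDer F f' x y := by
  simp only [flowDer, ← Finset.sum_add_distrib]
  refine Finset.sum_congr rfl fun m _ => ?_
  have e1 : pdx (fun x y => f x y + f' x y) m x y = pdx f m x y + pdx f' m x y := by
    simp only [pdx, fderiv_fun_add hf.1 hf'.1]
    rfl
  have e2 : ∀ k, pdy (fun x y => f x y + f' x y) k x y = pdy f k x y + pdy f' k x y := by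
    intro k
    simp only [pdy, fderiv_fun_add hf.2 hf'.2]
    rfl
  simp only [horiz, e1, e2, mul_add, Finset.sum_add_distrib]
  ring

lemma flowDer_const_mul {f : LineFun N} (hf : PartDiffAt f x y) (c : ℝ) :
    flowDer F (fun x y => c * f x y) x y = c * flowDer F f x y := by
  have hc : PartDiffAt (fun _ _ : Vec N => c) x y :=
    ⟨differentiableAt_const c, differentiableAt_const c⟩
  have : flowDer F (fun _ _ => c) x y = 0 := by
    simp [flowDer, horiz, pdx, pdy]
  rw [flowDer_mul hc hf, this]
  ring

lemma dot₁_eq (T : Fin N → LineFun N) (i : Fin N) :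
    dot₁ F T i x y = flowDer F (T i) x y - ∑ n, flowConn F n i x y * T n x y := by
  simp only [dot₁, hCov₁, flowDer, flowConn, sub_mul, Finset.sum_sub_distrib, Finset.sum_mul]
  congr 1
  rw [Finset.sum_comm]
  exact Finset.sum_congr rfl fun n _ => Finset.sum_congr rfl fun m _ => by ring

lemma dot₃_eq (T : Fin N → Fin N → Fin N → LineFun N) (i j k : Fin N) :
    dot₃ F T i j k x y = flowDer F (T i j k) x y - ∑ n, flowConn F n i x y * T n j k x y
      - ∑ n, flowConn F n j x y * T i n k x y - ∑ n, flowConn F n k x y * T i j n x y := by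
  have e : ∀ (i : Fin N) (S : Fin N → ℝ), ∑ m, (∑ n, conn F n i m x y * S n) * lUp F m x y
      = ∑ n, flowConn F n i x y * S n := by
    intro i S
    simp only [flowConn, Finset.sum_mul]
    rw [Finset.sum_comm]
    exact Finset.sum_congr rfl fun n _ => Finset.sum_congr rfl fun m _ => by ring
  simp only [dot₃, hCov₃, sub_mul, Finset.sum_sub_distrib, e]
  rfl

/-- If a covector `α` and a symmetric tensor `ρ` are parallel along `l`, then so is
`α_i ρ_{jk} + α_j ρ_{ik} + α_k ρ_{ij} + 2 α_i α_j α_k`. -/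
lemma dot₃_eq_zero {T : Fin N → Fin N → Fin N → LineFun N} {α : Fin N → LineFun N}
    {ρ : Fin N → Fin N → LineFun N} (c : ℝ)
    (hT : ∀ i j k, T i j k = fun x y => c * (α i x y * ρ j k x y + α j x y * ρ i k x y
      + α k x y * ρ i j x y + 2 * (α i x y * (α j x y * α k x y))))
    (dα : ∀ i, PartDiffAt (α i) x y) (dρ : ∀ i j, PartDiffAt (ρ i j) x y)
    (hα : ∀ i, flowDer F (α i) x y = ∑ n, flowConn F n i x y * α n x y)
    (hρ : ∀ i j, flowDer F (ρ i j) x y = ∑ n, flowConn F n i x y * ρ n j x y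
      + ∑ n, flowConn F n j x y * ρ i n x y) (i j k : Fin N) :
    dot₃ F T i j k x y = 0 := by
  have d1 := fun i j k => (dα i).mul (dρ j k)
  have d2 := (dα i).mul ((dα j).mul (dα k))
  have hd : flowDer F (T i j k) x y = c * (
      (α i x y * flowDer F (ρ j k) x y + ρ j k x y * flowDer F (α i) x y)
      + (α j x y * flowDer F (ρ i k) x y + ρ i k x y * flowDer F (α j) x y)
      + (α k x y * flowDer F (ρ i j) x y + ρ i j x y * flowDer F (α k) x y)
      + 2 * (α i x y * (α j x y * flowDer F (α k) x y + α k x y * flowDer F (α j) x y)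
        + α j x y * α k x y * flowDer F (α i) x y)) := by
    rw [hT, flowDer_const_mul ((((d1 i j k).add (d1 j i k)).add (d1 k i j)).add (d2.const_mul 2)),
      flowDer_add (((d1 i j k).add (d1 j i k)).add (d1 k i j)) (d2.const_mul 2),
      flowDer_add ((d1 i j k).add (d1 j i k)) (d1 k i j), flowDer_add (d1 i j k) (d1 j i k),
      flowDer_const_mul d2, flowDer_mul (dα i) (dρ j k), flowDer_mul (dα j) (dρ i k),
      flowDer_mul (dα k) (dρ i j), flowDer_mul (dα i) ((dα j).mul (dα k)),
      flowDer_mul (dα j) (dα k)]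
  have s : ∀ (v X₁ X₂ X₃ X₄ : Fin N → ℝ) (c₁ c₂ c₃ c₄ : ℝ),
      ∑ n, v n * (c * (c₁ * X₁ n + c₂ * X₂ n + c₃ * X₃ n + c₄ * X₄ n))
        = c * (c₁ * ∑ n, v n * X₁ n + c₂ * ∑ n, v n * X₂ n + c₃ * ∑ n, v n * X₃ n
          + c₄ * ∑ n, v n * X₄ n) := by
    intro v X₁ X₂ X₃ X₄ c₁ c₂ c₃ c₄
    simp only [Finset.mul_sum, ← Finset.sum_add_distrib]
    exact Finset.sum_congr rfl fun n _ => by ring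
  have s1 : ∑ n, flowConn F n i x y * T n j k x y = _ :=
    (Finset.sum_congr rfl fun n _ => by rw [hT]; ring).trans
      (s (fun n => flowConn F n i x y) (fun n => α n x y) (fun n => ρ n k x y)
        (fun n => ρ n j x y) (fun n => α n x y) (ρ j k x y) (α j x y) (α k x y)
        (2 * (α j x y * α k x y)))
  have s2 : ∑ n, flowConn F n j x y * T i n k x y = _ :=
    (Finset.sum_congr rfl fun n _ => by rw [hT]; ring).trans
      (s (fun n => flowConn F n j x y) (fun n => α n x y) (fun n => ρ n k x y)
        (fun n => ρ i n x y) (fun n => α n x y) (ρ i k x y) (α i x y) (α k x y)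
        (2 * (α i x y * α k x y)))
  have s3 : ∑ n, flowConn F n k x y * T i j n x y = _ :=
    (Finset.sum_congr rfl fun n _ => by rw [hT]; ring).trans
      (s (fun n => flowConn F n k x y) (fun n => α n x y) (fun n => ρ j n x y)
        (fun n => ρ i n x y) (fun n => α n x y) (ρ i j x y) (α i x y) (α j x y)
        (2 * (α i x y * α j x y)))
  rw [dot₃_eq, hd, s1, s2, s3]
  simp only [hα, hρ]
  ring

end Finsler

namespace FinsleroidChart

open Finsleroid Finsler

variable {N : ℕ} {D : FinsleroidChart N} {x y : Vec N}
  {Gam : Vec N → Fin N → Fin N → Fin N → ℝ} {μ : Vec N → ℝ}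

lemma SmoothFun.partDiffAt {f : LineFun N} (hf : D.SmoothFun f) (h : D.Reg x y) :
    PartDiffAt f x y :=
  ⟨DifferentiableAt.comp x (f := fun x' => (x', y)) (hf.differentiableAt h)
      (differentiableAt_id.prodMk (differentiableAt_const y)),
    hf.differentiableAt_right h⟩

lemma flowDer_congr {f f' : LineFun N} (hf : D.EqReg f f') (h : D.Reg x y) :
    flowDer D.F f x y = flowDer D.F f' x y := by
  simp only [flowDer, horiz, hf.pdx _ x y h, hf.pdy _ x y h]

lemma sum_y_r (h : D.Reg x y) (i : Fin N) : ∑ m, y m * D.r m i x y = 0 := by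
  rw [← con_r h (D.bet x y) (D.q x y) i]
  exact Finset.sum_congr rfl fun n _ => by rw [← y_eq_con h]

lemma sum_y_pE (h : D.Reg x y) (n : Fin N) :
    ∑ k, y k * D.pE μ n k x y = D.con x y (D.d₁ μ x y) (D.d₂ μ x y) n := by
  have hB := (B_pos h).ne'
  have e : ∀ k, y k * D.pE μ n k x y
      = D.con x y (D.bet x y) (D.q x y) k * D.pE μ n k x y := by
    intro k; rw [← y_eq_con h]
  simp only [e]
  rw [con_pE h]
  unfold d₁ d₂
  congr 1
  · field_simp
    ring
  · field_simp

/-- The contraction `T_{p,ik} yᵏ`: only its component on the complement of `b` and `y` matters. -/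
lemma sum_y_tE (h : D.Reg x y) : ∃ t₁₁ t₁₂ t₂₁ t₂₂ : ℝ, ∀ p i,
    ∑ k, y k * D.tE μ p i k x y = D.ten x y t₁₁ t₁₂ t₂₁ t₂₂
      (μ x / 2 * D.bet x y * (D.J x y * (D.MF x y - D.bet x y * D.q x y / D.B x y))
        - D.g x * D.J x y / (2 * D.B x y)
          * (D.d₁ μ x y * D.q x y - D.d₂ μ x y * D.bet x y)) p i := by
  obtain ⟨Q₁₁, Q₁₂, Q₂₂, hQ⟩ : ∃ Q₁₁ Q₁₂ Q₂₂, ∀ p i, D.QE p i x y = D.ten x y Q₁₁ Q₁₂ Q₁₂ Q₂₂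
    (D.J x y * (D.MF x y - D.bet x y * D.q x y / D.B x y)) p i := ⟨_, _, _, fun p i => rfl⟩
  obtain ⟨e₁, e₂, he⟩ : ∃ e₁ e₂, ∀ n, ∑ i, y i * D.QE i n x y = D.cov x y e₁ e₂ n :=
    ⟨_, _, fun n => sum_y_QE h n⟩
  set S := D.g x * D.J x y / (2 * D.B x y)
    * (D.d₁ μ x y * D.q x y - D.d₂ μ x y * D.bet x y) with hS
  refine ⟨μ x / 2 * D.bet x y * Q₁₁ - S * (2 / D.B x y * D.q x y ^ 2),
    μ x / 2 * (D.bet x y * Q₁₂ - e₂) + S * (2 / D.B x y * (D.q x y * D.bet x y)),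
    μ x / 2 * (D.bet x y * Q₁₂ + e₂) + S * (2 / D.B x y * (D.q x y * D.bet x y)),
    μ x / 2 * D.bet x y * Q₂₂ - S * (2 / D.B x y * D.bet x y ^ 2), fun p i => ?_⟩
  have c1 : ∀ i p, ∑ k, y k * ∑ m, D.pE μ m i x y * D.cE p m k x y = 0 := by
    intro i p
    simp only [Finset.mul_sum]
    rw [Finset.sum_comm]
    have : ∀ m, ∑ k, y k * (D.pE μ m i x y * D.cE p m k x y)
        = D.pE μ m i x y * ∑ k, y k * D.cE k p m x y := by
      intro m
      rw [Finset.mul_sum]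
      exact Finset.sum_congr rfl fun k _ => by rw [cE_rot p m k]; ring
    simp only [this, sum_y_cE h, mul_zero, Finset.sum_const_zero]
  have c2 : ∑ k, y k * ∑ m, D.pE μ m k x y * D.cE p m i x y
      = ∑ m, D.con x y (D.d₁ μ x y) (D.d₂ μ x y) m * D.cE m p i x y := by
    simp only [← sum_y_pE h, Finset.mul_sum, Finset.sum_mul]
    rw [Finset.sum_comm]
    exact Finset.sum_congr rfl fun m _ => Finset.sum_congr rfl fun k _ => by
      rw [cE_swap p m i]; ring
  have c3 : ∑ k, y k * D.tE μ p i k x y = μ x / 2 * ((∑ k, D.b k x * y k) * D.QE p i x y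
      + D.b i x * (∑ k, y k * D.QE k p x y) - D.b p x * ∑ k, y k * D.QE k i x y)
      - ∑ k, y k * ∑ m, D.pE μ m i x y * D.cE p m k x y
      - ∑ k, y k * ∑ m, D.pE μ m k x y * D.cE p m i x y
      + ∑ k, y k * ∑ m, D.pE μ m p x y * D.cE i m k x y := by
    have : ∀ k, y k * D.tE μ p i k x y = μ x / 2 * D.QE p i x y * (D.b k x * y k)
        + μ x / 2 * D.b i x * (y k * D.QE k p x y) - μ x / 2 * D.b p x * (y k * D.QE k i x y)
        - y k * ∑ m, D.pE μ m i x y * D.cE p m k x y - y k * ∑ m, D.pE μ m k x y * D.cE p m i x y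
        + y k * ∑ m, D.pE μ m p x y * D.cE i m k x y := by
      intro k
      unfold tE
      simp only [QE_symm k p, QE_symm k i, cE_swap _ i k]
      ring
    simp only [this, Finset.sum_add_distrib, Finset.sum_sub_distrib, ← Finset.mul_sum]
    ring
  rw [c3, c1, c1, c2, con_cE h, ← hS, he, he, hQ]
  change μ x / 2 * (D.bet x y * _ + _ - _) - _ - _ + _ = _
  unfold ten cov
  ring

variable (D) in
/-- The tensor `𝓗_{ij} = J r_{ij}`. -/
def rhoE (i j : Fin N) : LineFun N := fun x y => D.J x y * D.r i j x y

lemma smoothFun_rhoE (i j : Fin N) : D.SmoothFun (D.rhoE i j) := smoothFun_J.mul (smoothFun_r i j)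

lemma pdy_rhoE (i j n : Fin N) : D.EqReg (pdy (D.rhoE i j) n) fun x y =>
    D.J x y * (D.g x / D.B x y * D.nLow n x y * D.r i j x y
      - (D.r i n x y * D.om j x y + D.om i x y * D.r j n x y) / D.q x y) := by
  intro x y h
  have hL := lineDer_vertical h n
  have hB := (B_pos h).ne'
  rw [(smoothFun_rhoE i j).pdy_eq h, (smoothFun_rhoE i j).lineDir_eq h ((hL.J h).mul (hL.r i j))]
  simp only [zero_smul, add_zero, nLow, cov]
  field_simp
  ring

lemma pdx_rhoE (hP : D.IsParallel Gam μ) (h : D.Reg x y) (i j k : Fin N) :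
    pdx (D.rhoE i j) k x y = ∑ n, riemN Gam x y k n * pdy (D.rhoE i j) n x y
      + ∑ n, Gam x n i k * D.rhoE n j x y + ∑ n, Gam x n j k * D.rhoE i n x y
      + μ x * D.b k x * (D.J x y * (D.MF x y - D.bet x y * D.q x y / D.B x y) * D.r i j x y) := by
  have hL := lineDer_horizontal hP h k
  have hB := (B_pos h).ne'
  have e := (smoothFun_rhoE (D := D) i j).pdx_sub h k (riemN Gam x y k)
  rw [sub_eq_iff_eq_add'] at e
  rw [e, add_assoc, add_assoc]
  congr 1
  rw [(smoothFun_rhoE i j).lineDir_eq h ((hL.J h).mul (hL.r i j))]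
  have e1 : ∀ i j, ∑ n, Gam x n i k * D.rhoE n j x y = D.J x y * ((∑ n, Gam x n i k * D.a x n j)
      - (∑ n, Gam x n i k * D.b n x) * D.b j x
      - (∑ n, Gam x n i k * D.om n x y) * D.om j x y) := by
    intro i j
    simp only [Finset.mul_sum, Finset.sum_mul, ← Finset.sum_sub_distrib]
    exact Finset.sum_congr rfl fun n _ => by unfold rhoE r; ring
  have e2 : ∑ n, Gam x n j k * D.rhoE i n x y = ∑ n, Gam x n j k * D.rhoE n i x y :=
    Finset.sum_congr rfl fun n _ => by unfold rhoE; rw [r_symm i n]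
  have e3 : ∑ n, Gam x n j k * D.a x i n = ∑ n, Gam x n j k * D.a x n i :=
    Finset.sum_congr rfl fun n _ => by rw [D.a_symm x i n]
  rw [e2, e1, e1, e3]
  simp only [zero_smul, add_zero]
  ring

lemma flowConn_eq (hP : D.IsParallel Gam μ) (h : D.Reg x y) (n i : Fin N) :
    flowConn D.F n i x y = 1 / D.F x y * (∑ k, y k * Gam x n i k
      + ∑ p, D.gUpE n p x y * ∑ k, y k * D.tE μ p i k x y) := by
  have e : ∑ p, D.gUpE n p x y * ∑ k, y k * D.tE μ p i k x y
      = ∑ k, y k * ∑ p, D.gUpE n p x y * D.tE μ p i k x y := by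
    simp only [Finset.mul_sum]
    rw [Finset.sum_comm]
    exact Finset.sum_congr rfl fun m _ => Finset.sum_congr rfl fun k _ => by ring
  rw [e, ← Finset.sum_add_distrib, Finset.mul_sum]
  exact Finset.sum_congr rfl fun m _ => by rw [conn_eq hP h, lUp]; ring

/-- The derivative along `l` of a function whose `x`-derivatives are Riemannian transport terms plus
`w_k`. -/
lemma flowDer_eq (hP : D.IsParallel Gam μ) (h : D.Reg x y) {f : LineFun N} {w : Fin N → ℝ}
    (hf : ∀ k, pdx f k x y = ∑ n, riemN Gam x y k n * pdy f n x y + w k) :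
    flowDer D.F f x y = 1 / D.F x y * (∑ k, y k * w k
      - ∑ n, D.con x y (D.d₁ μ x y) (D.d₂ μ x y) n * pdy f n x y) := by
  have e : ∑ n, D.con x y (D.d₁ μ x y) (D.d₂ μ x y) n * pdy f n x y
      = ∑ k, y k * ∑ n, D.pE μ n k x y * pdy f n x y := by
    simp only [← sum_y_pE h, Finset.mul_sum, Finset.sum_mul]
    rw [Finset.sum_comm]
    exact Finset.sum_congr rfl fun m _ => Finset.sum_congr rfl fun k _ => by ring
  rw [e, ← Finset.sum_sub_distrib, Finset.mul_sum]
  refine Finset.sum_congr rfl fun k _ => ?_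
  simp only [horiz, hf, nonlin_eq hP h, add_mul, Finset.sum_add_distrib, lUp]
  ring

/-- The tensor `𝓗_{ij}` is parallel along `l`. -/
lemma flowDer_rhoE (hP : D.IsParallel Gam μ) (h : D.Reg x y) (i j : Fin N) :
    flowDer D.F (D.rhoE i j) x y = ∑ n, flowConn D.F n i x y * D.rhoE n j x y
      + ∑ n, flowConn D.F n j x y * D.rhoE i n x y := by
  have hB := (B_pos h).ne'
  have hJ := (J_pos h).ne'
  -- the coefficient of `r_{pi}` in `T_{p,ik} yᵏ`; twice it balances the derivative of `J`
  set cr := μ x / 2 * D.bet x y * (D.J x y * (D.MF x y - D.bet x y * D.q x y / D.B x y))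
    - D.g x * D.J x y / (2 * D.B x y) * (D.d₁ μ x y * D.q x y - D.d₂ μ x y * D.bet x y) with hcr
  have e1 : ∀ i j, ∑ n, flowConn D.F n i x y * D.rhoE n j x y
      = 1 / D.F x y * (∑ k, y k * ∑ n, Gam x n i k * D.rhoE n j x y + cr * D.r i j x y) := by
    intro i j
    obtain ⟨t₁₁, t₁₂, t₂₁, t₂₂, ht⟩ := sum_y_tE (μ := μ) h
    have a1 : ∑ n, (∑ p, D.gUpE n p x y * ∑ k, y k * D.tE μ p i k x y) * D.rhoE n j x y
        = cr * D.r i j x y := by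
      have : ∀ p, ∑ n, D.gUpE n p x y * (∑ k, y k * D.tE μ p i k x y) * D.rhoE n j x y
          = D.mix x y 0 0 0 0 1 p j * D.ten x y t₁₁ t₁₂ t₂₁ t₂₂ cr p i := by
        intro p
        have : D.mix x y 0 0 0 0 1 p j = D.J x y * ∑ n, D.gUpE p n x y * D.r n j x y := by
          rw [gUpE_r h]; unfold mix; field_simp; ring
        rw [this, ht, Finset.mul_sum, Finset.sum_mul]
        exact Finset.sum_congr rfl fun n _ => by rw [gUpE_symm n p]; unfold rhoE; ring
      simp only [Finset.sum_mul]
      rw [Finset.sum_comm]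
      simp only [this]
      rw [mix_ten h]
      unfold ten
      rw [r_symm j i]
      ring
    have a2 : ∑ n, (∑ k, y k * Gam x n i k) * D.rhoE n j x y
        = ∑ k, y k * ∑ n, Gam x n i k * D.rhoE n j x y := by
      simp only [Finset.sum_mul, Finset.mul_sum]
      rw [Finset.sum_comm]
      exact Finset.sum_congr rfl fun m _ => Finset.sum_congr rfl fun k _ => by ring
    rw [← a1, ← a2, ← Finset.sum_add_distrib, Finset.mul_sum]
    exact Finset.sum_congr rfl fun n _ => by rw [flowConn_eq hP h]; ring
  have e2 : ∀ S : Fin N → ℝ, ∑ n, S n * D.rhoE i n x y = ∑ n, S n * D.rhoE n i x y := fun S =>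
    Finset.sum_congr rfl fun n _ => by unfold rhoE; rw [r_symm i n]
  have e3 : ∑ n, D.con x y (D.d₁ μ x y) (D.d₂ μ x y) n * pdy (D.rhoE i j) n x y
      = D.J x y * (D.g x / D.B x y * (D.d₁ μ x y * D.q x y - D.d₂ μ x y * D.bet x y)
        * D.r i j x y) := by
    have a1 : ∀ n, D.con x y (D.d₁ μ x y) (D.d₂ μ x y) n * pdy (D.rhoE i j) n x y
        = D.J x y * (D.g x / D.B x y) * D.r i j x y
            * (D.con x y (D.d₁ μ x y) (D.d₂ μ x y) n * D.nLow n x y)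
          - D.J x y / D.q x y * D.om j x y
            * (D.con x y (D.d₁ μ x y) (D.d₂ μ x y) n * D.r n i x y)
          - D.J x y / D.q x y * D.om i x y
            * (D.con x y (D.d₁ μ x y) (D.d₂ μ x y) n * D.r n j x y) := by
      intro n
      rw [pdy_rhoE i j n x y h, r_symm n i, r_symm n j]
      ring
    have a2 := con_cov h (D.d₁ μ x y) (D.d₂ μ x y) (D.q x y) (-D.bet x y)
    change ∑ n, D.con x y (D.d₁ μ x y) (D.d₂ μ x y) n * D.nLow n x y = _ at a2
    simp only [a1, Finset.sum_sub_distrib, ← Finset.mul_sum, con_r h, a2]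
    ring
  rw [flowDer_eq hP h fun k => by rw [pdx_rhoE hP h i j k, add_assoc, add_assoc], e3,
    e2 (fun n => flowConn D.F n j x y), e1, e1, r_symm j i]
  have e4 : ∑ k, y k * (∑ n, Gam x n i k * D.rhoE n j x y + (∑ n, Gam x n j k * D.rhoE i n x y
        + μ x * D.b k x * (D.J x y * (D.MF x y - D.bet x y * D.q x y / D.B x y) * D.r i j x y)))
      = ∑ k, y k * ∑ n, Gam x n i k * D.rhoE n j x y
        + ∑ k, y k * ∑ n, Gam x n j k * D.rhoE n i x y
        + μ x * (∑ k, D.b k x * y k)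
          * (D.J x y * (D.MF x y - D.bet x y * D.q x y / D.B x y) * D.r i j x y) := by
    simp only [e2, Finset.mul_sum (a := μ x), Finset.sum_mul, ← Finset.sum_add_distrib]
    exact Finset.sum_congr rfl fun k _ => by ring
  rw [e4, hcr]
  change _ * (_ + _ + μ x * D.bet x y * _ - _) = _
  ring

variable (D) in
/-- The factor `1 / ‖A‖ = 2 / (N |g|)`. -/
def invNorm : LineFun N := fun x _ => 1 / (N / 2 * |D.g x|)

variable (D) in
/-- The explicit form of the normalized Cartan vector. -/
def alphaE (i : Fin N) : LineFun N := fun x y => D.invNorm x y * D.aE i x y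

lemma alphaVec_eq (i : Fin N) : D.EqReg (alphaVec D.F i) (D.alphaE i) := by
  intro x y h
  rw [alphaVec, cartanNorm_eq x y h, cartanVec_eq i x y h]
  rfl

/-- The normalized Cartan tensor is built from `α_i` and `𝓗_{ij}` with constant coefficients. -/
lemma alphaTensor_eq (i j k : Fin N) : D.EqReg (alphaTensor D.F i j k) fun x y =>
    1 / N * (D.alphaE i x y * D.rhoE j k x y + D.alphaE j x y * D.rhoE i k x y
      + D.alphaE k x y * D.rhoE i j x y
      + 2 * (D.alphaE i x y * (D.alphaE j x y * D.alphaE k x y))) := by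
  intro x y h
  have hB := (B_pos h).ne'
  have hN : (N : ℝ) ≠ 0 := by
    have := i.pos
    positivity
  rw [alphaTensor, cartanNorm_eq x y h, cartan_eq i j k x y h]
  unfold alphaE rhoE aE invNorm cE
  by_cases hg : D.g x = 0
  -- both sides carry the factor `g`
  · simp [hg]
  · have hg' : |D.g x| ≠ 0 := abs_ne_zero.2 hg
    have e : D.g x ^ 2 = |D.g x| ^ 2 := (sq_abs _).symm
    have e' := F_sq h
    field_simp
    rw [e', e]
    ring

lemma pdx_invNorm (hP : D.IsParallel Gam μ) (h : D.Reg x y) (hN : (N : ℝ) ≠ 0)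
    (hg : D.g x ≠ 0) : DifferentiableAt ℝ (fun x' => D.invNorm x' y) x ∧
      ∀ k, pdx D.invNorm k x y = -(μ x / D.g x) * D.invNorm x y * D.b k x := by
  have hd : DifferentiableAt ℝ D.g x :=
    (D.g_smooth.contDiffAt (D.isOpen.mem_nhds h.1)).differentiableAt (by simp)
  have h0 : (N / 2 * |D.g x| : ℝ) ≠ 0 :=
    mul_ne_zero (div_ne_zero hN two_ne_zero) (abs_ne_zero.2 hg)
  have h1 := (((hasDerivAt_abs hg).const_mul (N / 2 : ℝ)).inv h0).comp_hasFDerivAt x hd.hasFDerivAt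
  have h2 : (fun x' => D.invNorm x' y) = (fun s : ℝ => (N / 2 * |s|))⁻¹ ∘ D.g := by
    ext x'; simp [invNorm]
  rw [← h2] at h1
  refine ⟨h1.differentiableAt, fun k => ?_⟩
  have e : pdx D.invNorm k x y = _ := congrArg (· (EuclideanSpace.single k 1)) h1.fderiv
  rw [e]
  have e2 : (SignType.sign (D.g x) : ℝ) * D.g x = |D.g x| := sign_mul_self _
  have e3 : D.g x ^ 2 = |D.g x| ^ 2 := (sq_abs _).symm
  have h3 : |D.g x| ≠ 0 := abs_ne_zero.2 hg
  simp only [smul_apply, smul_eq_mul, hP.deriv_g x h.1, invNorm]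
  field_simp
  linear_combination -(μ x * D.b k x) * e2

lemma flowDer_invNorm (hP : D.IsParallel Gam μ) (h : D.Reg x y) (hN : (N : ℝ) ≠ 0)
    (hg : D.g x ≠ 0) :
    flowDer D.F D.invNorm x y = -(μ x / D.g x) * D.invNorm x y * (D.bet x y / D.F x y) := by
  have e : ∀ n, pdy D.invNorm n x y = 0 := by
    intro n; simp [pdy, invNorm]
  rw [flowDer_eq hP h (w := fun k => -(μ x / D.g x) * D.invNorm x y * D.b k x) fun k => by
    simp [e, (pdx_invNorm hP h hN hg).2]]
  simp only [e, mul_zero, Finset.sum_const_zero, sub_zero]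
  have : ∑ k, y k * (-(μ x / D.g x) * D.invNorm x y * D.b k x)
      = -(μ x / D.g x) * D.invNorm x y * D.bet x y := by
    rw [bet, Finset.mul_sum]
    exact Finset.sum_congr rfl fun k _ => by ring
  rw [this]
  ring

lemma partDiffAt_alphaE (hP : D.IsParallel Gam μ) (h : D.Reg x y) (hg : D.g x ≠ 0) (i : Fin N) :
    PartDiffAt (D.alphaE i) x y := by
  have hN : (N : ℝ) ≠ 0 := by
    have := i.pos
    positivity
  exact PartDiffAt.mul ⟨(pdx_invNorm hP h hN hg).1, differentiableAt_const _⟩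
    ((smoothFun_aE i).partDiffAt h)

/-- The vector `α_i` is parallel along `l`: the factor `1/g` in the `A`-special relation is
compensated by the derivative of `‖A‖ = N |g| / 2`, and `𝓗_{ik} lᵏ = 0`. -/
lemma flowDer_alphaE (hP : D.IsParallel Gam μ) (h : D.Reg x y) (hg : D.g x ≠ 0) (i : Fin N) :
    flowDer D.F (D.alphaE i) x y = ∑ n, flowConn D.F n i x y * D.alphaE n x y := by
  have hN : (N : ℝ) ≠ 0 := by
    have := i.pos
    positivity
  have hd : PartDiffAt D.invNorm x y :=
    ⟨(pdx_invNorm hP h hN hg).1, differentiableAt_const _⟩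
  have e1 : dot₁ D.F D.aE i x y = μ x * (D.bet x y / D.F x y)
      * (N / 2 * (D.F x y / D.B x y) * D.nLow i x y) := by
    have a1 : ∀ m, hCov₁ D.F D.aE i m x y * lUp D.F m x y
        = μ x / D.F x y * (N / 2 * (D.F x y / D.B x y) * D.nLow i x y) * (D.b m x * y m)
          + μ x * N * D.g x / (4 * D.F x y * D.q x y)
            * (D.B x y * D.MF x y - D.bet x y * D.q x y) * D.J x y / D.F x y
            * (y m * D.r m i x y) := by
      intro m
      rw [hCov₁_aE hP h, lUp, r_symm m i]
      ring
    simp only [dot₁, a1, Finset.sum_add_distrib, ← Finset.mul_sum, sum_y_r h]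
    change _ * D.bet x y + _ = _
    ring
  rw [dot₁_eq, sub_eq_iff_eq_add'] at e1
  have e2 : ∑ n, flowConn D.F n i x y * D.alphaE n x y
      = D.invNorm x y * ∑ n, flowConn D.F n i x y * D.aE n x y := by
    rw [Finset.mul_sum]
    exact Finset.sum_congr rfl fun n _ => by unfold alphaE; ring
  have e3 : flowDer D.F (D.alphaE i) x y = _ := flowDer_mul hd ((smoothFun_aE i).partDiffAt h)
  rw [e3, e1, flowDer_invNorm hP h hN hg, e2]
  generalize ∑ n, flowConn D.F n i x y * D.aE n x y = s
  unfold aE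
  field_simp
  ring

lemma dot₁_alphaVec (hP : D.IsParallel Gam μ) (h : D.Reg x y) (hg : D.g x ≠ 0) (i : Fin N) :
    dot₁ D.F (alphaVec D.F) i x y = 0 := by
  rw [dot₁_eq, flowDer_congr (alphaVec_eq i) h, flowDer_alphaE hP h hg]
  simp only [alphaVec_eq _ x y h, sub_self]

lemma dot₃_alphaTensor (hP : D.IsParallel Gam μ) (h : D.Reg x y) (hg : D.g x ≠ 0)
    (i j k : Fin N) : dot₃ D.F (alphaTensor D.F) i j k x y = 0 := by
  have := dot₃_eq_zero (F := D.F) (1 / N) (fun _ _ _ => rfl)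
    (fun i => partDiffAt_alphaE hP h hg i)
    (fun i j => (smoothFun_rhoE i j).partDiffAt h) (fun i => flowDer_alphaE hP h hg i)
    (fun i j => flowDer_rhoE hP h i j) i j k
  rw [dot₃_eq] at this ⊢
  simp only [flowDer_congr (alphaTensor_eq i j k) h, fun i j k => alphaTensor_eq i j k x y h]
  exact this

lemma calH_eq (h : D.Reg x y) (hg : D.g x ≠ 0) (i k : Fin N) :
    calH D.F i k x y = D.J x y * D.r i k x y := by
  have hB := (B_pos h).ne'
  have hF := (F_pos h).ne'
  have hN : (N : ℝ) ≠ 0 := by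
    have := i.pos
    positivity
  have hl : ∀ i, lLow D.F i x y = D.J x y / D.F x y * D.mLow i x y := by
    intro i
    have a1 : ∀ j, gLow D.F i j x y * lUp D.F j x y
        = 1 / D.F x y * (D.con x y (D.bet x y) (D.q x y) j * D.gE j i x y) := by
      intro j
      rw [gLow_eq i j x y h, lUp, gE_symm, ← y_eq_con h]
      ring
    simp only [lLow, a1, ← Finset.mul_sum]
    unfold gE
    rw [con_ten h]
    unfold mLow cov
    field_simp
    rw [B_eq]
    ring
  have hll : lLow D.F i x y * lLow D.F k x y
      = D.J x y / D.B x y * (D.mLow i x y * D.mLow k x y) := by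
    rw [hl, hl, show D.J x y / D.F x y * D.mLow i x y * (D.J x y / D.F x y * D.mLow k x y)
      = D.J x y ^ 2 / D.F x y ^ 2 * (D.mLow i x y * D.mLow k x y) by field_simp, F_sq h]
    field_simp
  have hαα : alphaVec D.F i x y * alphaVec D.F k x y
      = D.J x y / D.B x y * (D.nLow i x y * D.nLow k x y) := by
    have e : (D.invNorm x y * (N / 2) * D.g x) ^ 2 = 1 := by
      have e : D.g x ^ 2 = |D.g x| ^ 2 := (sq_abs _).symm
      have hg' : |D.g x| ≠ 0 := abs_ne_zero.2 hg
      unfold invNorm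
      field_simp
      rw [e]
    rw [alphaVec_eq i x y h, alphaVec_eq k x y h]
    unfold alphaE aE
    rw [show D.invNorm x y * (N / 2 * (D.g x * D.F x y / D.B x y) * D.nLow i x y)
        * (D.invNorm x y * (N / 2 * (D.g x * D.F x y / D.B x y) * D.nLow k x y))
      = (D.invNorm x y * (N / 2) * D.g x) ^ 2 * (D.F x y ^ 2 / D.B x y ^ 2
        * (D.nLow i x y * D.nLow k x y)) by ring, e, F_sq h]
    field_simp
  rw [calH, angular, hll, hαα, gLow_eq i k x y h]
  unfold gE mLow nLow ten cov
  ring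

end FinsleroidChart

/-! ### From the manifold to coordinates -/

namespace FinsleroidSpace

open Finsleroid Finsler

variable {N : ℕ} {M : Type*} [TopologicalSpace M] [ChartedSpace (Vec N) M]
  {φ : OpenPartialHomeomorph M (Vec N)}

/-- The coordinate vector fields of a chart are linearly independent. -/
lemma chartVec_eq_zero (hφ : φ ∈ IsManifold.maximalAtlas (𝓡 N) ∞ M) {x : Vec N}
    (hx : x ∈ φ.target) {v : Vec N} (hv : chartVec φ x v = 0) : v = 0 := by
  have h1 : ContMDiffOn (𝓡 N) (𝓡 N) ∞ φ.symm φ.target := contMDiffOn_symm_of_mem_maximalAtlas hφ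
  have h2 : ContMDiffOn (𝓡 N) (𝓡 N) ∞ φ φ.source := contMDiffOn_of_mem_maximalAtlas hφ
  have h3 : φ.MDifferentiable (𝓡 N) (𝓡 N) :=
    ⟨h2.mdifferentiableOn (by simp), h1.mdifferentiableOn (by simp)⟩
  have h4 := h3.comp_symm_deriv hx
  have h5 := congrArg (fun L => L v) h4
  change (mfderiv (𝓡 N) (𝓡 N) φ (φ.symm x)) (chartVec φ x v) = v at h5
  rw [hv] at h5
  exact h5.symm.trans (map_zero _)

lemma chartVec_eq_sum (x y : Vec N) :
    chartVec φ x y = ∑ i, y i • chartVec φ x (EuclideanSpace.single i 1) := by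
  have : y = ∑ i, y i • (EuclideanSpace.single i (1 : ℝ) : Vec N) := by
    ext j; simp [Pi.single_apply]
  conv_lhs => rw [this]
  unfold chartVec
  exact (map_sum _ _ _).trans (Finset.sum_congr rfl fun i _ => map_smul _ _ _)

variable [IsManifold (𝓡 N) ∞ M] (D : FinsleroidSpace N M)

/-- A constant-coefficient vector field in the chart `φ` is smooth. -/
lemma contMDiffOn_chartVec (hφ : φ ∈ IsManifold.maximalAtlas (𝓡 N) ∞ M) (v : Vec N) :
    ContMDiffOn (𝓡 N) ((𝓡 N).prod 𝓘(ℝ, Vec N)) ∞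
      (fun x => Bundle.TotalSpace.mk' (Vec N) (E := fun p : M => TangentSpace (𝓡 N) p)
        (φ.symm x) (chartVec φ x v)) φ.target := by
  have h1 : ContMDiffOn (𝓡 N) (𝓡 N) ∞ φ.symm φ.target := contMDiffOn_symm_of_mem_maximalAtlas hφ
  -- the field is the tangent map of `φ.symm` composed with a constant vector field on `ℝ^N`
  have h2 := h1.contMDiffOn_tangentMapWithin (m := ∞) (by simp) φ.open_target.uniqueMDiffOn
  have h3 : ContMDiff (𝓡 N) (𝓡 N).tangent ∞
      (fun x : Vec N => (⟨x, v⟩ : TangentBundle (𝓡 N) (Vec N))) := by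
    intro x
    rw [Bundle.contMDiffAt_totalSpace]
    refine ⟨contMDiffAt_id, ?_⟩
    simpa using contMDiffAt_const
  have h4 := h2.comp h3.contMDiffOn (s := φ.target) (fun x hx => hx)
  refine h4.congr fun x hx => ?_
  simp only [Function.comp, tangentMapWithin, chartVec]
  rw [mfderivWithin_of_isOpen φ.open_target hx]

lemma contDiffOn_formComp (hφ : φ ∈ IsManifold.maximalAtlas (𝓡 N) ∞ M) (i : Fin N) :
    ContDiffOn ℝ ∞ (formComp D.b φ i) φ.target := by
  have h1 : ContMDiffOn (𝓡 N) (𝓡 N) ∞ φ.symm φ.target := contMDiffOn_symm_of_mem_maximalAtlas hφ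
  have h2 := D.b_smooth.comp_contMDiffOn h1
  have h3 := contMDiffOn_chartVec hφ (EuclideanSpace.single i 1)
  have h4 := ContMDiffOn.clm_bundle_apply (F₁ := Vec N) (F₂ := ℝ) (IB := 𝓡 N) (IM := 𝓡 N)
    (E₁ := fun p : M => TangentSpace (𝓡 N) p) (E₂ := fun _ : M => ℝ)
    (b := φ.symm) (ϕ := fun x => D.b (φ.symm x)) h2 h3
  rw [← contMDiffOn_iff_contDiffOn]
  intro x hx
  have h5 := h4 x hx
  rw [Bundle.contMDiffWithinAt_totalSpace] at h5
  exact h5.2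

lemma contDiffOn_metricMat (hφ : φ ∈ IsManifold.maximalAtlas (𝓡 N) ∞ M) (i j : Fin N) :
    ContDiffOn ℝ ∞ (fun x => metricMat D.a φ x i j) φ.target := by
  have h1 : ContMDiffOn (𝓡 N) (𝓡 N) ∞ φ.symm φ.target := contMDiffOn_symm_of_mem_maximalAtlas hφ
  have h2 := D.a.contMDiff.comp_contMDiffOn h1
  have h3 := contMDiffOn_chartVec hφ (EuclideanSpace.single i 1)
  have h3' := contMDiffOn_chartVec hφ (EuclideanSpace.single j 1)
  have h4 := ContMDiffOn.clm_bundle_apply₂ (F₁ := Vec N) (F₂ := Vec N) (F₃ := ℝ) (IB := 𝓡 N)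
    (IM := 𝓡 N) (E₁ := fun p : M => TangentSpace (𝓡 N) p)
    (E₂ := fun p : M => TangentSpace (𝓡 N) p) (E₃ := fun _ : M => ℝ)
    (b := φ.symm) (ψ := fun x => D.a.inner (φ.symm x)) h2 h3 h3'
  rw [← contMDiffOn_iff_contDiffOn]
  intro x hx
  have h5 := h4 x hx
  rw [Bundle.contMDiffWithinAt_totalSpace] at h5
  exact h5.2

lemma contDiffOn_g (hφ : φ ∈ IsManifold.maximalAtlas (𝓡 N) ∞ M) :
    ContDiffOn ℝ ∞ (fun x => D.g (φ.symm x)) φ.target := by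
  have h1 : ContMDiffOn (𝓡 N) (𝓡 N) ∞ φ.symm φ.target := contMDiffOn_symm_of_mem_maximalAtlas hφ
  exact contMDiffOn_iff_contDiffOn.1 (D.g_smooth.comp_contMDiffOn h1)

lemma b_chartVec (x y : Vec N) :
    D.b (φ.symm x) (chartVec φ x y) = ∑ i, formComp D.b φ i x * y i := by
  rw [chartVec_eq_sum, map_sum]
  exact Finset.sum_congr rfl fun i _ => by rw [map_smul, smul_eq_mul, mul_comm]; rfl

lemma a_chartVec (x y : Vec N) : D.a.inner (φ.symm x) (chartVec φ x y) (chartVec φ x y)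
    = ∑ i, (∑ j, metricMat D.a φ x i j * y j) * y i := by
  have h1 : ∀ w, D.a.inner (φ.symm x) w (chartVec φ x y)
      = ∑ j, D.a.inner (φ.symm x) w (chartVec φ x (EuclideanSpace.single j 1)) * y j := by
    intro w
    refine (congrArg _ (chartVec_eq_sum x y)).trans ((map_sum _ _ _).trans ?_)
    exact Finset.sum_congr rfl fun j _ => by rw [map_smul, smul_eq_mul, mul_comm]
  rw [h1]
  simp_rw [D.a.symm _ (chartVec φ x y), h1, Finset.sum_mul]
  rfl

lemma metricMat_symm (x : Vec N) (i j : Fin N) :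
    metricMat D.a φ x i j = metricMat D.a φ x j i := D.a.symm _ _ _

/-- A null vector of the matrix `a_{ij}` would be the components of a tangent vector of zero
length. -/
lemma isUnit_det_metricMat (hφ : φ ∈ IsManifold.maximalAtlas (𝓡 N) ∞ M) {x : Vec N}
    (hx : x ∈ φ.target) : IsUnit (metricMat D.a φ x).det := by
  rw [isUnit_iff_ne_zero]
  intro h0
  obtain ⟨v, hv, hv'⟩ := Matrix.exists_mulVec_eq_zero_iff.2 h0
  refine hv ?_
  have h1 : D.a.inner (φ.symm x) (chartVec φ x (WithLp.toLp 2 v)) (chartVec φ x (WithLp.toLp 2 v))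
      = 0 := by
    rw [a_chartVec]
    refine Finset.sum_eq_zero fun i _ => ?_
    have := congrFun hv' i
    simp only [Matrix.mulVec, dotProduct, Pi.zero_apply] at this
    simp [this]
  have h2 : chartVec φ x (WithLp.toLp 2 v) = 0 := by
    by_contra h
    exact (D.a.pos _ _ h).ne' h1
  have h3 := chartVec_eq_zero hφ hx h2
  exact congrArg WithLp.ofLp h3

/-- The components of the data of a Finsleroid space in a chart. -/
def toChart (φ : OpenPartialHomeomorph M (Vec N))
    (hφ : φ ∈ IsManifold.maximalAtlas (𝓡 N) ∞ M) : FinsleroidChart N where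
  U := φ.target
  isOpen := φ.open_target
  a := metricMat D.a φ
  b := formComp D.b φ
  g := fun x => D.g (φ.symm x)
  a_smooth := D.contDiffOn_metricMat hφ
  b_smooth := D.contDiffOn_formComp hφ
  g_smooth := D.contDiffOn_g hφ
  a_symm := D.metricMat_symm
  a_unit := fun _ hx => D.isUnit_det_metricMat hφ hx
  b_unit := D.b_unit φ hφ
  g_gt := fun _ => D.g_gt _
  g_lt := fun _ => D.g_lt _

lemma riemChristoffel_symm (x : Vec N) (n i k : Fin N) :
    D.riemChristoffel φ n i k x = D.riemChristoffel φ n k i x := by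
  unfold riemChristoffel
  simp_rw [D.metricMat_symm (φ := φ) _ k i]
  congr 1
  exact Finset.sum_congr rfl fun m _ => by ring

/-- The Christoffel symbols with the upper index lowered are those of the first kind. -/
lemma sum_riemChristoffel_mul (hφ : φ ∈ IsManifold.maximalAtlas (𝓡 N) ∞ M) {x : Vec N}
    (hx : x ∈ φ.target) (i j k : Fin N) :
    ∑ n, D.riemChristoffel φ n i k x * metricMat D.a φ x n j
      = (1 / 2) * (fderiv ℝ (fun x' => metricMat D.a φ x' j i) x (EuclideanSpace.single k 1)
        + fderiv ℝ (fun x' => metricMat D.a φ x' j k) x (EuclideanSpace.single i 1)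
        - fderiv ℝ (fun x' => metricMat D.a φ x' k i) x (EuclideanSpace.single j 1)) := by
  have h1 : ∀ m, ∑ n, metricMat D.a φ x j n * (metricMat D.a φ x)⁻¹ n m
      = (1 : Matrix (Fin N) (Fin N) ℝ) j m := by
    intro m
    rw [← Matrix.mul_apply, Matrix.mul_nonsing_inv _ (D.isUnit_det_metricMat hφ hx)]
  have h2 : ∀ v : Fin N → ℝ,
      ∑ n, (1 / 2) * (∑ m, (metricMat D.a φ x)⁻¹ n m * v m) * metricMat D.a φ x n j
        = (1 / 2) * v j := by
    intro v
    have h3 : ∑ n, ∑ m, metricMat D.a φ x j n * (metricMat D.a φ x)⁻¹ n m * v m = v j := by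
      rw [Finset.sum_comm]
      simp_rw [← Finset.sum_mul, h1]
      simp [Matrix.one_apply]
    rw [← h3, Finset.mul_sum]
    refine Finset.sum_congr rfl fun n _ => ?_
    rw [D.metricMat_symm x n j, mul_assoc, Finset.sum_mul]
    congr 1
    exact Finset.sum_congr rfl fun m _ => by ring
  exact h2 _

variable (hφ : φ ∈ IsManifold.maximalAtlas (𝓡 N) ∞ M)

lemma toChart_bet (x y : Vec N) : D.b (φ.symm x) (chartVec φ x y) = (D.toChart φ hφ).bet x y :=
  D.b_chartVec x y

lemma toChart_q (x y : Vec N) : D.q (chartVec φ x y) = (D.toChart φ hφ).q x y := by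
  unfold q FinsleroidChart.q
  rw [D.a_chartVec, D.toChart_bet hφ]
  rfl

lemma toChart_B (x y : Vec N) : D.B (chartVec φ x y) = (D.toChart φ hφ).B x y := by
  unfold B
  rw [D.toChart_q hφ, D.toChart_bet hφ]
  rfl

lemma toChart_f (x y : Vec N) : D.f (chartVec φ x y)
    = angleFun ((D.toChart φ hφ).g x) ((D.toChart φ hφ).bet x y) ((D.toChart φ hφ).q x y) := by
  unfold f L
  rw [D.toChart_q hφ, D.toChart_bet hφ]
  rfl

lemma Kloc_eq : D.Kloc φ = (D.toChart φ hφ).F := by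
  funext x y
  unfold Kloc K
  rw [D.toChart_B hφ, D.toChart_f hφ]
  rfl

lemma toChart_Mfun (x y : Vec N) : D.Mfun (chartVec φ x y) = (D.toChart φ hφ).MF x y := by
  unfold Mfun
  rw [D.toChart_B hφ, D.toChart_f hφ, D.toChart_q hφ, D.toChart_bet hφ]
  rfl

lemma toChart_eta (μ : M → ℝ) (x y : Vec N) : D.eta (chartVec φ x y) μ
    = μ (φ.symm x) * N * (D.toChart φ hφ).g x
        / (4 * (D.toChart φ hφ).F x y * (D.toChart φ hφ).q x y)
      * ((D.toChart φ hφ).B x y * (D.toChart φ hφ).MF x y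
        - (D.toChart φ hφ).bet x y * (D.toChart φ hφ).q x y) := by
  unfold eta
  rw [D.toChart_Mfun hφ, D.toChart_B hφ, D.toChart_q hφ, D.toChart_bet hφ, ← D.Kloc_eq hφ]
  rfl

/-- The hypotheses on the space, in coordinates. -/
lemma toChart_isParallel {μ : M → ℝ} (hinv : D.IsInvolutive μ) (hpar : D.IsBParallel) :
    (D.toChart φ hφ).IsParallel (fun x n i k => D.riemChristoffel φ n i k x)
      (fun x => μ (φ.symm x)) where
  symm := D.riemChristoffel_symm
  deriv_a := by
    intro x hx i j k
    change fderiv ℝ (fun x' => metricMat D.a φ x' i j) x _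
      = ∑ n, D.riemChristoffel φ n i k x * metricMat D.a φ x n j
        + ∑ n, D.riemChristoffel φ n j k x * metricMat D.a φ x i n
    simp_rw [D.metricMat_symm x i]
    rw [D.sum_riemChristoffel_mul hφ hx, D.sum_riemChristoffel_mul hφ hx]
    simp_rw [D.metricMat_symm (φ := φ) _ j i, D.metricMat_symm (φ := φ) _ k i,
      D.metricMat_symm (φ := φ) _ k j]
    ring
  deriv_b := by
    intro x hx i k
    have h := hpar φ hφ x hx k i
    unfold nablaB at h
    refine (sub_eq_zero.1 h).trans (Finset.sum_congr rfl fun n _ => ?_)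
    rw [mul_comm, D.riemChristoffel_symm]
    rfl
  deriv_g := fun x hx k => hinv φ hφ x hx k

end FinsleroidSpace

end

/-- In a `b`-parallel involutive Finsleroid--Finsler space, in any local coordinates and at any line
element `(x, y)` with `g(x) ≠ 0` and `y` not collinear to `b`: the metric function is positive and
smooth, the tensor `g_{ij}` is invertible and `‖A‖ > 0` (so that all objects are well defined); the
relation `A_{i|k} = (1/g) g_k A_i + η 𝓗_{ik}` holds; and `α̇_{ijk} = 0`, `α̇_i = 0`. -/
theorem theorem3p1 {N : ℕ} (hN : 2 ≤ N) {M : Type*} [TopologicalSpace M]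
    [ChartedSpace (Vec N) M] [IsManifold (𝓡 N) ∞ M]
    (D : FinsleroidSpace N M) (μ : M → ℝ) (hinv : D.IsInvolutive μ) (hpar : D.IsBParallel)
    (φ : OpenPartialHomeomorph M (Vec N)) (hφ : φ ∈ IsManifold.maximalAtlas (𝓡 N) ∞ M)
    (x : Vec N) (hx : x ∈ φ.target) (y : Vec N)
    (hg : D.g (φ.symm x) ≠ 0) (hq : D.q (chartVec φ x y) ≠ 0) :
    (0 < D.Kloc φ x y ∧
      ContDiffAt ℝ ∞ (fun z : Vec N × Vec N => D.Kloc φ z.1 z.2) (x, y) ∧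
      IsUnit (Finsler.gMat (D.Kloc φ) x y).det ∧
      0 < Finsler.cartanNorm (D.Kloc φ) x y) ∧
    (∀ i k : Fin N,
      Finsler.hCov₁ (D.Kloc φ) (Finsler.cartanVec (D.Kloc φ)) i k x y =
        1 / D.g (φ.symm x) * D.gradG φ k x * Finsler.cartanVec (D.Kloc φ) i x y +
          D.eta (chartVec φ x y) μ * Finsler.calH (D.Kloc φ) i k x y) ∧
    (∀ i j k : Fin N,
      Finsler.dot₃ (D.Kloc φ) (Finsler.alphaTensor (D.Kloc φ)) i j k x y = 0) ∧
    (∀ i : Fin N, Finsler.dot₁ (D.Kloc φ) (Finsler.alphaVec (D.Kloc φ)) i x y = 0) := by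
  have hP := D.toChart_isParallel hφ hinv hpar
  have hpos : 0 < (D.toChart φ hφ).q x y :=
    (Real.sqrt_nonneg _).lt_of_ne' (by rwa [D.toChart_q hφ] at hq)
  have h : (D.toChart φ hφ).Reg x y := ⟨hx, hpos⟩
  have hg' : (D.toChart φ hφ).g x ≠ 0 := hg
  rw [D.Kloc_eq hφ]
  refine ⟨⟨FinsleroidChart.F_pos h, FinsleroidChart.contDiffAt_F h,
    FinsleroidChart.isUnit_det_gMat h, ?_⟩, fun i k => ?_,
    fun i j k => FinsleroidChart.dot₃_alphaTensor hP h hg' i j k,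
    fun i => FinsleroidChart.dot₁_alphaVec hP h hg' i⟩
  · rw [FinsleroidChart.cartanNorm_eq x y h]
    have : (0 : ℝ) < N := by exact_mod_cast (by omega : 0 < N)
    have := abs_pos.2 hg'
    positivity
  · have hgrad : D.gradG φ k x = μ (φ.symm x) * (D.toChart φ hφ).b k x := hinv φ hφ x hx k
    have hgx : D.g (φ.symm x) = (D.toChart φ hφ).g x := rfl
    rw [FinsleroidChart.hCov₁_congr FinsleroidChart.cartanVec_eq h,
      FinsleroidChart.hCov₁_aE hP h, FinsleroidChart.calH_eq h hg',
      FinsleroidChart.cartanVec_eq i x y h, hgrad, D.toChart_eta hφ, hgx]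
    unfold FinsleroidChart.aE
    field_simp
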